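/- **Theorem (major semi-axis and focal distance of the conformal range).** Let $A$ be a linear operator on a $2$-dimensional complex Hilbert space. Put $$D_A=\det\left(A-\tfrac{\operatorname{tr}A}{2}\mathrm{Id}\right),\qquad U_A=\tfrac12\operatorname{tr}\left(\left(A-\tfrac{\operatorname{tr}A}{2}\mathrm{Id}\right)^*\left(A-\tfrac{\operatorname{tr}A}{2}\mathrm{Id}\right)\right),\qquad E_A=\left(\tfrac{\operatorname{Im}\operatorname{tr}A}{2}\right)^2+\tfrac{|D_A|-\operatorname{Re}D_A}{2}.$$ Consider the conformal range $$K=\left\{\left(\frac{2\operatorname{Re}\langle Ax,x\rangle}{|Ax|^2+|x|^2},\frac{|Ax|^2-|x|^2}{|Ax|^2+|x|^2}\right):x\neq0\right\}$$ as a subset of the closed unit disk, regarded as the Beltrami–Cayley–Klein model of the asymptotically closed hyperbolic plane. Its asymptotic points are the points of the unit circle, its other points are called ordinary, and its distance is $$d(p,q)=\operatorname{arcosh}\frac{1-p\cdot q}{\sqrt{1-p\cdot p}\,\sqrt{1-q\cdot q}}$$ for ordinary points, while an asymptotic point has distance $+\infty$ from every other point and $0$ from itself. Lines are the chords, with their two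 asymptotic endpoints included. For an asymptotic point $\xi$ let $$b_\xi(x)=\log\frac{1-\xi\cdot x}{\sqrt{1-x\cdot x}},$$ so that $b_\xi(x)-c$ is the signed distance (negative inside) of the ordinary point $x$ from the horocycle $\{b_\xi=c\}$. A (generalized) *major axis* of $K$ is a segment of the following kind: if $K$ has no asymptotic point, a diameter, contained in $K$, of the disk of minimal hyperbolic radius containing $K$; if $K$ has exactly one asymptotic point, the intersection of $K$ with a line that is an axis of symmetry of $K$; if $K$ has two asymptotic points, a line contained in $K$. Its length is the distance $d$ of its endpoints. The (generalized) *foci* of $K$ are a pair of points of one of the following kinds: * ordinary points $F_1,F_2$ such that, for some finite $m\ge d(F_1,F_2)$, $K=\{x: d(F_1,x)+d(F_2,x)\le m\}$; * an ordinary point $F$ and an asymptotic point $\xi$ such that, for some real $c\ge b_\xi(F)$, $K$ consists of $\xi$ and of the ordinary points $x$ with $d(F,x)+b_\xi(x)-c\le0$; * distinct asymptotic points $\xi,\eta$ such that, for some finite $r\ge0$, $K$ is the set of points of distance at most $r$ from the line $\xi\eta$ (with $\xi,\eta$ included); * an asymptotic point $\xi$, taken twice, such that $K=\{\xi\}$,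 or such that, for some real $c$, $K$ consists of $\xi$ and of the ordinary points $x$ with $b_\xi(x)\le c$. In the formulas below let $\frac a0=+\infty$ for $a>0$, $\frac00=1$, and $\operatorname{arcosh}(+\infty)=+\infty$. Then: 1. $K$ has a major axis, and for every major axis of $K$ half of its length is $$s^+=\frac12\operatorname{arcosh}\frac{U_A+E_A}{\bigl|E_A-|D_A|\bigr|}.$$ 2. $K$ has a pair of foci, and for every pair of foci of $K$ half of their distance is $$s^{\mathrm f}=\frac12\operatorname{arcosh}\frac{E_A+|D_A|}{\bigl|E_A-|D_A|\bigr|}.$$ -/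

import Mathlib

open scoped ENNReal NNReal

noncomputable section

namespace ConformalRange

/-! ## Numerical quantities attached to an operator on a two-dimensional Hilbert space -/

section Operators

variable {H : Type*} [NormedAddCommGroup H] [InnerProductSpace ℂ H] [FiniteDimensional ℂ H]

/-- The traceless part `A - (tr A / 2) Id`. -/
def traceless (A : H →ₗ[ℂ] H) : H →ₗ[ℂ] H :=
  A - (LinearMap.trace ℂ H A / 2) • LinearMap.id

/-- The spectral discriminant `D_A = det (A - (tr A / 2) Id)`. -/
def specDisc (A : H →ₗ[ℂ] H) : ℂ :=
  LinearMap.det (traceless A)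

/-- The metric discriminant
`U_A = ½ tr ((A - (tr A / 2) Id)^* (A - (tr A / 2) Id))` (the trace is a real number). -/
def metricDisc (A : H →ₗ[ℂ] H) : ℝ :=
  (LinearMap.trace ℂ H (LinearMap.adjoint (traceless A) ∘ₗ traceless A)).re / 2

/-- `E_A = (Im tr A / 2)² + (|D_A| - Re D_A) / 2`. -/
def conjDisc (A : H →ₗ[ℂ] H) : ℝ :=
  ((LinearMap.trace ℂ H A).im / 2) ^ 2 + (‖specDisc A‖ - (specDisc A).re) / 2

/-- The conformal range (real Davis--Wielandt shell) of `A` in the Beltrami--Cayley--Klein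
model. -/
def conformalRange (A : H →ₗ[ℂ] H) : Set (ℝ × ℝ) :=
  {P | ∃ x : H, x ≠ 0 ∧
    P = (2 * (inner ℂ (A x) x).re / (‖A x‖ ^ 2 + ‖x‖ ^ 2),
      (‖A x‖ ^ 2 - ‖x‖ ^ 2) / (‖A x‖ ^ 2 + ‖x‖ ^ 2))}

end Operators

/-! ## The asymptotically closed hyperbolic plane in the Beltrami--Cayley--Klein model

The points are those of the closed unit disk of `ℝ × ℝ`; the ones on the unit circle are the
asymptotic points. Asymptotically closed lines are the Euclidean segments `segment ℝ a b` whose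
endpoints `a ≠ b` lie on the unit circle, and hyperbolic segments (and half-lines) are
Euclidean segments. -/

/-- The Euclidean scalar product of the coordinates. -/
def dot (p q : ℝ × ℝ) : ℝ := p.1 * q.1 + p.2 * q.2

/-- Ordinary points. -/
def IsOrdinary (p : ℝ × ℝ) : Prop := dot p p < 1

/-- Asymptotic points. -/
def IsAsymptotic (p : ℝ × ℝ) : Prop := dot p p = 1

/-- The asymptotically closed hyperbolic plane. -/
def closedPlane : Set (ℝ × ℝ) := {p | dot p p ≤ 1}

/-- The hyperbolic distance (curvature `-1`) of two ordinary points. -/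
def ordDist (p q : ℝ × ℝ) : ℝ :=
  Real.arcosh ((1 - dot p q) / (√(1 - dot p p) * √(1 - dot q q)))

open Classical in
/-- The `[0, ∞]`-valued distance on the asymptotically closed plane: the distance of an
asymptotic point to any other point is `∞`. -/
def hdist (p q : ℝ × ℝ) : ℝ≥0∞ :=
  if p = q then 0
  else if IsOrdinary p ∧ IsOrdinary q then ENNReal.ofReal (ordDist p q)
  else ∞

/-- The hyperbolic disk of center `c` and radius `r`. -/
def hdisk (c : ℝ × ℝ) (r : ℝ≥0) : Set (ℝ × ℝ) := {x ∈ closedPlane | hdist c x ≤ r}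

/-- The regularized distance of an ordinary point `x` from the asymptotic point `ξ`. Its level
set `{x | horoDist ξ x = c}` is a horocycle with asymptotic point `ξ`, and
`horoDist ξ x - c` is the signed distance of `x` from that horocycle, negative inside. -/
def horoDist (ξ x : ℝ × ℝ) : ℝ := Real.log ((1 - dot ξ x) / √(1 - dot x x))

/-- The hyperbolic reflection in the line with asymptotic points `a` and `b`. In homogeneous
coordinates, with `X = (x, 1)`, `A = (a, 1)`, `B = (b, 1)` and the form
`⟨X, Y⟩ = x₁ y₁ + x₂ y₂ - x₃ y₃`, it is
`X ↦ 2 (⟨X, B⟩ A + ⟨X, A⟩ B) / ⟨A, B⟩ - X`. -/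
def hreflection (a b x : ℝ × ℝ) : ℝ × ℝ :=
  (2 * ((dot x b - 1) + (dot x a - 1)) / (dot a b - 1) - 1)⁻¹ •
    ((2 / (dot a b - 1)) • ((dot x b - 1) • a + (dot x a - 1) • b) - x)

/-- The line with asymptotic points `a` and `b` is an axis of symmetry of `K`. -/
def IsSymmetryAxis (K : Set (ℝ × ℝ)) (a b : ℝ × ℝ) : Prop :=
  IsAsymptotic a ∧ IsAsymptotic b ∧ a ≠ b ∧ hreflection a b '' K = K

/-! ## Major axes and foci of (possibly degenerate) elliptical disks -/

/-- `IsMajorAxis K p q`: the segment with endpoints `p` and `q` is a (generalized) major axis of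
the possibly degenerate elliptical disk `K` of the asymptotically closed plane, according to
whether `K` has no, one or two asymptotic points. -/
inductive IsMajorAxis (K : Set (ℝ × ℝ)) : ℝ × ℝ → ℝ × ℝ → Prop
  /-- `K` has no asymptotic point (elliptical disk, disk, segment, ordinary point): a diameter,
  lying in `K`, of the disk of minimal radius that contains `K`. -/
  | bounded (p q c : ℝ × ℝ) (r : ℝ≥0)
      (hK : ∀ x ∈ K, IsOrdinary x)
      (hc : IsOrdinary c)
      (hsub : K ⊆ hdisk c r)
      (hmin : ∀ (c' : ℝ × ℝ) (r' : ℝ≥0), IsOrdinary c' → K ⊆ hdisk c' r' → r ≤ r')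
      (hcpq : c ∈ segment ℝ p q)
      (hp : hdist c p = r)
      (hq : hdist c q = r)
      (hpq : segment ℝ p q ⊆ K) : IsMajorAxis K p q
  /-- `K` has a single asymptotic point (elliptic parabolic disk, horodisk, half-line, asymptotic
  point): the intersection of `K` with an axis of symmetry. -/
  | semibounded (p q a b ξ : ℝ × ℝ)
      (hK : {x ∈ K | IsAsymptotic x} = {ξ})
      (hab : IsSymmetryAxis K a b)
      (hpq : K ∩ segment ℝ a b = segment ℝ p q) : IsMajorAxis K p q
  /-- `K` has two asymptotic points (distance band, line): a line contained in `K`. -/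
  | band (p q : ℝ × ℝ)
      (hp : IsAsymptotic p) (hq : IsAsymptotic q) (hne : p ≠ q)
      (hpq : segment ℝ p q ⊆ K) : IsMajorAxis K p q

/-- `IsFociPair K F₁ F₂`: the points `F₁` and `F₂` are the (generalized) foci of the possibly
degenerate elliptical disk `K` of the asymptotically closed plane, where asymptotic points are
allowed to act as foci. -/
inductive IsFociPair (K : Set (ℝ × ℝ)) : ℝ × ℝ → ℝ × ℝ → Prop
  /-- `K` is the elliptical disk with foci `F₁`, `F₂` and length of major axis `m` (a disk if
  `F₁ = F₂`; the segment, or point, from `F₁` to `F₂` if `m` is their distance). -/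
  | ellipse (F₁ F₂ : ℝ × ℝ) (m : ℝ≥0)
      (h₁ : IsOrdinary F₁) (h₂ : IsOrdinary F₂) (hm : hdist F₁ F₂ ≤ m)
      (hK : K = {x ∈ closedPlane | hdist F₁ x + hdist F₂ x ≤ m}) : IsFociPair K F₁ F₂
  /-- `K` is the asymptotically closed elliptic parabolic disk with focus `F` and horocycle
  `{x | horoDist ξ x = c}`, where `F` is inside the horocycle (or on it, in which case `K` is
  the half-line from `F` to `ξ`). -/
  | parabola (F ξ : ℝ × ℝ) (c : ℝ)
      (hF : IsOrdinary F) (hξ : IsAsymptotic ξ) (hc : horoDist ξ F - c ≤ 0)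
      (hK : K = insert ξ {x | IsOrdinary x ∧ ordDist F x + (horoDist ξ x - c) ≤ 0}) :
      IsFociPair K F ξ
  /-- `K` is the asymptotically closed distance band of radius `r` around the line with
  asymptotic points `ξ`, `η` (the line itself if `r = 0`). -/
  | band (ξ η : ℝ × ℝ) (r : ℝ≥0)
      (hξ : IsAsymptotic ξ) (hη : IsAsymptotic η) (hne : ξ ≠ η)
      (hK : K = {x ∈ closedPlane | (⨅ y ∈ segment ℝ ξ η, hdist x y) ≤ r}) : IsFociPair K ξ η
  /-- `K` is an asymptotically closed horodisk, whose asymptotic point is a double focus. -/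
  | horodisk (ξ : ℝ × ℝ) (c : ℝ)
      (hξ : IsAsymptotic ξ)
      (hK : K = insert ξ {x | IsOrdinary x ∧ horoDist ξ x - c ≤ 0}) : IsFociPair K ξ ξ
  /-- `K` is an asymptotic point, which is a double focus. -/
  | asymptoticPoint (ξ : ℝ × ℝ)
      (hξ : IsAsymptotic ξ) (hK : K = {ξ}) : IsFociPair K ξ ξ

/-! ## Extended arithmetic -/

/-- The quotient `a / b` of nonnegative real numbers with the conventions
`a / 0 = ∞` for `a ≠ 0`, and `0 / 0 = 1`. -/
def extQuot (a b : ℝ) : ℝ≥0∞ :=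
  if b = 0 then (if a = 0 then 1 else ∞) else ENNReal.ofReal (a / b)

/-- The function `arcosh` extended by `arcosh ∞ = ∞`. -/
def extArcosh (t : ℝ≥0∞) : ℝ≥0∞ :=
  if t = ∞ then ∞ else ENNReal.ofReal (Real.arcosh t.toReal)

end ConformalRange

end

namespace ConformalRange

/-! ## Minkowski space and the hyperboloid model -/

/-! Take an orthonormal basis in which `A` is upper triangular, with diagonal `x₁ + i y₁`, `x₂ + i
y₂` and off-diagonal entry `β`; put `B = |β|²` and `N = y₁² + y₂² + (x₁ - x₂)²`. Then `E_A - |D_A| =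
y₁ y₂`, `E_A + |D_A| = N / 2` and `U_A + E_A = (N + B) / 2`. When `y₁ y₂ ≠ 0`, the claim is thus
that `K` is an elliptical disk whose foci are at the distance `arcosh (N / (2|y₁ y₂|))`, which is
the distance of `x₁ + i|y₁|` and `x₂ + i|y₂|` in the upper half-plane, and whose major axis has
length `arcosh ((N + B) / (2|y₁ y₂|))`.

For unit vectors `v` the pairs `(u, q) = (Re ⟨Av, v⟩, |Av|²)` form the shell; a projective chart
taking the parabola `q = u²` to the unit circle maps it onto `K` (`conformalRange_eq_image`). The
shell is an affine image of the unit sphere of `ℝ³`. For `B > 0` the affine map has rank two, and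
the shell is the filled ellipse `0 ≤ conic` (`IsTriangular.shell_eq_conic`); for `B = 0` it is a
segment.

Let `F_j` be the image of `(x_j, x_j² + y_j²)` and `d_j` the distance from `F_j`. In the chart `q +
x_j² + y_j² - 2 u x_j` equals `2|y_j| √(q - u²) cosh d_j`, so for `y₁ y₂ ≠ 0` and `M = (N + B) /
(2|y₁ y₂|)` the polynomial `conic` is a positive multiple of `(M - cosh (d₁ + d₂)) (M - cosh (d₁ -
d₂))`. For `B > 0` the second factor is positive, and what remains is `d₁ + d₂ ≤ arcosh M`
(`IsShell.eq_ellipse`). A vanishing `y_j` sends `F_j` to the circle and turns its distance into a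
Busemann function: the same polynomial then describes an elliptic parabolic disk, a band or a
horodisk.

All major axes and all pairs of foci are concerned, so both lengths must be recovered from `K`
alone. For an elliptical disk the length `m` of the major axis is the diameter of `K`, and the focal
distance `2f` follows from the minor semi-axis `b` through `cosh b * cosh f = cosh (m / 2)`
(`ellipse_focal_le`). If `K` has asymptotic points, the lengths are `0` or `∞`; the substantial
points are that an elliptic parabolic disk is never a horodisk (`parabola_ne_horodisk`), and that an
axis of symmetry meets `K` in its asymptotic point and in a further point if there is one
(`exists_mem_axis`). -/

/-- The Minkowski form on `ℝ³`, positive on timelike vectors. -/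
def mink (X Y : ℝ × ℝ × ℝ) : ℝ := X.2.2 * Y.2.2 - X.1 * Y.1 - X.2.1 * Y.2.1

lemma mink_comm (X Y : ℝ × ℝ × ℝ) : mink X Y = mink Y X := by simp only [mink]; ring

lemma mink_add_left (X Y Z : ℝ × ℝ × ℝ) : mink (X + Y) Z = mink X Z + mink Y Z := by
  simp only [mink, Prod.fst_add, Prod.snd_add]; ring

lemma mink_sub_left (X Y Z : ℝ × ℝ × ℝ) : mink (X - Y) Z = mink X Z - mink Y Z := by
  simp only [mink, Prod.fst_sub, Prod.snd_sub]; ring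

lemma mink_smul_left (r : ℝ) (X Y : ℝ × ℝ × ℝ) : mink (r • X) Y = r * mink X Y := by
  simp only [mink, Prod.smul_fst, Prod.smul_snd, smul_eq_mul]; ring

lemma mink_add_right (X Y Z : ℝ × ℝ × ℝ) : mink Z (X + Y) = mink Z X + mink Z Y := by
  simp only [mink_comm Z, mink_add_left]

lemma mink_sub_right (X Y Z : ℝ × ℝ × ℝ) : mink Z (X - Y) = mink Z X - mink Z Y := by
  simp only [mink_comm Z, mink_sub_left]

lemma mink_smul_right (r : ℝ) (X Y : ℝ × ℝ × ℝ) : mink Y (r • X) = r * mink Y X := by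
  simp only [mink_comm Y, mink_smul_left]

/-- The homogeneous coordinates of a point. -/
def hom (p : ℝ × ℝ) : ℝ × ℝ × ℝ := (p.1, p.2, 1)

/-- The point with given homogeneous coordinates. -/
noncomputable def toDisk (X : ℝ × ℝ × ℝ) : ℝ × ℝ := (X.1 / X.2.2, X.2.1 / X.2.2)

/-- The point of the hyperboloid that corresponds to an ordinary point. -/
noncomputable def lift (p : ℝ × ℝ) : ℝ × ℝ × ℝ := (√(1 - dot p p))⁻¹ • hom p

/-- The points of the upper sheet of the unit hyperboloid. -/
def IsUnitTimelike (X : ℝ × ℝ × ℝ) : Prop := mink X X = 1 ∧ 0 < X.2.2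

lemma mink_hom (p q : ℝ × ℝ) : mink (hom p) (hom q) = 1 - dot p q := by
  simp only [mink, hom, dot]; ring

lemma dot_comm (p q : ℝ × ℝ) : dot p q = dot q p := by simp only [dot]; ring

lemma toDisk_hom (p : ℝ × ℝ) : toDisk (hom p) = p := by simp [toDisk, hom]

lemma toDisk_smul {r : ℝ} (hr : r ≠ 0) (X : ℝ × ℝ × ℝ) : toDisk (r • X) = toDisk X := by
  simp only [toDisk, Prod.smul_fst, Prod.smul_snd, smul_eq_mul]
  rw [mul_div_mul_left _ _ hr, mul_div_mul_left _ _ hr]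

lemma hom_toDisk {X : ℝ × ℝ × ℝ} (hX : X.2.2 ≠ 0) : hom (toDisk X) = X.2.2⁻¹ • X := by
  simp only [toDisk, hom, Prod.ext_iff, Prod.smul_fst, Prod.smul_snd, smul_eq_mul]
  refine ⟨by ring, by ring, by field_simp⟩

lemma one_sub_dot_toDisk {X Y : ℝ × ℝ × ℝ} (hX : X.2.2 ≠ 0) (hY : Y.2.2 ≠ 0) :
    1 - dot (toDisk X) (toDisk Y) = mink X Y / (X.2.2 * Y.2.2) := by
  rw [← mink_hom, hom_toDisk hX, hom_toDisk hY, mink_smul_left, mink_smul_right]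
  field_simp

lemma IsOrdinary.sqrt_pos {p : ℝ × ℝ} (hp : IsOrdinary p) : 0 < √(1 - dot p p) :=
  Real.sqrt_pos.2 (sub_pos.2 hp)

lemma isUnitTimelike_lift {p : ℝ × ℝ} (hp : IsOrdinary p) : IsUnitTimelike (lift p) := by
  have h := hp.sqrt_pos
  constructor
  · rw [lift, mink_smul_left, mink_smul_right, mink_hom]
    have h2 : √(1 - dot p p) * √(1 - dot p p) = 1 - dot p p :=
      Real.mul_self_sqrt (sub_nonneg.2 (le_of_lt hp))
    field_simp
    rw [sq, h2]
  · simp only [lift, hom, Prod.smul_snd, smul_eq_mul]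
    positivity

lemma toDisk_lift {p : ℝ × ℝ} (hp : IsOrdinary p) : toDisk (lift p) = p := by
  rw [lift, toDisk_smul (inv_ne_zero hp.sqrt_pos.ne'), toDisk_hom]

lemma isOrdinary_toDisk {X : ℝ × ℝ × ℝ} (hz : X.2.2 ≠ 0) (hX : 0 < mink X X) :
    IsOrdinary (toDisk X) := by
  have h := one_sub_dot_toDisk hz hz
  have : 0 < mink X X / (X.2.2 * X.2.2) := div_pos hX (mul_self_pos.2 hz)
  rw [← h] at this
  exact sub_pos.1 this

lemma lift_toDisk_of_pos {X : ℝ × ℝ × ℝ} (hz : 0 < X.2.2) (hX : 0 < mink X X) :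
    lift (toDisk X) = (√(mink X X))⁻¹ • X := by
  rw [lift, one_sub_dot_toDisk hz.ne' hz.ne', hom_toDisk hz.ne', smul_smul]
  congr 1
  rw [Real.sqrt_div hX.le, Real.sqrt_mul_self hz.le]
  have := Real.sqrt_pos.2 hX
  field_simp

lemma IsUnitTimelike.isOrdinary {X : ℝ × ℝ × ℝ} (hX : IsUnitTimelike X) :
    IsOrdinary (toDisk X) :=
  isOrdinary_toDisk hX.2.ne' (by rw [hX.1]; exact one_pos)

lemma IsUnitTimelike.lift_toDisk {X : ℝ × ℝ × ℝ} (hX : IsUnitTimelike X) :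
    lift (toDisk X) = X := by
  rw [lift_toDisk_of_pos hX.2 (by rw [hX.1]; exact one_pos), hX.1]; simp

lemma mink_lift (p q : ℝ × ℝ) : mink (lift p) (lift q) =
    (1 - dot p q) / (√(1 - dot p p) * √(1 - dot q q)) := by
  rw [lift, lift, mink_smul_left, mink_smul_right, mink_hom]
  rw [div_eq_mul_inv, mul_inv]; ring

lemma ordDist_eq (p q : ℝ × ℝ) : ordDist p q = Real.arcosh (mink (lift p) (lift q)) := by
  rw [mink_lift, ordDist]

lemma ordDist_comm (p q : ℝ × ℝ) : ordDist p q = ordDist q p := by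
  rw [ordDist_eq, ordDist_eq, mink_comm]

/-- A vector orthogonal to a timelike vector is spacelike. -/
lemma IsUnitTimelike.mink_nonpos {X W : ℝ × ℝ × ℝ} (hX : IsUnitTimelike X)
    (hW : mink W X = 0) : mink W W ≤ 0 := by
  obtain ⟨h1, h2⟩ := hX
  obtain ⟨a, b, c⟩ := X
  obtain ⟨d, e, f⟩ := W
  simp only [mink] at *
  have h3 : c ^ 2 * (d ^ 2 + e ^ 2 - f ^ 2) ≥ 0 := by
    have : f * c = d * a + e * b := by linarith
    have h4 : (f * c) ^ 2 = (d * a + e * b) ^ 2 := by rw [this]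
    nlinarith [sq_nonneg (d * b - e * a), sq_nonneg d, sq_nonneg e]
  have := nonneg_of_mul_nonneg_right h3 (by positivity)
  nlinarith

/-- The form is negative definite on the complement of a timelike vector. Equality cases below use
this: the deviation from equality is a vector `W` orthogonal to a point of the hyperboloid with
`mink W W ≥ 0`. -/
lemma IsUnitTimelike.eq_zero {X W : ℝ × ℝ × ℝ} (hX : IsUnitTimelike X)
    (hW : mink W X = 0) (hWW : 0 ≤ mink W W) : W = 0 := by
  obtain ⟨h1, h2⟩ := hX
  obtain ⟨a, b, c⟩ := X
  obtain ⟨d, e, f⟩ := W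
  simp only [mink] at *
  have h3 : f * c = d * a + e * b := by linarith
  have h4 : (f * c) ^ 2 = (d * a + e * b) ^ 2 := by rw [h3]
  have h5 : d ^ 2 + e ^ 2 ≤ 0 := by
    nlinarith [sq_nonneg (d * b - e * a), mul_nonneg hWW (sq_nonneg c)]
  have hd : d = 0 := by nlinarith [sq_nonneg d, sq_nonneg e]
  have he : e = 0 := by nlinarith [sq_nonneg d, sq_nonneg e]
  have hf : f = 0 := by
    subst hd he
    have : f * c = 0 := by linarith
    exact (mul_eq_zero.1 this).resolve_right h2.ne'
  simp [hd, he, hf]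

/-- Reversed Cauchy–Schwarz inequality: the component of `Y` orthogonal to `X` has square `1 - (mink
X Y)²`, which is nonpositive, and the common sheet makes `mink X Y` positive. -/
lemma IsUnitTimelike.one_le_mink {X Y : ℝ × ℝ × ℝ} (hX : IsUnitTimelike X)
    (hY : IsUnitTimelike Y) : 1 ≤ mink X Y := by
  have hpos : 0 < mink X Y := by
    obtain ⟨h1, h2⟩ := hX
    obtain ⟨h3, h4⟩ := hY
    obtain ⟨a, b, c⟩ := X
    obtain ⟨d, e, f⟩ := Y
    simp only [mink] at *
    have h5 : a * d + b * e < c * f := by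
      apply lt_of_pow_lt_pow_left₀ 2 (by positivity)
      have h6 : c ^ 2 = 1 + a ^ 2 + b ^ 2 := by linarith
      have h7 : f ^ 2 = 1 + d ^ 2 + e ^ 2 := by linarith
      rw [mul_pow, h6, h7]
      nlinarith [sq_nonneg (a * e - b * d), sq_nonneg a, sq_nonneg b, sq_nonneg d, sq_nonneg e]
    linarith
  have h := hX.mink_nonpos (W := Y - mink X Y • X) (by
    rw [mink_sub_left, mink_smul_left, hX.1, mink_comm Y X]; ring)
  simp only [mink_sub_left, mink_smul_left, mink_sub_right, mink_smul_right, hX.1, hY.1,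
    mink_comm Y X] at h
  nlinarith

lemma IsUnitTimelike.eq_of_mink_le_one {X Y : ℝ × ℝ × ℝ} (hX : IsUnitTimelike X)
    (hY : IsUnitTimelike Y) (h : mink X Y ≤ 1) : X = Y := by
  have h1 := le_antisymm h (hX.one_le_mink hY)
  have h2 := hX.eq_zero (W := X - Y) (by
    rw [mink_sub_left, hX.1, mink_comm Y X, h1]; ring) (by
    simp only [mink_sub_left, mink_sub_right, hX.1, hY.1, mink_comm Y X, h1]; norm_num)
  exact sub_eq_zero.1 h2

/-- The Gram determinant of three points of the hyperboloid is a square. -/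
lemma gram_nonneg {X Y Z : ℝ × ℝ × ℝ} (hX : IsUnitTimelike X) (hY : IsUnitTimelike Y)
    (hZ : IsUnitTimelike Z) :
    (mink X Z - mink X Y * mink Y Z) ^ 2 ≤ (mink X Y ^ 2 - 1) * (mink Y Z ^ 2 - 1) := by
  have key : mink X X * mink Y Y * mink Z Z + 2 * mink X Y * mink Y Z * mink X Z
      - mink X X * mink Y Z ^ 2 - mink Y Y * mink X Z ^ 2 - mink Z Z * mink X Y ^ 2 =
      (X.1 * (Y.2.1 * Z.2.2 - Y.2.2 * Z.2.1) - X.2.1 * (Y.1 * Z.2.2 - Y.2.2 * Z.1)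
        + X.2.2 * (Y.1 * Z.2.1 - Y.2.1 * Z.1)) ^ 2 := by
    simp only [mink]; ring
  rw [hX.1, hY.1, hZ.1] at key
  nlinarith [sq_nonneg (X.1 * (Y.2.1 * Z.2.2 - Y.2.2 * Z.2.1)
    - X.2.1 * (Y.1 * Z.2.2 - Y.2.2 * Z.1) + X.2.2 * (Y.1 * Z.2.1 - Y.2.1 * Z.1))]

lemma one_le_mink_lift {p q : ℝ × ℝ} (hp : IsOrdinary p) (hq : IsOrdinary q) :
    1 ≤ mink (lift p) (lift q) :=
  (isUnitTimelike_lift hp).one_le_mink (isUnitTimelike_lift hq)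

lemma cosh_ordDist {p q : ℝ × ℝ} (hp : IsOrdinary p) (hq : IsOrdinary q) :
    Real.cosh (ordDist p q) = mink (lift p) (lift q) := by
  rw [ordDist_eq, Real.cosh_arcosh (one_le_mink_lift hp hq)]

lemma ordDist_nonneg {p q : ℝ × ℝ} (hp : IsOrdinary p) (hq : IsOrdinary q) :
    0 ≤ ordDist p q := by
  rw [ordDist_eq]; exact Real.arcosh_nonneg (one_le_mink_lift hp hq)

lemma ordDist_self {p : ℝ × ℝ} (hp : IsOrdinary p) : ordDist p p = 0 := by
  rw [ordDist_eq, (isUnitTimelike_lift hp).1]; simp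

lemma cosh_le_cosh_iff {x y : ℝ} (hx : 0 ≤ x) (hy : 0 ≤ y) :
    Real.cosh x ≤ Real.cosh y ↔ x ≤ y := by
  rw [Real.cosh_le_cosh, abs_of_nonneg hx, abs_of_nonneg hy]

lemma eq_of_cosh_eq {x y : ℝ} (hx : 0 ≤ x) (hy : 0 ≤ y)
    (h : Real.cosh x = Real.cosh y) : x = y :=
  Real.cosh_injOn hx hy h

/-- The Gram inequality says that `cosh d(p, r)` differs from `cosh * cosh` by at most `sinh *
sinh`; the addition formulas turn this into both triangle inequalities. -/
lemma mink_lift_le_cosh_add {p q r : ℝ × ℝ} (hp : IsOrdinary p) (hq : IsOrdinary q)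
    (hr : IsOrdinary r) :
    mink (lift p) (lift r) ≤ Real.cosh (ordDist p q + ordDist q r) ∧
      Real.cosh (ordDist p q - ordDist q r) ≤ mink (lift p) (lift r) := by
  have h := gram_nonneg (isUnitTimelike_lift hp) (isUnitTimelike_lift hq) (isUnitTimelike_lift hr)
  rw [← cosh_ordDist hp hq, ← cosh_ordDist hq hr, ← Real.sinh_sq, ← Real.sinh_sq, ← mul_pow] at h
  have h0 : 0 ≤ Real.sinh (ordDist p q) * Real.sinh (ordDist q r) :=
    mul_nonneg (Real.sinh_nonneg_iff.2 (ordDist_nonneg hp hq))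
      (Real.sinh_nonneg_iff.2 (ordDist_nonneg hq hr))
  have h1 := abs_le_of_sq_le_sq' h h0
  rw [Real.cosh_add, Real.cosh_sub]
  constructor <;> linarith [h1.1, h1.2]

lemma ordDist_triangle {p q r : ℝ × ℝ} (hp : IsOrdinary p) (hq : IsOrdinary q)
    (hr : IsOrdinary r) : ordDist p r ≤ ordDist p q + ordDist q r := by
  have h := (mink_lift_le_cosh_add hp hq hr).1
  rwa [← cosh_ordDist hp hr, cosh_le_cosh_iff (ordDist_nonneg hp hr)
    (add_nonneg (ordDist_nonneg hp hq) (ordDist_nonneg hq hr))] at h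

lemma eq_of_ordDist_eq_zero {p q : ℝ × ℝ} (hp : IsOrdinary p) (hq : IsOrdinary q)
    (h : ordDist p q = 0) : p = q := by
  have h1 := cosh_ordDist hp hq
  rw [h, Real.cosh_zero] at h1
  rw [← toDisk_lift hp, ← toDisk_lift hq,
    (isUnitTimelike_lift hp).eq_of_mink_le_one (isUnitTimelike_lift hq) h1.symm.le]

/-! ## The extended distance -/

lemma IsAsymptotic.not_isOrdinary {p : ℝ × ℝ} (hp : IsAsymptotic p) : ¬ IsOrdinary p := by
  intro h
  rw [IsOrdinary, hp] at h
  exact lt_irrefl _ h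

lemma isOrdinary_or_isAsymptotic {p : ℝ × ℝ} (hp : p ∈ closedPlane) :
    IsOrdinary p ∨ IsAsymptotic p := lt_or_eq_of_le hp

lemma hdist_ordinary {p q : ℝ × ℝ} (hp : IsOrdinary p) (hq : IsOrdinary q) :
    hdist p q = ENNReal.ofReal (ordDist p q) := by
  rw [hdist]
  split_ifs with h1 h2
  · rw [h1, ordDist_self hq, ENNReal.ofReal_zero]
  · rfl
  · exact absurd ⟨hp, hq⟩ h2

lemma hdist_self (p : ℝ × ℝ) : hdist p p = 0 := by simp [hdist]

lemma hdist_eq_top {p q : ℝ × ℝ} (h : IsAsymptotic p ∨ IsAsymptotic q) (hne : p ≠ q) :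
    hdist p q = ∞ := by
  rw [hdist, if_neg hne, if_neg]
  rintro ⟨h1, h2⟩
  exact h.elim (fun h => h.not_isOrdinary h1) (fun h => h.not_isOrdinary h2)

lemma hdist_ne_top_iff {p q : ℝ × ℝ} (hp : IsOrdinary p) (hq : q ∈ closedPlane) :
    hdist p q ≠ ∞ ↔ IsOrdinary q := by
  constructor
  · intro h
    refine (isOrdinary_or_isAsymptotic hq).resolve_right fun h1 => h (hdist_eq_top (Or.inr h1) ?_)
    rintro rfl
    exact h1.not_isOrdinary hp
  · intro h
    rw [hdist_ordinary hp h]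
    exact ENNReal.ofReal_ne_top

lemma ofReal_le_coe_iff {x : ℝ} {r : ℝ≥0} : ENNReal.ofReal x ≤ r ↔ x ≤ r := by
  rw [ENNReal.ofReal_le_iff_le_toReal ENNReal.coe_ne_top, ENNReal.coe_toReal]

lemma mem_hdisk {c x : ℝ × ℝ} {r : ℝ≥0} (hc : IsOrdinary c) :
    x ∈ hdisk c r ↔ IsOrdinary x ∧ ordDist c x ≤ r := by
  constructor
  · rintro ⟨hx, h⟩
    have hx' := (hdist_ne_top_iff hc hx).1 (ne_top_of_le_ne_top ENNReal.coe_ne_top h)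
    rw [hdist_ordinary hc hx', ofReal_le_coe_iff] at h
    exact ⟨hx', h⟩
  · rintro ⟨hx, h⟩
    refine ⟨le_of_lt hx, ?_⟩
    rwa [hdist_ordinary hc hx, ofReal_le_coe_iff]

/-! ## Segments -/

lemma toDisk_add_mem_segment {X Y : ℝ × ℝ × ℝ} (hX : 0 < X.2.2) (hY : 0 < Y.2.2) {a b : ℝ}
    (ha : 0 ≤ a) (hb : 0 ≤ b) (hab : 0 < a + b) :
    toDisk (a • X + b • Y) ∈ segment ℝ (toDisk X) (toDisk Y) := by
  have hz : 0 < a * X.2.2 + b * Y.2.2 := by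
    rcases ha.eq_or_lt with h | h
    · subst h
      have : 0 < b := by linarith
      positivity
    · positivity
  refine ⟨a * X.2.2 / (a * X.2.2 + b * Y.2.2), b * Y.2.2 / (a * X.2.2 + b * Y.2.2),
    by positivity, by positivity, by field_simp, ?_⟩
  simp only [toDisk, Prod.ext_iff, Prod.smul_fst, Prod.smul_snd, smul_eq_mul, Prod.fst_add,
    Prod.snd_add]
  constructor <;> field_simp

lemma hom_of_mem_segment {p q x : ℝ × ℝ} (hx : x ∈ segment ℝ p q) :
    ∃ a b : ℝ, 0 ≤ a ∧ 0 ≤ b ∧ a + b = 1 ∧ hom x = a • hom p + b • hom q := by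
  obtain ⟨a, b, ha, hb, hab, rfl⟩ := hx
  refine ⟨a, b, ha, hb, hab, ?_⟩
  simp [hom, hab]

lemma two_dot_le (p q : ℝ × ℝ) : 2 * dot p q ≤ dot p p + dot q q := by
  simp only [dot]; nlinarith [sq_nonneg (p.1 - q.1), sq_nonneg (p.2 - q.2)]

lemma mink_hom_pos_of_left {p q : ℝ × ℝ} (hp : IsOrdinary p) (hq : q ∈ closedPlane) :
    0 < mink (hom p) (hom q) := by
  have h1 : dot p p < 1 := hp
  have h2 : dot q q ≤ 1 := hq
  rw [mink_hom]
  linarith [two_dot_le p q]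

lemma isOrdinary_of_mem_segment {p q x : ℝ × ℝ} (hp : IsOrdinary p) (hq : IsOrdinary q)
    (hx : x ∈ segment ℝ p q) : IsOrdinary x := by
  obtain ⟨a, b, ha, hb, hab, h⟩ := hom_of_mem_segment hx
  have h1 : dot p p < 1 := hp
  have h2 : dot q q < 1 := hq
  have h3 : mink (hom x) (hom x) =
      a ^ 2 * (1 - dot p p) + b ^ 2 * (1 - dot q q) + 2 * a * b * (1 - dot p q) := by
    rw [h]
    simp only [mink_add_left, mink_add_right, mink_smul_left, mink_smul_right, mink_hom,
      dot_comm q p]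
    ring
  have h4 : 0 < 1 - dot p q := by linarith [two_dot_le p q]
  rw [mink_hom] at h3
  have : 0 < 1 - dot x x := by
    rw [h3]
    rcases ha.eq_or_lt with h | h
    · subst h
      have : b = 1 := by linarith
      subst this
      linarith
    · have : 0 < a ^ 2 * (1 - dot p p) := mul_pos (by positivity) (by linarith)
      have : 0 ≤ b ^ 2 * (1 - dot q q) := mul_nonneg (by positivity) (by linarith)
      have : 0 ≤ 2 * a * b * (1 - dot p q) := mul_nonneg (by positivity) h4.le
      linarith
  exact sub_pos.1 this

lemma lift_of_mem_segment {p q x : ℝ × ℝ} (hp : IsOrdinary p) (hq : IsOrdinary q)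
    (hx : x ∈ segment ℝ p q) :
    ∃ a b : ℝ, 0 ≤ a ∧ 0 ≤ b ∧ lift x = a • lift p + b • lift q := by
  have hxo := isOrdinary_of_mem_segment hp hq hx
  obtain ⟨a, b, ha, hb, hab, h⟩ := hom_of_mem_segment hx
  have h1 := hp.sqrt_pos
  have h2 := hq.sqrt_pos
  have h3 := hxo.sqrt_pos
  refine ⟨(√(1 - dot x x))⁻¹ * a * √(1 - dot p p), (√(1 - dot x x))⁻¹ * b * √(1 - dot q q),
    by positivity, by positivity, ?_⟩
  simp only [lift, h, smul_add, smul_smul]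
  congr 2 <;> field_simp

lemma sinh_ordDist_sq {p q : ℝ × ℝ} (hp : IsOrdinary p) (hq : IsOrdinary q) :
    Real.sinh (ordDist p q) ^ 2 = mink (lift p) (lift q) ^ 2 - 1 := by
  rw [Real.sinh_sq, cosh_ordDist hp hq]

lemma sinh_ordDist_nonneg {p q : ℝ × ℝ} (hp : IsOrdinary p) (hq : IsOrdinary q) :
    0 ≤ Real.sinh (ordDist p q) :=
  Real.sinh_nonneg_iff.2 (ordDist_nonneg hp hq)

/-- If `lift x = a • lift p + b • lift q`, then `sinh d(p, x)` and `sinh d(x, q)` are `b` and `a`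
times `sinh d(p, q)`, and the addition formula for `cosh` gives the sum. -/
lemma ordDist_add_of_mem_segment {p q x : ℝ × ℝ} (hp : IsOrdinary p) (hq : IsOrdinary q)
    (hx : x ∈ segment ℝ p q) : ordDist p x + ordDist x q = ordDist p q := by
  have hxo := isOrdinary_of_mem_segment hp hq hx
  obtain ⟨a, b, ha, hb, h⟩ := lift_of_mem_segment hp hq hx
  have hX := (isUnitTimelike_lift hxo).1
  have hpx : mink (lift p) (lift x) = a + b * mink (lift p) (lift q) := by
    rw [h, mink_add_right, mink_smul_right, mink_smul_right, (isUnitTimelike_lift hp).1]; ring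
  have hxq : mink (lift x) (lift q) = a * mink (lift p) (lift q) + b := by
    rw [h, mink_add_left, mink_smul_left, mink_smul_left, (isUnitTimelike_lift hq).1]; ring
  have h1 : a ^ 2 + b ^ 2 + 2 * a * b * mink (lift p) (lift q) = 1 := by
    rw [← hX, h]
    simp only [mink_add_left, mink_add_right, mink_smul_left, mink_smul_right,
      (isUnitTimelike_lift hp).1, (isUnitTimelike_lift hq).1, mink_comm (lift q)]
    ring
  have hs := sinh_ordDist_nonneg hp hq
  have hs2 := sinh_ordDist_sq hp hq
  have s1 : Real.sinh (ordDist p x) = b * Real.sinh (ordDist p q) := by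
    rw [← sq_eq_sq₀ (sinh_ordDist_nonneg hp hxo) (by positivity), sinh_ordDist_sq hp hxo,
      mul_pow, hs2, hpx]
    linear_combination h1
  have s2 : Real.sinh (ordDist x q) = a * Real.sinh (ordDist p q) := by
    rw [← sq_eq_sq₀ (sinh_ordDist_nonneg hxo hq) (by positivity), sinh_ordDist_sq hxo hq,
      mul_pow, hs2, hxq]
    linear_combination h1
  apply eq_of_cosh_eq (add_nonneg (ordDist_nonneg hp hxo) (ordDist_nonneg hxo hq))
    (ordDist_nonneg hp hq)
  rw [Real.cosh_add, s1, s2, cosh_ordDist hp hxo, cosh_ordDist hxo hq, cosh_ordDist hp hq,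
    hpx, hxq]
  linear_combination a * b * hs2 + mink (lift p) (lift q) * h1

lemma mem_segment_of_ordDist_add_le {p q x : ℝ × ℝ} (hp : IsOrdinary p) (hq : IsOrdinary q)
    (hx : IsOrdinary x) (h : ordDist p x + ordDist x q ≤ ordDist p q) :
    x ∈ segment ℝ p q := by
  have h0 := le_antisymm h (ordDist_triangle hp hx hq)
  rcases (ordDist_nonneg hp hq).eq_or_lt with h1 | h1
  · have h2 : ordDist p x = 0 := by linarith [ordDist_nonneg hp hx, ordDist_nonneg hx hq]
    rw [← eq_of_ordDist_eq_zero hp hx h2]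
    exact left_mem_segment ℝ p q
  have hs := Real.sinh_pos_iff.2 h1
  have e1 := (cosh_ordDist hp hx).symm
  have e2 := (cosh_ordDist hx hq).symm
  have e3 := (cosh_ordDist hp hq).symm
  have f1 : Real.sinh (ordDist p q) = Real.sinh (ordDist p x) * Real.cosh (ordDist x q)
      + Real.cosh (ordDist p x) * Real.sinh (ordDist x q) := by rw [← h0, Real.sinh_add]
  have f2 : Real.cosh (ordDist p q) = Real.cosh (ordDist p x) * Real.cosh (ordDist x q)
      + Real.sinh (ordDist p x) * Real.sinh (ordDist x q) := by rw [← h0, Real.cosh_add]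
  have g1 := Real.cosh_sq (ordDist p x)
  have g2 := Real.cosh_sq (ordDist x q)
  have hP := (isUnitTimelike_lift hp).1
  have hQ := (isUnitTimelike_lift hq).1
  have hX := (isUnitTimelike_lift hx).1
  set s := Real.sinh (ordDist p q)
  set c := Real.cosh (ordDist p q)
  set s1 := Real.sinh (ordDist p x)
  set c1 := Real.cosh (ordDist p x)
  set s2 := Real.sinh (ordDist x q)
  set c2 := Real.cosh (ordDist x q)
  have hs1 : 0 ≤ s1 := sinh_ordDist_nonneg hp hx
  have hs2 : 0 ≤ s2 := sinh_ordDist_nonneg hx hq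
  -- On a geodesic, the point at distance `d₁` from `p` and `d₂` from `q` is `(sinh d₂ • p + sinh d₁
  -- • q) / sinh (d₁ + d₂)`. The defect `W` of this formula is orthogonal to `lift p` and isotropic.
  have hW := (isUnitTimelike_lift hp).eq_zero
    (W := s • lift x - s2 • lift p - s1 • lift q) (by
      simp only [mink_sub_left, mink_smul_left, hP, mink_comm (lift x) (lift p), e1,
        mink_comm (lift q) (lift p), e3]
      rw [f1, f2]
      linear_combination s2 * g1) (by
      simp only [mink_sub_left, mink_smul_left, mink_sub_right, mink_smul_right, hP, hX, hQ,
        mink_comm (lift x) (lift p), e1, mink_comm (lift q) (lift p), e3,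
        mink_comm (lift q) (lift x), e2]
      apply le_of_eq
      rw [f1, f2]
      linear_combination s2 ^ 2 * g1 + s1 ^ 2 * g2)
  have hx' : lift x = s⁻¹ • (s2 • lift p + s1 • lift q) := by
    have : s • lift x = s2 • lift p + s1 • lift q := by
      rw [sub_sub] at hW
      exact sub_eq_zero.1 hW
    rw [← this, smul_smul, inv_mul_cancel₀ hs.ne', one_smul]
  rw [← toDisk_lift hx, hx', toDisk_smul (inv_ne_zero hs.ne')]
  have hsum : 0 < s2 + s1 := by
    by_contra hcon
    have z1 : s1 = 0 := by linarith
    have z2 : s2 = 0 := by linarith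
    rw [z1, z2] at f1
    linarith
  have hmem := toDisk_add_mem_segment (isUnitTimelike_lift hp).2 (isUnitTimelike_lift hq).2
    hs2 hs1 hsum
  rwa [toDisk_lift hp, toDisk_lift hq] at hmem

/-! ## Geodesics in the hyperboloid -/

lemma isUnitTimelike_of_mink_pos {X O : ℝ × ℝ × ℝ} (hO : IsUnitTimelike O)
    (h1 : mink X X = 1) (h2 : 0 < mink X O) : IsUnitTimelike X := by
  refine ⟨h1, ?_⟩
  by_contra h
  have hz : X.2.2 ≠ 0 := by
    intro hz
    simp only [mink, hz] at h1
    nlinarith [sq_nonneg X.1, sq_nonneg X.2.1]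
  have h3 : IsUnitTimelike ((-1 : ℝ) • X) := by
    constructor
    · rw [mink_smul_left, mink_smul_right, h1]; norm_num
    · simp only [Prod.smul_snd, smul_eq_mul]
      have := lt_of_le_of_ne (not_lt.1 h) hz
      linarith
  have := h3.one_le_mink hO
  rw [mink_smul_left] at this
  linarith

/-- The geodesic through `O` with unit tangent vector `e`. -/
noncomputable def geod (O e : ℝ × ℝ × ℝ) (t : ℝ) : ℝ × ℝ × ℝ :=
  Real.cosh t • O + Real.sinh t • e

/-- `O` is a point of the hyperboloid and `e` is a unit tangent vector at `O`. -/
structure IsFrame (O e : ℝ × ℝ × ℝ) : Prop where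
  unit : IsUnitTimelike O
  tangent : mink O e = 0
  norm : mink e e = -1

lemma IsFrame.mink_geod {O e : ℝ × ℝ × ℝ} (h : IsFrame O e) (s t : ℝ) :
    mink (geod O e s) (geod O e t) = Real.cosh (s - t) := by
  simp only [geod, mink_add_left, mink_add_right, mink_smul_left, mink_smul_right, h.unit.1,
    h.tangent, mink_comm e O, h.norm, Real.cosh_sub]
  ring

lemma geod_zero (O e : ℝ × ℝ × ℝ) : geod O e 0 = O := by simp [geod]

lemma IsFrame.geod {O e : ℝ × ℝ × ℝ} (h : IsFrame O e) (t : ℝ) :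
    IsUnitTimelike (geod O e t) := by
  refine isUnitTimelike_of_mink_pos h.unit (by rw [h.mink_geod]; simp) ?_
  conv => rhs; arg 2; rw [← geod_zero O e]
  rw [h.mink_geod]
  exact Real.cosh_pos _

lemma arcosh_cosh_abs (t : ℝ) : Real.arcosh (Real.cosh t) = |t| := by
  rw [← Real.cosh_abs, Real.arcosh_cosh (abs_nonneg t)]

lemma IsFrame.ordDist_geod {O e : ℝ × ℝ × ℝ} (h : IsFrame O e) (s t : ℝ) :
    ordDist (toDisk (ConformalRange.geod O e s)) (toDisk (ConformalRange.geod O e t))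
      = |s - t| := by
  rw [ordDist_eq, (h.geod s).lift_toDisk, (h.geod t).lift_toDisk, h.mink_geod, arcosh_cosh_abs]

lemma exists_isFrame {O : ℝ × ℝ × ℝ} (hO : IsUnitTimelike O) : ∃ e, IsFrame O e := by
  obtain ⟨a, b, c⟩ := O
  have h1 := hO.1
  simp only [mink] at h1
  have h2 : c ^ 2 - a ^ 2 = 1 + b ^ 2 := by linarith
  -- The vector `(c, 0, a)` is orthogonal to `(a, b, c)` and has square `a² - c² = -(1 + b²)`.
  refine ⟨(√(1 + b ^ 2))⁻¹ • (c, 0, a), hO, ?_, ?_⟩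
  · rw [mink_smul_right]; simp only [mink]; ring
  · rw [mink_smul_left, mink_smul_right]
    simp only [mink]
    have h3 : √(1 + b ^ 2) * √(1 + b ^ 2) = 1 + b ^ 2 := Real.mul_self_sqrt (by positivity)
    have h4 : 0 < √(1 + b ^ 2) := Real.sqrt_pos.2 (by positivity)
    field_simp
    nlinarith

/-- A unit normal vector of a geodesic. -/
lemma IsFrame.exists_normal {O e : ℝ × ℝ × ℝ} (h : IsFrame O e) :
    ∃ n, IsFrame O n ∧ mink e n = 0 := by
  obtain ⟨hO, ht, hn⟩ := h
  obtain ⟨a, b, c⟩ := O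
  obtain ⟨d, k, f⟩ := e
  have hO1 := hO.1
  -- This is the Minkowski cross product of `e` and `O`, up to sign.
  refine ⟨(c * k - b * f, a * f - c * d, a * k - b * d), ⟨hO, ?_, ?_⟩, ?_⟩
  · simp only [mink]; ring
  · simp only [mink] at *
    linear_combination (f * f - d * d - k * k) * hO1 + hn - (c * f - a * d - b * k) * ht
  · simp only [mink]; ring

/-- Two ordinary points in a frame at their midpoint. -/
lemma exists_frame_of_ordinary {p q : ℝ × ℝ} (hp : IsOrdinary p) (hq : IsOrdinary q) :
    ∃ O e, IsFrame O e ∧ lift p = geod O e (ordDist p q / 2) ∧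
      lift q = geod O e (-(ordDist p q / 2)) := by
  have hP := isUnitTimelike_lift hp
  have hQ := isUnitTimelike_lift hq
  rcases (ordDist_nonneg hp hq).eq_or_lt with h | h
  · obtain ⟨e, he⟩ := exists_isFrame hP
    refine ⟨lift p, e, he, ?_, ?_⟩
    · rw [← h]; simp [geod]
    · rw [← h, ← eq_of_ordDist_eq_zero hp hq h.symm]; simp [geod]
  · set f := ordDist p q / 2 with hf
    have hf0 : 0 < f := by positivity
    have hc : mink (lift p) (lift q) = Real.cosh (2 * f) := by
      rw [← cosh_ordDist hp hq, hf]; ring_nf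
    have hC := Real.cosh_pos f
    have hS := Real.sinh_pos_iff.2 hf0
    have hcs := Real.cosh_sq f
    rw [Real.cosh_two_mul] at hc
    refine ⟨(2 * Real.cosh f)⁻¹ • (lift p + lift q), (2 * Real.sinh f)⁻¹ • (lift p - lift q),
      ⟨⟨?_, ?_⟩, ?_, ?_⟩, ?_, ?_⟩
    · simp only [mink_smul_left, mink_smul_right, mink_add_left, mink_add_right, hP.1, hQ.1,
        mink_comm (lift q) (lift p), hc]
      field_simp
      linear_combination (-2 : ℝ) * hcs
    · simp only [Prod.smul_snd, Prod.snd_add, smul_eq_mul]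
      have := hP.2
      have := hQ.2
      positivity
    · simp only [mink_smul_left, mink_smul_right, mink_add_left, mink_sub_right, hP.1, hQ.1,
        mink_comm (lift q) (lift p)]
      ring
    · simp only [mink_smul_left, mink_smul_right, mink_sub_left, mink_sub_right, hP.1, hQ.1,
        mink_comm (lift q) (lift p), hc]
      field_simp
      linear_combination (-2 : ℝ) * hcs
    · simp only [geod, smul_smul]
      rw [show Real.cosh f * (2 * Real.cosh f)⁻¹ = 1 / 2 by field_simp,
        show Real.sinh f * (2 * Real.sinh f)⁻¹ = 1 / 2 by field_simp]
      module
    · simp only [geod, smul_smul, Real.cosh_neg, Real.sinh_neg]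
      rw [show Real.cosh f * (2 * Real.cosh f)⁻¹ = 1 / 2 by field_simp,
        show -Real.sinh f * (2 * Real.sinh f)⁻¹ = -(1 / 2) by field_simp]
      module

/-! ## Elliptical disks -/

/-- The elliptical disk with given foci and length of the major axis. -/
def ellipse (F₁ F₂ : ℝ × ℝ) (m : ℝ≥0) : Set (ℝ × ℝ) :=
  {x ∈ closedPlane | hdist F₁ x + hdist F₂ x ≤ m}

lemma mem_ellipse {F₁ F₂ x : ℝ × ℝ} {m : ℝ≥0} (h₁ : IsOrdinary F₁) (h₂ : IsOrdinary F₂) :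
    x ∈ ellipse F₁ F₂ m ↔ IsOrdinary x ∧ ordDist F₁ x + ordDist F₂ x ≤ m := by
  have key : ∀ hx : IsOrdinary x, hdist F₁ x + hdist F₂ x =
      ENNReal.ofReal (ordDist F₁ x + ordDist F₂ x) := fun hx => by
    rw [hdist_ordinary h₁ hx, hdist_ordinary h₂ hx,
      ENNReal.ofReal_add (ordDist_nonneg h₁ hx) (ordDist_nonneg h₂ hx)]
  constructor
  · rintro ⟨hx, h⟩
    have hx' : IsOrdinary x := (hdist_ne_top_iff h₁ hx).1
      (ne_top_of_le_ne_top ENNReal.coe_ne_top (le_self_add.trans h))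
    rw [key hx', ofReal_le_coe_iff] at h
    exact ⟨hx', h⟩
  · rintro ⟨hx, h⟩
    refine ⟨le_of_lt hx, ?_⟩
    rwa [key hx, ofReal_le_coe_iff]

/-- Add the triangle inequalities through the two foci. Together with `exists_diameter` this makes
`m` the diameter of the set. -/
lemma ordDist_le_of_mem_ellipse {F₁ F₂ p q : ℝ × ℝ} {m : ℝ≥0} (h₁ : IsOrdinary F₁)
    (h₂ : IsOrdinary F₂) (hp : p ∈ ellipse F₁ F₂ m) (hq : q ∈ ellipse F₁ F₂ m) :
    ordDist p q ≤ m := by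
  obtain ⟨hp, hp'⟩ := (mem_ellipse h₁ h₂).1 hp
  obtain ⟨hq, hq'⟩ := (mem_ellipse h₁ h₂).1 hq
  have t1 := ordDist_triangle hp h₁ hq
  have t2 := ordDist_triangle hp h₂ hq
  rw [ordDist_comm p F₁] at t1
  rw [ordDist_comm p F₂] at t2
  linarith

lemma IsUnitTimelike.exists_eq_geod {O e X : ℝ × ℝ × ℝ} (h : IsFrame O e)
    (hX : IsUnitTimelike X) {a b : ℝ} (hab : X = a • O + b • e) : ∃ t, X = geod O e t := by
  have h1 : mink X O = a := by
    rw [hab]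
    simp only [mink_add_left, mink_smul_left, h.unit.1, mink_comm e O, h.tangent]; ring
  have h2 : a ^ 2 - b ^ 2 = 1 := by
    rw [← hX.1, hab]
    simp only [mink_add_left, mink_add_right, mink_smul_left, mink_smul_right, h.unit.1,
      mink_comm e O, h.tangent, h.norm]
    ring
  have h3 : 1 ≤ a := h1 ▸ hX.one_le_mink h.unit
  refine ⟨Real.arsinh b, ?_⟩
  rw [geod, Real.sinh_arsinh, Real.cosh_arsinh, show 1 + b ^ 2 = a ^ 2 by linarith,
    Real.sqrt_sq (by linarith), hab]

lemma cosh_add_cosh (x y : ℝ) :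
    Real.cosh x + Real.cosh y = 2 * Real.cosh ((x + y) / 2) * Real.cosh ((x - y) / 2) := by
  have h1 : Real.cosh x = Real.cosh ((x + y) / 2 + (x - y) / 2) := by ring_nf
  have h2 : Real.cosh y = Real.cosh ((x + y) / 2 - (x - y) / 2) := by ring_nf
  rw [h1, h2, Real.cosh_add, Real.cosh_sub]; ring

lemma abs_sub_ordDist_le {p q r : ℝ × ℝ} (hp : IsOrdinary p) (hq : IsOrdinary q)
    (hr : IsOrdinary r) : |ordDist p r - ordDist q r| ≤ ordDist p q := by
  have h1 := ordDist_triangle hp hq hr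
  have h2 := ordDist_triangle hq hp hr
  rw [ordDist_comm q p] at h2
  rw [abs_le]; constructor <;> linarith

/-! ### Elliptical disks in a frame at the midpoint of the foci -/

section Frame

variable {O e : ℝ × ℝ × ℝ} {F₁ F₂ : ℝ × ℝ} {f : ℝ}

/-- The hyperbolic median formula, which is `lift F₁ + lift F₂ = (2 * cosh f) • O` paired with `lift
x`. -/
lemma cosh_ordDist_center (h₁ : IsOrdinary F₁) (h₂ : IsOrdinary F₂) (h : IsFrame O e)
    (e₁ : lift F₁ = geod O e f) (e₂ : lift F₂ = geod O e (-f)) {x : ℝ × ℝ} (hx : IsOrdinary x) :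
    2 * Real.cosh f * Real.cosh (ordDist (toDisk O) x) =
      Real.cosh (ordDist F₁ x) + Real.cosh (ordDist F₂ x) := by
  rw [cosh_ordDist h.unit.isOrdinary hx, cosh_ordDist h₁ hx, cosh_ordDist h₂ hx,
    h.unit.lift_toDisk, e₁, e₂]
  simp only [geod, mink_add_left, mink_smul_left, Real.cosh_neg, Real.sinh_neg]
  ring

/-- By the median formula and `cosh_add_cosh`, `cosh f * cosh d(O, x)` is the product of the `cosh`
of the half sum and of the half difference of the focal distances; these are at most `cosh (m / 2)`
and `cosh f`. -/
lemma ellipse_subset_hdisk (h₁ : IsOrdinary F₁) (h₂ : IsOrdinary F₂) (h : IsFrame O e)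
    (e₁ : lift F₁ = geod O e f) (e₂ : lift F₂ = geod O e (-f)) (hf : ordDist F₁ F₂ = 2 * f)
    (m : ℝ≥0) : ellipse F₁ F₂ m ⊆ hdisk (toDisk O) (m / 2) := by
  intro x hx
  obtain ⟨hx, hm⟩ := (mem_ellipse h₁ h₂).1 hx
  have hO := h.unit.isOrdinary
  rw [mem_hdisk hO]
  refine ⟨hx, ?_⟩
  have hd := ordDist_nonneg h₁ hx
  have hd' := ordDist_nonneg h₂ hx
  rw [NNReal.coe_div, NNReal.coe_two, ← cosh_le_cosh_iff (ordDist_nonneg hO hx) (by positivity)]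
  have key := cosh_ordDist_center h₁ h₂ h e₁ e₂ hx
  rw [cosh_add_cosh] at key
  have a1 : Real.cosh ((ordDist F₁ x + ordDist F₂ x) / 2) ≤ Real.cosh (m / 2) := by
    rw [cosh_le_cosh_iff (by positivity) (by positivity)]
    linarith
  have a2 : Real.cosh ((ordDist F₁ x - ordDist F₂ x) / 2) ≤ Real.cosh f := by
    have := abs_sub_ordDist_le h₁ h₂ hx
    rw [Real.cosh_le_cosh, abs_div, abs_two]
    have := le_abs_self f
    linarith
  have hc := Real.cosh_pos f
  have : Real.cosh ((ordDist F₁ x + ordDist F₂ x) / 2)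
      * Real.cosh ((ordDist F₁ x - ordDist F₂ x) / 2) ≤ Real.cosh (m / 2) * Real.cosh f :=
    mul_le_mul a1 a2 (Real.cosh_pos _).le (Real.cosh_pos _).le
  nlinarith

lemma segment_subset_ellipse (h₁ : IsOrdinary F₁) (h₂ : IsOrdinary F₂) (h : IsFrame O e)
    (e₁ : lift F₁ = geod O e f) (e₂ : lift F₂ = geod O e (-f)) (hf : ordDist F₁ F₂ = 2 * f)
    {m : ℝ≥0} (hm : ordDist F₁ F₂ ≤ m) :
    segment ℝ (toDisk (geod O e (m / 2))) (toDisk (geod O e (-(m / 2)))) ⊆ ellipse F₁ F₂ m := by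
  intro x hx
  have hp := (h.geod (m / 2)).isOrdinary
  have hq := (h.geod (-(m / 2))).isOrdinary
  have hxo := isOrdinary_of_mem_segment hp hq hx
  have hsum := ordDist_add_of_mem_segment hp hq hx
  obtain ⟨a, b, -, -, hab⟩ := lift_of_mem_segment hp hq hx
  rw [(h.geod _).lift_toDisk, (h.geod _).lift_toDisk] at hab
  obtain ⟨t, ht⟩ := (isUnitTimelike_lift hxo).exists_eq_geod h
    (a := (a + b) * Real.cosh (m / 2)) (b := (a - b) * Real.sinh (m / 2)) (by
      rw [hab]; simp only [geod, Real.cosh_neg, Real.sinh_neg]; module)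
  have hxt : x = toDisk (geod O e t) := by rw [← ht, toDisk_lift hxo]
  have hF₁ : F₁ = toDisk (geod O e f) := by rw [← e₁, toDisk_lift h₁]
  have hF₂ : F₂ = toDisk (geod O e (-f)) := by rw [← e₂, toDisk_lift h₂]
  rw [mem_ellipse h₁ h₂]
  refine ⟨hxo, ?_⟩
  have d0 := ordDist_nonneg h₁ h₂
  rw [hxt, h.ordDist_geod, h.ordDist_geod, h.ordDist_geod] at hsum
  rw [hxt, hF₁, hF₂, h.ordDist_geod, h.ordDist_geod]
  have hm2 : f ≤ m / 2 := by linarith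
  have hm0 : (0 : ℝ) ≤ m := m.2
  rw [show (m / 2 - -(m / 2) : ℝ) = m by ring, abs_of_nonneg hm0] at hsum
  have c1 : t ≤ m / 2 := by linarith [le_abs_self (t - -(m / 2 : ℝ)), neg_abs_le (m / 2 - t : ℝ)]
  have c2 : -(m / 2 : ℝ) ≤ t := by
    linarith [neg_abs_le (t - -(m / 2 : ℝ)), le_abs_self (m / 2 - t : ℝ)]
  -- The sum `|f - t| + |-f - t|` is `2 * max |f| |t|`, and both values are at most `m / 2`.
  rcases abs_cases (f - t) with ⟨h1, -⟩ | ⟨h1, -⟩ <;>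
    rcases abs_cases (-f - t) with ⟨h2, -⟩ | ⟨h2, -⟩ <;> rw [h1, h2] <;> linarith

end Frame

/-- The center and the endpoints of a major axis. -/
lemma exists_diameter {F₁ F₂ : ℝ × ℝ} {m : ℝ≥0} (h₁ : IsOrdinary F₁) (h₂ : IsOrdinary F₂)
    (hm : ordDist F₁ F₂ ≤ m) : ∃ p q c : ℝ × ℝ, IsOrdinary p ∧ IsOrdinary q ∧ IsOrdinary c ∧
      ordDist p q = m ∧ ordDist c p = m / 2 ∧ ordDist c q = m / 2 ∧ c ∈ segment ℝ p q ∧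
      segment ℝ p q ⊆ ellipse F₁ F₂ m ∧ ellipse F₁ F₂ m ⊆ hdisk c (m / 2) := by
  obtain ⟨O, e, h, e₁, e₂⟩ := exists_frame_of_ordinary h₁ h₂
  have hp := (h.geod (m / 2)).isOrdinary
  have hq := (h.geod (-(m / 2))).isOrdinary
  have hO := h.unit.isOrdinary
  have hm0 : (0 : ℝ) ≤ m := m.2
  have hpq : ordDist (toDisk (geod O e (m / 2))) (toDisk (geod O e (-(m / 2)))) = m := by
    rw [h.ordDist_geod, show (m / 2 - -(m / 2) : ℝ) = m by ring, abs_of_nonneg hm0]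
  have hcp : ordDist (toDisk O) (toDisk (geod O e (m / 2))) = m / 2 := by
    conv => lhs; arg 1; rw [← geod_zero O e]
    rw [h.ordDist_geod, zero_sub, abs_neg, abs_of_nonneg (by positivity)]
  have hcq : ordDist (toDisk O) (toDisk (geod O e (-(m / 2)))) = m / 2 := by
    conv => lhs; arg 1; rw [← geod_zero O e]
    rw [h.ordDist_geod, zero_sub, neg_neg, abs_of_nonneg (by positivity)]
  refine ⟨_, _, toDisk O, hp, hq, hO, hpq, hcp, hcq, ?_,
    segment_subset_ellipse h₁ h₂ h e₁ e₂ (by ring) hm,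
    ellipse_subset_hdisk h₁ h₂ h e₁ e₂ (by ring) m⟩
  apply mem_segment_of_ordDist_add_le hp hq hO
  rw [ordDist_comm, hcp, hcq, hpq]
  linarith

/-! ### Major axes of elliptical disks -/

lemma exists_isMajorAxis_ellipse {F₁ F₂ : ℝ × ℝ} {m : ℝ≥0} (h₁ : IsOrdinary F₁)
    (h₂ : IsOrdinary F₂) (hm : ordDist F₁ F₂ ≤ m) :
    ∃ p q, IsMajorAxis (ellipse F₁ F₂ m) p q := by
  obtain ⟨p, q, c, hp, hq, hc, hpq, hcp, hcq, hmem, hseg, hsub⟩ := exists_diameter h₁ h₂ hm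
  have hh : ENNReal.ofReal (m / 2 : ℝ) = ((m / 2 : ℝ≥0) : ℝ≥0∞) := by
    rw [← ENNReal.ofReal_coe_nnreal, NNReal.coe_div, NNReal.coe_two]
  refine ⟨p, q, .bounded p q c (m / 2) (fun x hx => ((mem_ellipse h₁ h₂).1 hx).1) hc hsub ?_ hmem
    ?_ ?_ hseg⟩
  · intro c' r' hc' hsub'
    have a1 := ((mem_hdisk hc').1 (hsub' (hseg (left_mem_segment ℝ p q)))).2
    have a2 := ((mem_hdisk hc').1 (hsub' (hseg (right_mem_segment ℝ p q)))).2
    have a3 := ordDist_triangle hp hc' hq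
    rw [ordDist_comm p c'] at a3
    rw [← NNReal.coe_le_coe, NNReal.coe_div, NNReal.coe_two]
    linarith
  · rw [hdist_ordinary hc hp, hcp, hh]
  · rw [hdist_ordinary hc hq, hcq, hh]

/-- A disk of radius `r` containing `K` contains two points at distance `m`, so `m ≤ 2 r`. The given
axis has length `2 r` and lies in `K`, whose diameter is `m`. -/
lemma hdist_of_isMajorAxis_ellipse {F₁ F₂ : ℝ × ℝ} {m : ℝ≥0} (h₁ : IsOrdinary F₁)
    (h₂ : IsOrdinary F₂) (hm : ordDist F₁ F₂ ≤ m) {p q : ℝ × ℝ}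
    (h : IsMajorAxis (ellipse F₁ F₂ m) p q) : hdist p q = m := by
  have hord : ∀ x ∈ ellipse F₁ F₂ m, IsOrdinary x := fun x hx => ((mem_ellipse h₁ h₂).1 hx).1
  cases h with
  | bounded c r hK hc hsub hmin hcpq hp hq hpq =>
    have hpK := hpq (left_mem_segment ℝ p q)
    have hqK := hpq (right_mem_segment ℝ p q)
    have hpo := hord p hpK
    have hqo := hord q hqK
    have hle := ordDist_le_of_mem_ellipse h₁ h₂ hpK hqK
    obtain ⟨P, Q, -, hP, hQ, -, hPQ, -, -, -, hseg, -⟩ := exists_diameter h₁ h₂ hm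
    have a1 := ((mem_hdisk hc).1 (hsub (hseg (left_mem_segment ℝ P Q)))).2
    have a2 := ((mem_hdisk hc).1 (hsub (hseg (right_mem_segment ℝ P Q)))).2
    have a3 := ordDist_triangle hP hc hQ
    rw [ordDist_comm P c, hPQ] at a3
    have hsum := ordDist_add_of_mem_segment hpo hqo hcpq
    have e1 : ordDist c p = r := by
      rw [hdist_ordinary hc hpo] at hp
      rw [← ENNReal.toReal_ofReal (ordDist_nonneg hc hpo), hp, ENNReal.coe_toReal]
    have e2 : ordDist c q = r := by
      rw [hdist_ordinary hc hqo] at hq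
      rw [← ENNReal.toReal_ofReal (ordDist_nonneg hc hqo), hq, ENNReal.coe_toReal]
    rw [ordDist_comm p c, e1, e2] at hsum
    have : ordDist p q = m := by linarith
    rw [hdist_ordinary hpo hqo, this, ENNReal.ofReal_coe_nnreal]
  | semibounded a b ξ hK hab hpq =>
    have : ξ ∈ ({ξ} : Set (ℝ × ℝ)) := rfl
    rw [← hK] at this
    exact absurd (hord ξ this.1) this.2.not_isOrdinary
  | band hp hq hne hpq =>
    exact absurd (hord p (hpq (left_mem_segment ℝ p q))) hp.not_isOrdinary

/-! ### Recovering axis length and focal distance from an elliptical disk -/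

lemma ellipse_major_le {F₁ F₂ G₁ G₂ : ℝ × ℝ} {m m' : ℝ≥0} (h₁ : IsOrdinary F₁)
    (h₂ : IsOrdinary F₂) (hm : ordDist F₁ F₂ ≤ m) (k₁ : IsOrdinary G₁) (k₂ : IsOrdinary G₂)
    (h : ellipse F₁ F₂ m ⊆ ellipse G₁ G₂ m') : m ≤ m' := by
  obtain ⟨P, Q, -, hP, hQ, -, hPQ, -, -, -, hseg, -⟩ := exists_diameter h₁ h₂ hm
  rw [← NNReal.coe_le_coe, ← hPQ]
  exact ordDist_le_of_mem_ellipse k₁ k₂ (h (hseg (left_mem_segment ℝ P Q)))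
    (h (hseg (right_mem_segment ℝ P Q)))

/-- For a fixed major axis, the minor axis gets shorter as the foci move apart. The endpoints `P`,
`Q` of the major axis force `G₁`, `G₂` onto the segment `PQ`, symmetrically about its midpoint; the
endpoint of the minor semi-axis then bounds their distance from the midpoint. -/
lemma ellipse_focal_le {F₁ F₂ G₁ G₂ : ℝ × ℝ} {m : ℝ≥0} (h₁ : IsOrdinary F₁)
    (h₂ : IsOrdinary F₂) (hm : ordDist F₁ F₂ ≤ m) (k₁ : IsOrdinary G₁) (k₂ : IsOrdinary G₂)
    (hK : ellipse F₁ F₂ m ⊆ ellipse G₁ G₂ m) : ordDist G₁ G₂ ≤ ordDist F₁ F₂ := by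
  obtain ⟨O, e, h, e₁, e₂⟩ := exists_frame_of_ordinary h₁ h₂
  have hm0 : (0 : ℝ) ≤ m := m.2
  have hseg := (segment_subset_ellipse h₁ h₂ h e₁ e₂ (by ring) hm).trans hK
  set f := ordDist F₁ F₂ / 2 with hf
  have hf0 : 0 ≤ f := by have := ordDist_nonneg h₁ h₂; positivity
  have hp := (h.geod (m / 2)).isOrdinary
  have hq := (h.geod (-(m / 2))).isOrdinary
  have hO := h.unit.isOrdinary
  have hPQ : ordDist (toDisk (geod O e (m / 2))) (toDisk (geod O e (-(m / 2)))) = m := by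
    rw [h.ordDist_geod, show (m / 2 - -(m / 2) : ℝ) = m by ring, abs_of_nonneg hm0]
  have hP := ((mem_ellipse k₁ k₂).1 (hseg (left_mem_segment ℝ _ _))).2
  have hQ := ((mem_ellipse k₁ k₂).1 (hseg (right_mem_segment ℝ _ _))).2
  have lP := (h.geod (m / 2)).lift_toDisk
  have lQ := (h.geod (-(m / 2))).lift_toDisk
  set P := toDisk (geod O e (m / 2))
  set Q := toDisk (geod O e (-(m / 2)))
  have t1 := ordDist_triangle hp k₁ hq
  have t2 := ordDist_triangle hp k₂ hq
  rw [ordDist_comm P G₁, hPQ] at t1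
  rw [ordDist_comm P G₂, hPQ] at t2
  have hcenter : ∀ {x : ℝ × ℝ}, IsOrdinary x →
      2 * Real.cosh (m / 2) * Real.cosh (ordDist (toDisk O) x) =
        Real.cosh (ordDist P x) + Real.cosh (ordDist Q x) := fun hx =>
    cosh_ordDist_center hp hq h lP lQ hx
  -- The ellipse inequalities at `P` and `Q` add up to at most `2 m`, the triangle inequalities
  -- through `G₁` and `G₂` to at least `2 m`. All are therefore equalities, which interchanges the
  -- distances of `G₁` and `G₂` from `P` and `Q`.
  have hδ : ordDist (toDisk O) G₁ = ordDist (toDisk O) G₂ := by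
    apply eq_of_cosh_eq (ordDist_nonneg hO k₁) (ordDist_nonneg hO k₂)
    have c1 := hcenter k₁
    have c2 := hcenter k₂
    rw [ordDist_comm P, ordDist_comm Q] at c1 c2
    have i1 : ordDist G₁ Q = ordDist G₂ P := by linarith
    have i2 : ordDist G₁ P = ordDist G₂ Q := by linarith
    rw [i1, i2, add_comm, ← c2] at c1
    exact mul_left_cancel₀ (mul_ne_zero two_ne_zero (Real.cosh_pos _).ne') c1
  obtain ⟨n, hn, hen⟩ := h.exists_normal
  have hfm : Real.cosh f ≤ Real.cosh (m / 2) := by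
    rw [cosh_le_cosh_iff hf0 (by positivity)]; linarith
  have hCf := Real.cosh_pos f
  -- The minor semi-axis, from the hyperbolic Pythagorean theorem in the right triangle with legs
  -- `f`, `β` and hypotenuse `m / 2`.
  set β := Real.arcosh (Real.cosh (m / 2) / Real.cosh f) with hβ
  have hcβ : Real.cosh β * Real.cosh f = Real.cosh (m / 2) := by
    rw [hβ, Real.cosh_arcosh ((one_le_div hCf).2 hfm)]; field_simp
  have hB := hn.geod β
  have hBo := hB.isOrdinary
  have hBlin : ∀ a b : ℝ, mink (a • O + b • e) (geod O n β) = a * Real.cosh β := fun a b => by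
    simp only [geod, mink_add_left, mink_add_right, mink_smul_left, mink_smul_right, h.unit.1,
      mink_comm e O, h.tangent, hn.tangent, hen]
    ring
  have hBF : toDisk (geod O n β) ∈ ellipse F₁ F₂ m := by
    rw [mem_ellipse h₁ h₂]
    refine ⟨hBo, ?_⟩
    have b1 : ordDist F₁ (toDisk (geod O n β)) = m / 2 := by
      rw [ordDist_eq, e₁, hB.lift_toDisk, geod, hBlin, mul_comm, hcβ,
        Real.arcosh_cosh (by positivity)]
    have b2 : ordDist F₂ (toDisk (geod O n β)) = m / 2 := by
      rw [ordDist_eq, e₂, hB.lift_toDisk, geod, hBlin, Real.cosh_neg, mul_comm, hcβ,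
        Real.arcosh_cosh (by positivity)]
    rw [b1, b2]; linarith
  have hBG := ((mem_ellipse k₁ k₂).1 (hK hBF)).2
  have hBdist : ∀ {G : ℝ × ℝ}, IsOrdinary G → ordDist G P + ordDist G Q ≤ m →
      Real.cosh (ordDist G (toDisk (geod O n β))) =
        Real.cosh β * Real.cosh (ordDist (toDisk O) G) := by
    intro G hG hle
    have hmem := mem_segment_of_ordDist_add_le hp hq hG
      (by rw [ordDist_comm P, hPQ]; exact hle)
    obtain ⟨a, b, -, -, hab⟩ := lift_of_mem_segment hp hq hmem
    have hab' : lift G = ((a + b) * Real.cosh (m / 2)) • O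
        + ((a - b) * Real.sinh (m / 2)) • e := by
      rw [hab, lP, lQ]; simp only [geod, Real.cosh_neg, Real.sinh_neg]; module
    rw [cosh_ordDist hG hBo, hB.lift_toDisk, cosh_ordDist hO hG, h.unit.lift_toDisk, hab', hBlin]
    simp only [mink_add_right, mink_smul_right, h.unit.1, h.tangent]
    ring
  have d1 := hBdist k₁ (by linarith)
  have d2 := hBdist k₂ (by linarith)
  -- By symmetry the endpoint of the minor semi-axis is equally far from `G₁` and `G₂`, hence at
  -- most `m / 2` from each; Pythagoras again bounds the distance of `G₁` from the center by `f`.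
  have d3 : ordDist G₁ (toDisk (geod O n β)) = ordDist G₂ (toDisk (geod O n β)) :=
    eq_of_cosh_eq (ordDist_nonneg k₁ hBo) (ordDist_nonneg k₂ hBo) (by rw [d1, d2, hδ])
  have d4 : Real.cosh (ordDist G₁ (toDisk (geod O n β))) ≤ Real.cosh (m / 2) := by
    rw [cosh_le_cosh_iff (ordDist_nonneg k₁ hBo) (by positivity)]; linarith
  rw [d1, ← hcβ] at d4
  have d5 := le_of_mul_le_mul_left d4 (Real.cosh_pos β)
  rw [cosh_le_cosh_iff (ordDist_nonneg hO k₁) hf0] at d5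
  have t3 := ordDist_triangle k₁ hO k₂
  rw [ordDist_comm G₁ (toDisk O), ← hδ] at t3
  linarith

lemma ordDist_eq_of_ellipse_eq {F₁ F₂ G₁ G₂ : ℝ × ℝ} {m m' : ℝ≥0} (h₁ : IsOrdinary F₁)
    (h₂ : IsOrdinary F₂) (hm : ordDist F₁ F₂ ≤ m) (k₁ : IsOrdinary G₁) (k₂ : IsOrdinary G₂)
    (hm' : ordDist G₁ G₂ ≤ m') (hK : ellipse F₁ F₂ m = ellipse G₁ G₂ m') :
    ordDist F₁ F₂ = ordDist G₁ G₂ := by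
  have hmm : m = m' := le_antisymm (ellipse_major_le h₁ h₂ hm k₁ k₂ hK.subset)
    (ellipse_major_le k₁ k₂ hm' h₁ h₂ hK.superset)
  subst hmm
  exact le_antisymm (ellipse_focal_le k₁ k₂ hm' h₁ h₂ hK.superset)
    (ellipse_focal_le h₁ h₂ hm k₁ k₂ hK.subset)

lemma hdist_of_isFociPair_ellipse {F₁ F₂ : ℝ × ℝ} {m : ℝ≥0} (h₁ : IsOrdinary F₁)
    (h₂ : IsOrdinary F₂) (hm : ordDist F₁ F₂ ≤ m) {p q : ℝ × ℝ}
    (h : IsFociPair (ellipse F₁ F₂ m) p q) : hdist p q = ENNReal.ofReal (ordDist F₁ F₂) := by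
  have hord : ∀ x ∈ ellipse F₁ F₂ m, IsOrdinary x := fun x hx => ((mem_ellipse h₁ h₂).1 hx).1
  cases h with
  | ellipse _ m' hp hq hm' hK =>
    rw [hdist_ordinary hp hq] at hm' ⊢
    rw [ordDist_eq_of_ellipse_eq h₁ h₂ hm hp hq (ofReal_le_coe_iff.1 hm') hK]
  | parabola _ c hF hξ hc hK =>
    exact absurd (hord q (hK ▸ Set.mem_insert _ _)) hξ.not_isOrdinary
  | band _ r hξ hη hne hK =>
    refine absurd (hord p (hK ▸ ⟨hξ.le, ?_⟩)) hξ.not_isOrdinary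
    exact (iInf₂_le p (left_mem_segment ℝ p q)).trans (by rw [hdist_self]; exact zero_le)
  | horodisk c hξ hK =>
    exact absurd (hord p (hK ▸ Set.mem_insert _ _)) hξ.not_isOrdinary
  | asymptoticPoint hξ hK =>
    exact absurd (hord p (hK ▸ rfl)) hξ.not_isOrdinary

/-! ## Asymptotic points -/

lemma mink_hom_self {p : ℝ × ℝ} (hp : IsAsymptotic p) : mink (hom p) (hom p) = 0 := by
  rw [mink_hom, hp, sub_self]

lemma IsAsymptotic.eq_of_one_le_dot {p q : ℝ × ℝ} (hp : IsAsymptotic p) (hq : q ∈ closedPlane)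
    (h : 1 ≤ dot p q) : p = q := by
  have h1 : dot p p = 1 := hp
  have h2 : dot q q ≤ 1 := hq
  have h3 : (p.1 - q.1) ^ 2 + (p.2 - q.2) ^ 2 ≤ 0 := by simp only [dot] at *; nlinarith
  have h4 : (p.1 - q.1) ^ 2 = 0 := le_antisymm (by nlinarith [sq_nonneg (p.2 - q.2)]) (sq_nonneg _)
  have h5 : (p.2 - q.2) ^ 2 = 0 := le_antisymm (by nlinarith [sq_nonneg (p.1 - q.1)]) (sq_nonneg _)
  exact Prod.ext (sub_eq_zero.1 (pow_eq_zero_iff two_ne_zero |>.1 h4))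
    (sub_eq_zero.1 (pow_eq_zero_iff two_ne_zero |>.1 h5))

lemma IsAsymptotic.mink_hom_pos {p q : ℝ × ℝ} (hp : IsAsymptotic p) (hq : q ∈ closedPlane)
    (hne : p ≠ q) : 0 < mink (hom p) (hom q) := by
  rw [mink_hom]
  by_contra h
  exact hne (hp.eq_of_one_le_dot hq (by linarith))

lemma IsAsymptotic.mem_closedPlane {p : ℝ × ℝ} (hp : IsAsymptotic p) : p ∈ closedPlane :=
  le_of_eq hp

lemma IsOrdinary.mem_closedPlane {p : ℝ × ℝ} (hp : IsOrdinary p) : p ∈ closedPlane :=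
  le_of_lt hp

/-- Strict convexity of the disk: `|a p + b q|² = a |p|² + b |q|² - a b |p - q|²` when `a + b = 1`.
-/
lemma isOrdinary_or_eq_of_mem_segment {p q x : ℝ × ℝ} (hp : p ∈ closedPlane)
    (hq : q ∈ closedPlane) (hx : x ∈ segment ℝ p q) : x = p ∨ x = q ∨ IsOrdinary x := by
  by_cases hpq : p = q
  · subst hpq
    rw [segment_same] at hx
    exact Or.inl hx
  obtain ⟨a, b, ha, hb, hab, rfl⟩ := hx
  rcases ha.eq_or_lt with h | h
  · subst h
    right; left
    rw [show b = 1 by linarith]; simp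
  rcases hb.eq_or_lt with h' | h'
  · subst h'
    left
    rw [show a = 1 by linarith]; simp
  right; right
  have h1 : dot p p ≤ 1 := hp
  have h2 : dot q q ≤ 1 := hq
  have h3 : 0 < (p.1 - q.1) ^ 2 + (p.2 - q.2) ^ 2 := by
    by_contra hcon
    have h4 : (p.1 - q.1) ^ 2 = 0 := le_antisymm (by nlinarith [sq_nonneg (p.2 - q.2)]) (sq_nonneg _)
    have h5 : (p.2 - q.2) ^ 2 = 0 := le_antisymm (by nlinarith [sq_nonneg (p.1 - q.1)]) (sq_nonneg _)
    exact hpq (Prod.ext (sub_eq_zero.1 (pow_eq_zero_iff two_ne_zero |>.1 h4))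
      (sub_eq_zero.1 (pow_eq_zero_iff two_ne_zero |>.1 h5)))
  have h6 : dot (a • p + b • q) (a • p + b • q) =
      a * dot p p + b * dot q q - a * b * ((p.1 - q.1) ^ 2 + (p.2 - q.2) ^ 2) := by
    simp only [dot, Prod.fst_add, Prod.snd_add, Prod.smul_fst, Prod.smul_snd, smul_eq_mul]
    rw [show b = 1 - a by linarith]
    ring
  have h7 : 0 < a * b * ((p.1 - q.1) ^ 2 + (p.2 - q.2) ^ 2) := by positivity
  rw [IsOrdinary, h6]
  nlinarith

lemma IsAsymptotic.eq_or_eq_of_mem_segment {p q x : ℝ × ℝ} (hx : IsAsymptotic x)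
    (hp : p ∈ closedPlane) (hq : q ∈ closedPlane) (h : x ∈ segment ℝ p q) : x = p ∨ x = q := by
  rcases isOrdinary_or_eq_of_mem_segment hp hq h with h | h | h
  · exact Or.inl h
  · exact Or.inr h
  · exact absurd h hx.not_isOrdinary

lemma mink_hom_lift_pos {ξ x : ℝ × ℝ} (hξ : IsAsymptotic ξ) (hx : IsOrdinary x) :
    0 < mink (hom ξ) (lift x) := by
  rw [lift, mink_smul_right]
  refine mul_pos (inv_pos.2 hx.sqrt_pos) (hξ.mink_hom_pos hx.mem_closedPlane ?_)
  rintro rfl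
  exact hξ.not_isOrdinary hx

lemma horoDist_eq (ξ x : ℝ × ℝ) : horoDist ξ x = Real.log (mink (hom ξ) (lift x)) := by
  rw [horoDist, lift, mink_smul_right, mink_hom, div_eq_inv_mul]

/-! ## Elliptic parabolic disks -/

/-- The asymptotically closed elliptic parabolic disk. -/
def parabola (F ξ : ℝ × ℝ) (c : ℝ) : Set (ℝ × ℝ) :=
  insert ξ {x | IsOrdinary x ∧ ordDist F x + (horoDist ξ x - c) ≤ 0}

/-- The asymptotically closed horodisk. -/
def horodisk (ξ : ℝ × ℝ) (c : ℝ) : Set (ℝ × ℝ) :=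
  insert ξ {x | IsOrdinary x ∧ horoDist ξ x - c ≤ 0}

/-- The asymptotically closed distance band. -/
def band (ξ η : ℝ × ℝ) (r : ℝ≥0) : Set (ℝ × ℝ) :=
  {x ∈ closedPlane | (⨅ y ∈ segment ℝ ξ η, hdist x y) ≤ r}

/-- This is `|b_ξ(x) - b_ξ(F)| ≤ d(F, x)` written with `cosh`, together with its equality case. `W`
is the component of `lift x` orthogonal to the plane of `lift F` and `hom ξ`; equality puts `x` on
the line through `F` and `ξ`. -/
lemma mink_busemann {ξ F x : ℝ × ℝ} (hξ : IsAsymptotic ξ) (hF : IsOrdinary F)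
    (hx : IsOrdinary x) :
    mink (hom ξ) (lift F) ^ 2 + mink (hom ξ) (lift x) ^ 2 ≤
      2 * mink (lift F) (lift x) * mink (hom ξ) (lift F) * mink (hom ξ) (lift x) ∧
    (2 * mink (lift F) (lift x) * mink (hom ξ) (lift F) * mink (hom ξ) (lift x) ≤
        mink (hom ξ) (lift F) ^ 2 + mink (hom ξ) (lift x) ^ 2 →
      lift x = (mink (hom ξ) (lift x) / mink (hom ξ) (lift F)) • lift F +
        ((mink (lift F) (lift x) - mink (hom ξ) (lift x) / mink (hom ξ) (lift F)) /
          mink (hom ξ) (lift F)) • hom ξ) := by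
  have hf := mink_hom_lift_pos hξ hF
  have hF1 := (isUnitTimelike_lift hF).1
  have hX1 := (isUnitTimelike_lift hx).1
  have hξ0 := mink_hom_self hξ
  set f := mink (hom ξ) (lift F)
  set h := mink (hom ξ) (lift x)
  set k := mink (lift F) (lift x)
  set W := lift x - ((h / f) • lift F + ((k - h / f) / f) • hom ξ) with hWdef
  have hWF : mink W (lift F) = 0 := by
    rw [hWdef]
    simp only [mink_sub_left, mink_add_left, mink_smul_left, hF1, mink_comm (lift x) (lift F)]
    change k - (h / f * 1 + (k - h / f) / f * f) = 0
    field_simp; ring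
  have hWW : mink W W = (f ^ 2 + h ^ 2 - 2 * k * f * h) / f ^ 2 := by
    rw [hWdef]
    simp only [mink_sub_left, mink_add_left, mink_smul_left, mink_sub_right, mink_add_right,
      mink_smul_right, hF1, hX1, hξ0, mink_comm (lift x) (lift F), mink_comm (lift F) (hom ξ),
      mink_comm (lift x) (hom ξ)]
    change 1 - (h / f * k + (k - h / f) / f * h) - (h / f * (k - (h / f * 1 + (k - h / f) / f * f))
      + (k - h / f) / f * (h - (h / f * f + (k - h / f) / f * 0))) = _
    field_simp; ring
  have hU := isUnitTimelike_lift hF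
  constructor
  · have := hU.mink_nonpos hWF
    rw [hWW, div_le_iff₀ (by positivity)] at this
    linarith
  · intro hle
    have := hU.eq_zero hWF (by rw [hWW]; apply div_nonneg <;> nlinarith)
    exact sub_eq_zero.1 this

lemma two_cosh_log {t : ℝ} (ht : 0 < t) : 2 * Real.cosh (Real.log t) = t + t⁻¹ := by
  rw [Real.cosh_log ht]; ring

/-- The condition is `d(F, x) ≤ log (κ / h)` with `h = mink (hom ξ) (lift x)`. Taking `cosh` loses
only the sign of the logarithm, and strictness in `hκ` excludes the spurious branch `h > κ`. -/
lemma mem_parabola_iff_of_lt {F ξ x : ℝ × ℝ} {κ : ℝ} (hF : IsOrdinary F) (hξ : IsAsymptotic ξ)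
    (hx : IsOrdinary x) (hκ : mink (hom ξ) (lift F) < κ) :
    ordDist F x + (horoDist ξ x - Real.log κ) ≤ 0 ↔
      2 * κ * mink (lift F) (lift x) * mink (hom ξ) (lift x) ≤
        κ ^ 2 + mink (hom ξ) (lift x) ^ 2 := by
  have hf := mink_hom_lift_pos hξ hF
  have hh := mink_hom_lift_pos hξ hx
  have hb := (mink_busemann hξ hF hx).1
  have hd := ordDist_nonneg hF hx
  have hc := cosh_ordDist hF hx
  rw [horoDist_eq]
  set f := mink (hom ξ) (lift F)
  set h := mink (hom ξ) (lift x)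
  set k := mink (lift F) (lift x)
  have hκ0 : 0 < κ := hf.trans hκ
  have hlog : Real.log h - Real.log κ = -Real.log (κ / h) := by
    rw [Real.log_div hκ0.ne' hh.ne']; ring
  have hcosh : k ≤ Real.cosh (Real.log (κ / h)) ↔ 2 * κ * k * h ≤ κ ^ 2 + h ^ 2 := by
    have h2 := two_cosh_log (div_pos hκ0 hh)
    have h3 : κ / h + (κ / h)⁻¹ = (κ ^ 2 + h ^ 2) / (κ * h) := by field_simp
    rw [h3, eq_div_iff (by positivity)] at h2
    have h4 : 0 < κ * h := by positivity
    constructor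
    · intro h5; nlinarith
    · intro h5
      by_contra h6
      nlinarith [mul_lt_mul_of_pos_right (not_le.1 h6) h4]
  rw [hlog, ← hcosh, ← hc, Real.cosh_le_cosh, abs_of_nonneg hd]
  constructor
  · intro h1
    exact (by linarith : ordDist F x ≤ Real.log (κ / h)).trans (le_abs_self _)
  · intro h1
    have h2 : k ≤ Real.cosh (Real.log (κ / h)) := by
      rw [← hc, Real.cosh_le_cosh, abs_of_nonneg hd]; exact h1
    rw [hcosh] at h2
    have h3 : h ≤ κ := by
      by_contra h4
      have h4 := not_le.1 h4
      -- Eliminating `k` between the Busemann inequality and `h2` gives `(κ - f) (h² - f κ) ≤ 0`,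
      -- impossible when `f < κ < h`.
      have h5 : κ * (f ^ 2 + h ^ 2) ≤ f * (κ ^ 2 + h ^ 2) := by
        nlinarith [mul_le_mul_of_nonneg_left hb hκ0.le, mul_le_mul_of_nonneg_left h2 hf.le]
      have h6 : 0 < (κ - f) * (h ^ 2 - f * κ) :=
        mul_pos (by linarith) (by nlinarith)
      nlinarith
    rw [abs_of_nonneg (Real.log_nonneg ((one_le_div hh).2 h3))] at h1
    linarith

/-- Along the half-line from `F` to `ξ` the Busemann function decreases at unit speed, so its change
cancels the distance from `F`; conversely, points where this happens satisfy the equality case of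
`mink_busemann`. -/
lemma segment_eq_parabola {F ξ : ℝ × ℝ} (hF : IsOrdinary F) (hξ : IsAsymptotic ξ) :
    segment ℝ F ξ = parabola F ξ (horoDist ξ F) := by
  have hf := mink_hom_lift_pos hξ hF
  have hF1 := (isUnitTimelike_lift hF).1
  have hξ0 := mink_hom_self hξ
  ext x
  constructor
  · intro hx
    rcases isOrdinary_or_eq_of_mem_segment hF.mem_closedPlane hξ.mem_closedPlane hx
      with rfl | rfl | hxo
    · right
      exact ⟨hF, by rw [ordDist_self hF]; simp⟩
    · left; rfl
    right
    refine ⟨hxo, ?_⟩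
    obtain ⟨a, b, ha, hb, hab, h⟩ := hom_of_mem_segment hx
    have hh := mink_hom_lift_pos hξ hxo
    have hs := hxo.sqrt_pos
    have hX1 := (isUnitTimelike_lift hxo).1
    obtain ⟨α, β, hβ, hlift⟩ : ∃ α β : ℝ, 0 ≤ β ∧ lift x = α • lift F + β • hom ξ := by
      have h2 := hF.sqrt_pos
      refine ⟨(√(1 - dot x x))⁻¹ * a * √(1 - dot F F), (√(1 - dot x x))⁻¹ * b, by positivity, ?_⟩
      simp only [lift, h, smul_add, smul_smul]
      congr 2; field_simp
    have e1 : mink (hom ξ) (lift x) = α * mink (hom ξ) (lift F) := by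
      rw [hlift, mink_add_right, mink_smul_right, mink_smul_right, hξ0]; ring
    have e2 : mink (lift F) (lift x) = α + β * mink (hom ξ) (lift F) := by
      rw [hlift, mink_add_right, mink_smul_right, mink_smul_right, hF1, mink_comm (lift F)]; ring
    have e3 : α ^ 2 + 2 * α * β * mink (hom ξ) (lift F) = 1 := by
      rw [← hX1, hlift]
      simp only [mink_add_left, mink_add_right, mink_smul_left, mink_smul_right, hF1, hξ0,
        mink_comm (lift F) (hom ξ)]
      ring
    have hα : 0 < α := by
      rw [e1] at hh
      exact pos_of_mul_pos_left hh hf.le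
    have hα1 : α ≤ 1 := by
      have : 0 ≤ α * β * mink (hom ξ) (lift F) := by positivity
      nlinarith
    have e4 : ordDist F x = -Real.log α := by
      have hl := Real.log_nonpos hα.le hα1
      apply eq_of_cosh_eq (ordDist_nonneg hF hxo) (by linarith)
      rw [cosh_ordDist hF hxo, e2, Real.cosh_neg, Real.cosh_log hα]
      field_simp
      linear_combination e3
    rw [e4, horoDist_eq, horoDist_eq, e1, Real.log_mul hα.ne' hf.ne']
    linarith
  · rintro (rfl | ⟨hx, h⟩)
    · exact right_mem_segment ℝ _ _
    have hh := mink_hom_lift_pos hξ hx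
    have hd := ordDist_nonneg hF hx
    rw [horoDist_eq, horoDist_eq] at h
    have hk := one_le_mink_lift hF hx
    have hle : mink (hom ξ) (lift x) ≤ mink (hom ξ) (lift F) := by
      rw [← Real.log_le_log_iff hh hf]; linarith
    have hmin := (mink_busemann hξ hF hx).2 (by
      have h1 : Real.cosh (ordDist F x) ≤
          Real.cosh (Real.log (mink (hom ξ) (lift F) / mink (hom ξ) (lift x))) := by
        rw [cosh_le_cosh_iff hd (Real.log_nonneg ((one_le_div hh).2 hle)),
          Real.log_div hf.ne' hh.ne']
        linarith
      have h2 := two_cosh_log (div_pos hf hh)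
      rw [cosh_ordDist hF hx] at h1
      have h3 : mink (hom ξ) (lift F) / mink (hom ξ) (lift x)
          + (mink (hom ξ) (lift F) / mink (hom ξ) (lift x))⁻¹ =
          (mink (hom ξ) (lift F) ^ 2 + mink (hom ξ) (lift x) ^ 2) /
            (mink (hom ξ) (lift F) * mink (hom ξ) (lift x)) := by field_simp
      rw [h3, eq_div_iff (by positivity)] at h2
      have h4 : 0 < mink (hom ξ) (lift F) * mink (hom ξ) (lift x) := by positivity
      nlinarith)
    rw [← toDisk_lift hx, hmin]
    have hmem := toDisk_add_mem_segment (X := lift F) (Y := hom ξ) (isUnitTimelike_lift hF).2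
      (by simp [hom])
      (a := mink (hom ξ) (lift x) / mink (hom ξ) (lift F))
      (b := (mink (lift F) (lift x) - mink (hom ξ) (lift x) / mink (hom ξ) (lift F)) /
          mink (hom ξ) (lift F)) (by positivity)
      (div_nonneg (by linarith [(div_le_one hf).2 hle]) hf.le)
      (by
        have : 0 < mink (hom ξ) (lift x) / mink (hom ξ) (lift F) := by positivity
        have : 0 ≤ (mink (lift F) (lift x) - mink (hom ξ) (lift x) / mink (hom ξ) (lift F)) /
          mink (hom ξ) (lift F) := div_nonneg (by linarith [(div_le_one hf).2 hle]) hf.le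
        linarith)
    rwa [toDisk_lift hF, toDisk_hom] at hmem

lemma mem_horodisk_iff {ξ x : ℝ × ℝ} {κ : ℝ} (hξ : IsAsymptotic ξ) (hx : IsOrdinary x)
    (hκ : 0 < κ) : horoDist ξ x - Real.log κ ≤ 0 ↔ mink (hom ξ) (lift x) ≤ κ := by
  rw [horoDist_eq, sub_nonpos, Real.log_le_log_iff (mink_hom_lift_pos hξ hx) hκ]

lemma mem_parabola_asymptotic {F ξ x : ℝ × ℝ} {c : ℝ} (hx : IsAsymptotic x)
    (h : x ∈ parabola F ξ c) : x = ξ :=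
  h.resolve_right fun h => hx.not_isOrdinary h.1

lemma mem_horodisk_asymptotic {ξ x : ℝ × ℝ} {c : ℝ} (hx : IsAsymptotic x)
    (h : x ∈ horodisk ξ c) : x = ξ :=
  h.resolve_right fun h => hx.not_isOrdinary h.1

/-- Points of the bounding horocycle can converge to `ξ`, and their distance from `F` is then
unbounded; in an elliptic parabolic disk this distance is at most `c - c'` on that horocycle. -/
lemma parabola_ne_horodisk {F ξ ξ' : ℝ × ℝ} {c c' : ℝ} (hF : IsOrdinary F)
    (hξ : IsAsymptotic ξ) : parabola F ξ c ≠ horodisk ξ' c' := by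
  intro h
  have e : ξ = ξ' := mem_horodisk_asymptotic hξ (h.subset (Set.mem_insert _ _))
  subst e
  have hF1 : dot F F < 1 := hF
  have hξ1 : ξ.1 * ξ.1 + ξ.2 * ξ.2 = 1 := hξ
  set κ := Real.exp c'
  have hκ : 0 < κ := Real.exp_pos c'
  set M := Real.cosh (c - c')
  have hM : 0 < M := Real.cosh_pos _
  set ε := (1 - dot F F) / 2
  have hε : 0 < ε := by simp only [ε]; linarith
  have hsF := hF.sqrt_pos
  -- The parameter `s` will be `1 - ξ · x`. The second and third bounds make the radicand of `σ`
  -- nonnegative, the last one makes `cosh d(F, x)` exceed `M`.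
  obtain ⟨s, hs0, hs1, hs2, hs3⟩ : ∃ s : ℝ, 0 < s ∧ s ≤ 1 ∧ s / κ ^ 2 ≤ 1 ∧
      M * √(1 - dot F F) * s / κ < ε := by
    refine ⟨min 1 (min (κ ^ 2) (ε * κ / (2 * M * √(1 - dot F F)))), ?_, min_le_left _ _, ?_, ?_⟩
    · positivity
    · rw [div_le_one (by positivity)]
      exact (min_le_right _ _).trans (min_le_left _ _)
    · have : min 1 (min (κ ^ 2) (ε * κ / (2 * M * √(1 - dot F F)))) ≤
          ε * κ / (2 * M * √(1 - dot F F)) := (min_le_right _ _).trans (min_le_right _ _)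
      calc _ ≤ M * √(1 - dot F F) * (ε * κ / (2 * M * √(1 - dot F F))) / κ := by gcongr
        _ = ε / 2 := by field_simp
        _ < ε := by linarith
  set σ := √(2 * s - s ^ 2 - s ^ 2 / κ ^ 2) with hσ
  have hσ2 : σ ^ 2 = 2 * s - s ^ 2 - s ^ 2 / κ ^ 2 := by
    rw [hσ, Real.sq_sqrt]
    have : s ^ 2 / κ ^ 2 = s * (s / κ ^ 2) := by ring
    nlinarith
  -- The vector `(1 - s) ξ` plus `σ` times `ξ` turned by a right angle; `σ` is chosen so that `√(1 -
  -- |x|²) = s / κ`, which places `x` on the horocycle of level `c' = log κ`.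
  set x : ℝ × ℝ := ((1 - s) * ξ.1 - σ * ξ.2, (1 - s) * ξ.2 + σ * ξ.1) with hxdef
  have hxx : 1 - dot x x = (s / κ) ^ 2 := by
    have : dot x x = ((1 - s) ^ 2 + σ ^ 2) * (ξ.1 * ξ.1 + ξ.2 * ξ.2) := by
      simp only [dot, x]; ring
    rw [this, hξ1, hσ2, div_pow]; ring
  have hξx : 1 - dot ξ x = s := by
    have : dot ξ x = (1 - s) * (ξ.1 * ξ.1 + ξ.2 * ξ.2) := by simp only [dot, x]; ring
    rw [this, hξ1]; ring
  have hsκ : 0 < s / κ := by positivity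
  have hxo : IsOrdinary x := by
    have : 0 < 1 - dot x x := by rw [hxx]; positivity
    exact sub_pos.1 this
  have hsq : √(1 - dot x x) = s / κ := by rw [hxx, Real.sqrt_sq hsκ.le]
  have hb : horoDist ξ x = c' := by
    rw [horoDist, hξx, hsq, show s / (s / κ) = κ by field_simp, Real.log_exp]
  have hxK : x ∈ parabola F ξ c := by
    rw [h]; right; exact ⟨hxo, by rw [hb, sub_self]⟩
  rcases hxK with hxK | ⟨-, hxK⟩
  · rw [hxK] at hxo; exact hξ.not_isOrdinary hxo
  rw [hb] at hxK
  have hd : Real.cosh (ordDist F x) ≤ M := by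
    rw [Real.cosh_le_cosh, abs_of_nonneg (ordDist_nonneg hF hxo)]
    exact (by linarith : ordDist F x ≤ c - c').trans (le_abs_self _)
  rw [cosh_ordDist hF hxo, mink_lift, hsq, div_le_iff₀ (by positivity)] at hd
  have hFx : ε ≤ 1 - dot F x := by
    have := two_dot_le F x
    have : dot x x < 1 := hxo
    simp only [ε]
    linarith
  have : M * (√(1 - dot F F) * (s / κ)) = M * √(1 - dot F F) * s / κ := by ring
  linarith

lemma hom_fst (p : ℝ × ℝ) : (hom p).1 = p.1 := rfl

lemma hom_snd_fst (p : ℝ × ℝ) : (hom p).2.1 = p.2 := rfl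

lemma hom_snd_snd (p : ℝ × ℝ) : (hom p).2.2 = 1 := rfl

/-! ## Distance bands -/

/-- Writing `lift y = α • hom ξ + β • hom η`, the normalization gives `2 α β * mink (hom ξ) (hom η)
= 1`, and the inequality is the one between arithmetic and geometric means. -/
lemma mink_sq_le_of_mem_line {ξ η x y : ℝ × ℝ} (hξ : IsAsymptotic ξ) (hη : IsAsymptotic η)
    (hy : IsOrdinary y) (h : y ∈ segment ℝ ξ η) :
    2 * mink (hom ξ) (lift x) * mink (hom η) (lift x) ≤
      mink (hom ξ) (hom η) * mink (lift x) (lift y) ^ 2 := by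
  obtain ⟨a, b, ha, hb, -, hab⟩ := hom_of_mem_segment h
  obtain ⟨α, β, hl⟩ : ∃ α β : ℝ, lift y = α • hom ξ + β • hom η :=
    ⟨(√(1 - dot y y))⁻¹ * a, (√(1 - dot y y))⁻¹ * b, by rw [lift, hab, smul_add, smul_smul,
      smul_smul]⟩
  have h1 : 2 * α * β * mink (hom ξ) (hom η) = 1 := by
    rw [← (isUnitTimelike_lift hy).1, hl]
    simp only [mink_add_left, mink_add_right, mink_smul_left, mink_smul_right, mink_hom_self hξ,
      mink_hom_self hη, mink_comm (hom η) (hom ξ)]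
    ring
  have h2 : mink (lift x) (lift y) =
      α * mink (hom ξ) (lift x) + β * mink (hom η) (lift x) := by
    rw [hl, mink_add_right, mink_smul_right, mink_smul_right, mink_comm (lift x),
      mink_comm (lift x)]
  have hs : 0 ≤ mink (hom ξ) (hom η) := by
    by_cases hne : ξ = η
    · rw [hne, mink_hom_self hη]
    · exact (hξ.mink_hom_pos hη.mem_closedPlane hne).le
  have h3 : mink (hom ξ) (hom η) * (α * mink (hom ξ) (lift x) + β * mink (hom η) (lift x)) ^ 2 -
      2 * mink (hom ξ) (lift x) * mink (hom η) (lift x) =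
      mink (hom ξ) (hom η) * (α * mink (hom ξ) (lift x) - β * mink (hom η) (lift x)) ^ 2 := by
    linear_combination (2 * mink (hom ξ) (lift x) * mink (hom η) (lift x)) * h1
  have h4 := mul_nonneg hs (sq_nonneg (α * mink (hom ξ) (lift x) - β * mink (hom η) (lift x)))
  rw [h2]
  linarith

/-- Equality is attained at the foot of the perpendicular: `Y` is a positive multiple of the
orthogonal projection of `lift x` to the plane of `hom ξ` and `hom η`. -/
lemma exists_foot {ξ η x : ℝ × ℝ} (hξ : IsAsymptotic ξ) (hη : IsAsymptotic η) (hne : ξ ≠ η)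
    (hx : IsOrdinary x) : ∃ y ∈ segment ℝ ξ η, IsOrdinary y ∧
      2 * mink (hom ξ) (lift x) * mink (hom η) (lift x) =
        mink (hom ξ) (hom η) * mink (lift x) (lift y) ^ 2 := by
  have hs := hξ.mink_hom_pos hη.mem_closedPlane hne
  have h1 := mink_hom_lift_pos hξ hx
  have h2 := mink_hom_lift_pos hη hx
  set Y := mink (hom η) (lift x) • hom ξ + mink (hom ξ) (lift x) • hom η with hY
  have hYY : mink Y Y =
      2 * mink (hom ξ) (lift x) * mink (hom η) (lift x) * mink (hom ξ) (hom η) := by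
    rw [hY]
    simp only [mink_add_left, mink_add_right, mink_smul_left, mink_smul_right, mink_hom_self hξ,
      mink_hom_self hη, mink_comm (hom η) (hom ξ)]
    ring
  have hpos : 0 < mink Y Y := by rw [hYY]; positivity
  have hz : 0 < Y.2.2 := by
    simp only [Y, Prod.snd_add, Prod.smul_snd, hom_snd_snd, smul_eq_mul]
    linarith
  have hmem := toDisk_add_mem_segment (X := hom ξ) (Y := hom η) (by simp [hom]) (by simp [hom])
    h2.le h1.le (by positivity)
  rw [toDisk_hom, toDisk_hom] at hmem
  refine ⟨toDisk Y, hmem, isOrdinary_toDisk hz.ne' hpos, ?_⟩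
  have hxY : mink (lift x) Y = 2 * mink (hom ξ) (lift x) * mink (hom η) (lift x) := by
    rw [hY, mink_add_right, mink_smul_right, mink_smul_right, mink_comm (lift x),
      mink_comm (lift x)]; ring
  rw [lift_toDisk_of_pos hz hpos, mink_smul_right, mul_pow, inv_pow, Real.sq_sqrt hpos.le, hYY,
    hxY]
  field_simp

lemma mem_band_ordinary {ξ η x : ℝ × ℝ} {r : ℝ≥0} (hξ : IsAsymptotic ξ) (hη : IsAsymptotic η)
    (hne : ξ ≠ η) (hx : IsOrdinary x) : x ∈ band ξ η r ↔
      2 * mink (hom ξ) (lift x) * mink (hom η) (lift x) ≤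
        mink (hom ξ) (hom η) * Real.cosh r ^ 2 := by
  have hs := hξ.mink_hom_pos hη.mem_closedPlane hne
  have hr : (0 : ℝ) ≤ r := r.2
  obtain ⟨y, hy, hyo, hfoot⟩ := exists_foot hξ hη hne hx
  have key : 2 * mink (hom ξ) (lift x) * mink (hom η) (lift x) ≤
        mink (hom ξ) (hom η) * Real.cosh r ^ 2 ↔ ordDist x y ≤ r := by
    rw [hfoot, mul_le_mul_iff_right₀ hs, ← cosh_ordDist hx hyo,
      sq_le_sq₀ (Real.cosh_pos _).le (Real.cosh_pos _).le,
      cosh_le_cosh_iff (ordDist_nonneg hx hyo) hr]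
  rw [key]
  constructor
  · rintro ⟨-, h⟩
    rw [← ofReal_le_coe_iff]
    refine le_trans (le_iInf₂ fun z hz => ?_) h
    rcases isOrdinary_or_eq_of_mem_segment hξ.mem_closedPlane hη.mem_closedPlane hz
      with rfl | rfl | hzo
    · rw [hdist_eq_top (Or.inr hξ) (by rintro rfl; exact hξ.not_isOrdinary hx)]; exact le_top
    · rw [hdist_eq_top (Or.inr hη) (by rintro rfl; exact hη.not_isOrdinary hx)]; exact le_top
    rw [hdist_ordinary hx hzo]
    apply ENNReal.ofReal_le_ofReal
    have h1 := mink_sq_le_of_mem_line (x := x) hξ hη hzo hz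
    rw [hfoot, mul_le_mul_iff_right₀ hs, ← cosh_ordDist hx hyo, ← cosh_ordDist hx hzo,
      sq_le_sq₀ (Real.cosh_pos _).le (Real.cosh_pos _).le,
      cosh_le_cosh_iff (ordDist_nonneg hx hyo) (ordDist_nonneg hx hzo)] at h1
    exact h1
  · intro h
    refine ⟨hx.mem_closedPlane, (iInf₂_le y hy).trans ?_⟩
    rwa [hdist_ordinary hx hyo, ofReal_le_coe_iff]

lemma segment_subset_band {ξ η : ℝ × ℝ} (r : ℝ≥0) (hξ : IsAsymptotic ξ) (hη : IsAsymptotic η) :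
    segment ℝ ξ η ⊆ band ξ η r := by
  intro x hx
  refine ⟨?_, (iInf₂_le x hx).trans (by rw [hdist_self]; exact zero_le)⟩
  rcases isOrdinary_or_eq_of_mem_segment hξ.mem_closedPlane hη.mem_closedPlane hx
      with rfl | rfl | hxo
  · exact hξ.mem_closedPlane
  · exact hη.mem_closedPlane
  · exact hxo.mem_closedPlane

lemma mem_band_asymptotic {ξ η x : ℝ × ℝ} {r : ℝ≥0} (hξ : IsAsymptotic ξ) (hη : IsAsymptotic η)
    (hx : IsAsymptotic x) : x ∈ band ξ η r ↔ x = ξ ∨ x = η := by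
  constructor
  · rintro ⟨-, h⟩
    by_contra hcon
    have htop : (⨅ y ∈ segment ℝ ξ η, hdist x y) = ∞ := by
      simp only [iInf_eq_top]
      intro y hy
      refine hdist_eq_top (Or.inl hx) ?_
      rintro rfl
      exact hcon (hx.eq_or_eq_of_mem_segment hξ.mem_closedPlane hη.mem_closedPlane hy)
    rw [htop] at h
    exact ENNReal.coe_ne_top (top_le_iff.1 h)
  · rintro (rfl | rfl)
    · exact segment_subset_band r hξ hη (left_mem_segment ℝ _ _)
    · exact segment_subset_band r hξ hη (right_mem_segment ℝ _ _)

lemma segment_eq_band {ξ η : ℝ × ℝ} (hξ : IsAsymptotic ξ) (hη : IsAsymptotic η) (hne : ξ ≠ η) :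
    segment ℝ ξ η = band ξ η 0 := by
  refine (segment_subset_band 0 hξ hη).antisymm fun x hx => ?_
  rcases isOrdinary_or_isAsymptotic hx.1 with hxo | hxa
  · obtain ⟨y, hy, hyo, hfoot⟩ := exists_foot hξ hη hne hxo
    rw [mem_band_ordinary hξ hη hne hxo, hfoot, NNReal.coe_zero, Real.cosh_zero,
      mul_le_mul_iff_right₀ (hξ.mink_hom_pos hη.mem_closedPlane hne)] at hx
    have h1 := one_le_mink_lift hxo hyo
    have := (isUnitTimelike_lift hxo).eq_of_mink_le_one (isUnitTimelike_lift hyo) (by nlinarith)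
    rwa [← toDisk_lift hxo, this, toDisk_lift hyo]
  · rcases (mem_band_asymptotic hξ hη hxa).1 hx with rfl | rfl
    · exact left_mem_segment ℝ _ _
    · exact right_mem_segment ℝ _ _

/-! ## Reflections -/

/-- The reflection in a line in homogeneous coordinates. -/
noncomputable def reflVec (a b : ℝ × ℝ) (X : ℝ × ℝ × ℝ) : ℝ × ℝ × ℝ :=
  (2 / mink (hom a) (hom b)) • (mink X (hom b) • hom a + mink X (hom a) • hom b) - X

lemma hreflection_eq (a b x : ℝ × ℝ) : hreflection a b x = toDisk (reflVec a b (hom x)) := by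
  have e1 : ∀ u v : ℝ × ℝ, mink (hom u) (hom v) = -(dot u v - 1) := fun u v => by
    rw [mink_hom]; ring
  simp only [hreflection, reflVec, toDisk, e1, Prod.ext_iff, Prod.smul_fst, Prod.smul_snd,
    Prod.fst_sub, Prod.snd_sub, Prod.fst_add, Prod.snd_add, hom_fst, hom_snd_fst, hom_snd_snd,
    smul_eq_mul]
  generalize dot a b - 1 = d
  generalize dot x b - 1 = u
  generalize dot x a - 1 = v
  constructor <;> ring

lemma mink_reflVec {a b : ℝ × ℝ} (ha : IsAsymptotic a) (hb : IsAsymptotic b) (hab : a ≠ b)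
    (X Y : ℝ × ℝ × ℝ) : mink (reflVec a b X) (reflVec a b Y) = mink X Y := by
  have hs := (ha.mink_hom_pos hb.mem_closedPlane hab).ne'
  simp only [reflVec, mink_sub_left, mink_sub_right, mink_smul_left, mink_smul_right,
    mink_add_left, mink_add_right, mink_hom_self ha, mink_hom_self hb, mink_comm (hom b) (hom a),
    mink_comm (hom a) Y, mink_comm (hom b) Y]
  field_simp
  ring

lemma reflVec_add (a b : ℝ × ℝ) (X Y : ℝ × ℝ × ℝ) :
    reflVec a b (X + Y) = reflVec a b X + reflVec a b Y := by
  simp only [reflVec, mink_add_left]; module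

lemma reflVec_smul (a b : ℝ × ℝ) (r : ℝ) (X : ℝ × ℝ × ℝ) :
    reflVec a b (r • X) = r • reflVec a b X := by
  simp only [reflVec, mink_smul_left]; module

lemma reflVec_left {a b : ℝ × ℝ} (ha : IsAsymptotic a) (hb : IsAsymptotic b) (hab : a ≠ b) :
    reflVec a b (hom a) = hom a := by
  have hs := (ha.mink_hom_pos hb.mem_closedPlane hab).ne'
  rw [reflVec, mink_hom_self ha, zero_smul, add_zero, smul_smul, div_mul_cancel₀ _ hs]
  module

lemma reflVec_right {a b : ℝ × ℝ} (ha : IsAsymptotic a) (hb : IsAsymptotic b) (hab : a ≠ b) :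
    reflVec a b (hom b) = hom b := by
  have hs := (ha.mink_hom_pos hb.mem_closedPlane hab).ne'
  rw [reflVec, mink_hom_self hb, zero_smul, zero_add, smul_smul, mink_comm (hom b),
    div_mul_cancel₀ _ hs]
  module

lemma reflVec_reflVec {a b : ℝ × ℝ} (ha : IsAsymptotic a) (hb : IsAsymptotic b) (hab : a ≠ b)
    (X : ℝ × ℝ × ℝ) : reflVec a b (reflVec a b X) = X := by
  have e1 := mink_reflVec ha hb hab X (hom a)
  have e2 := mink_reflVec ha hb hab X (hom b)
  rw [reflVec_left ha hb hab] at e1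
  rw [reflVec_right ha hb hab] at e2
  rw [reflVec, e1, e2, reflVec]
  module

lemma reflVec_hom_of_mem_segment {a b x : ℝ × ℝ} (ha : IsAsymptotic a) (hb : IsAsymptotic b)
    (hab : a ≠ b) (hx : x ∈ segment ℝ a b) : reflVec a b (hom x) = hom x := by
  obtain ⟨s, t, -, -, -, h⟩ := hom_of_mem_segment hx
  rw [h, reflVec_add, reflVec_smul, reflVec_smul, reflVec_left ha hb hab,
    reflVec_right ha hb hab]

/-- The reflection preserves the upper sheet. With `n = |(a + b) / 2|² < 1` and `t = x · (a + b)`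
the claim is `t < 1 + n`, which follows from `t² ≤ 4 n < (1 + n)²`. -/
lemma reflVec_hom_pos {a b x : ℝ × ℝ} (ha : IsAsymptotic a) (hb : IsAsymptotic b)
    (hab : a ≠ b) (hx : x ∈ closedPlane) : 0 < (reflVec a b (hom x)).2.2 := by
  have hs := ha.mink_hom_pos hb.mem_closedPlane hab
  have e : (reflVec a b (hom x)).2.2 =
      (2 * (mink (hom x) (hom b) + mink (hom x) (hom a)) - mink (hom a) (hom b)) /
        mink (hom a) (hom b) := by
    simp only [reflVec, Prod.smul_snd, Prod.snd_sub, Prod.snd_add, hom_snd_snd, smul_eq_mul]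
    field_simp
  rw [e]
  refine div_pos ?_ hs
  rw [mink_hom] at hs
  simp only [mink_hom]
  have ha' : a.1 * a.1 + a.2 * a.2 = 1 := ha
  have hb' : b.1 * b.1 + b.2 * b.2 = 1 := hb
  have hx' : x.1 * x.1 + x.2 * x.2 ≤ 1 := hx
  simp only [dot] at *
  set n := (1 + (a.1 * b.1 + a.2 * b.2)) / 2 with hn
  set t := x.1 * (a.1 + b.1) + x.2 * (a.2 + b.2) with ht
  have hn1 : n < 1 := by linarith
  have hcs : t ^ 2 ≤ 4 * n := by
    have h1 : (a.1 + b.1) ^ 2 + (a.2 + b.2) ^ 2 = 4 * n := by rw [hn]; linarith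
    have h2 : t ^ 2 ≤ (x.1 * x.1 + x.2 * x.2) * ((a.1 + b.1) ^ 2 + (a.2 + b.2) ^ 2) := by
      rw [ht]; nlinarith [sq_nonneg (x.1 * (a.2 + b.2) - x.2 * (a.1 + b.1))]
    have h3 : 0 ≤ (a.1 + b.1) ^ 2 + (a.2 + b.2) ^ 2 := by positivity
    nlinarith
  have hn0 : 0 ≤ n := by nlinarith [sq_nonneg t]
  have htn : t < 1 + n := by
    by_contra hcon
    have hcon := not_lt.1 hcon
    nlinarith [sq_nonneg (1 - n), mul_pos (sub_pos.2 hn1) (sub_pos.2 hn1)]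
  have e2 : 2 * (1 - (x.1 * b.1 + x.2 * b.2) + (1 - (x.1 * a.1 + x.2 * a.2))) -
      (1 - (a.1 * b.1 + a.2 * b.2)) = 2 * (1 + n - t) := by rw [hn, ht]; ring
  rw [e2]
  linarith

section Reflection

variable {a b : ℝ × ℝ}

lemma one_sub_dot_hreflection (ha : IsAsymptotic a) (hb : IsAsymptotic b) (hab : a ≠ b)
    {x : ℝ × ℝ} (hx : x ∈ closedPlane) :
    1 - dot (hreflection a b x) (hreflection a b x) =
      (1 - dot x x) / ((reflVec a b (hom x)).2.2 * (reflVec a b (hom x)).2.2) := by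
  have hz := (reflVec_hom_pos ha hb hab hx).ne'
  rw [hreflection_eq, one_sub_dot_toDisk hz hz, mink_reflVec ha hb hab, mink_hom]

lemma isOrdinary_hreflection (ha : IsAsymptotic a) (hb : IsAsymptotic b) (hab : a ≠ b)
    {x : ℝ × ℝ} (hx : IsOrdinary x) : IsOrdinary (hreflection a b x) := by
  have hx' : dot x x < 1 := hx
  have h := one_sub_dot_hreflection ha hb hab hx.mem_closedPlane
  have hz := reflVec_hom_pos ha hb hab hx.mem_closedPlane
  have : 0 < (1 - dot x x) / ((reflVec a b (hom x)).2.2 * (reflVec a b (hom x)).2.2) :=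
    div_pos (by linarith) (by positivity)
  rw [← h] at this
  exact sub_pos.1 this

lemma isAsymptotic_hreflection (ha : IsAsymptotic a) (hb : IsAsymptotic b) (hab : a ≠ b)
    {x : ℝ × ℝ} (hx : IsAsymptotic x) : IsAsymptotic (hreflection a b x) := by
  have hx' : dot x x = 1 := hx
  have h := one_sub_dot_hreflection ha hb hab hx.mem_closedPlane
  rw [hx', sub_self, zero_div] at h
  exact (sub_eq_zero.1 h).symm

lemma hom_hreflection (ha : IsAsymptotic a) (hb : IsAsymptotic b) (hab : a ≠ b)
    {x : ℝ × ℝ} (hx : x ∈ closedPlane) : reflVec a b (hom x) =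
      (reflVec a b (hom x)).2.2 • hom (hreflection a b x) := by
  have hz := (reflVec_hom_pos ha hb hab hx).ne'
  rw [hreflection_eq, hom_toDisk hz, smul_smul, mul_inv_cancel₀ hz, one_smul]

lemma lift_hreflection (ha : IsAsymptotic a) (hb : IsAsymptotic b) (hab : a ≠ b)
    {x : ℝ × ℝ} (hx : IsOrdinary x) : lift (hreflection a b x) = reflVec a b (lift x) := by
  have hz := reflVec_hom_pos ha hb hab hx.mem_closedPlane
  have hx' : 0 < mink (hom x) (hom x) := by rw [mink_hom]; exact sub_pos.2 hx
  rw [hreflection_eq, lift_toDisk_of_pos hz (by rw [mink_reflVec ha hb hab]; exact hx'),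
    mink_reflVec ha hb hab, mink_hom, lift, reflVec_smul]

lemma hreflection_hreflection (ha : IsAsymptotic a) (hb : IsAsymptotic b) (hab : a ≠ b)
    {x : ℝ × ℝ} (hx : x ∈ closedPlane) : hreflection a b (hreflection a b x) = x := by
  have hz := (reflVec_hom_pos ha hb hab hx).ne'
  rw [hreflection_eq a b (hreflection a b x), hreflection_eq a b x, hom_toDisk hz, reflVec_smul,
    toDisk_smul (inv_ne_zero hz), reflVec_reflVec ha hb hab, toDisk_hom]

lemma hreflection_of_mem_segment (ha : IsAsymptotic a) (hb : IsAsymptotic b) (hab : a ≠ b)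
    {x : ℝ × ℝ} (hx : x ∈ segment ℝ a b) : hreflection a b x = x := by
  rw [hreflection_eq, reflVec_hom_of_mem_segment ha hb hab hx, toDisk_hom]

lemma isSymmetryAxis_of_forall {K : Set (ℝ × ℝ)} (ha : IsAsymptotic a) (hb : IsAsymptotic b)
    (hab : a ≠ b) (hK : K ⊆ closedPlane) (h : ∀ x ∈ K, hreflection a b x ∈ K) :
    IsSymmetryAxis K a b := by
  refine ⟨ha, hb, hab, Set.Subset.antisymm ?_ ?_⟩
  · rintro _ ⟨x, hx, rfl⟩
    exact h x hx
  · intro x hx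
    exact ⟨_, h x hx, hreflection_hreflection ha hb hab (hK hx)⟩

lemma mink_lift_hreflection (ha : IsAsymptotic a) (hb : IsAsymptotic b) (hab : a ≠ b)
    {x : ℝ × ℝ} (hx : IsOrdinary x) {y : ℝ × ℝ} (hy : y ∈ segment ℝ a b) :
    mink (hom y) (lift (hreflection a b x)) = mink (hom y) (lift x) := by
  rw [lift_hreflection ha hb hab hx]
  conv => lhs; rw [← reflVec_hom_of_mem_segment ha hb hab hy]
  rw [mink_reflVec ha hb hab]

lemma horoDist_hreflection (ha : IsAsymptotic a) (hb : IsAsymptotic b) (hab : a ≠ b)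
    {x : ℝ × ℝ} (hx : IsOrdinary x) {y : ℝ × ℝ} (hy : y ∈ segment ℝ a b) :
    horoDist y (hreflection a b x) = horoDist y x := by
  rw [horoDist_eq, horoDist_eq, mink_lift_hreflection ha hb hab hx hy]

lemma ordDist_hreflection (ha : IsAsymptotic a) (hb : IsAsymptotic b) (hab : a ≠ b)
    {x : ℝ × ℝ} (hx : IsOrdinary x) {y : ℝ × ℝ} (hy : y ∈ segment ℝ a b) :
    ordDist y (hreflection a b x) = ordDist y x := by
  rw [ordDist_eq, ordDist_eq, lift, mink_smul_left, mink_smul_left,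
    mink_lift_hreflection ha hb hab hx hy]

end Reflection

/-! ### Axes of symmetry of the sets with one asymptotic point -/

lemma parabola_subset {F ξ : ℝ × ℝ} {c : ℝ} (hξ : IsAsymptotic ξ) :
    parabola F ξ c ⊆ closedPlane := by
  rintro x (rfl | ⟨hx, -⟩)
  exacts [hξ.mem_closedPlane, hx.mem_closedPlane]

lemma horodisk_subset {ξ : ℝ × ℝ} {c : ℝ} (hξ : IsAsymptotic ξ) :
    horodisk ξ c ⊆ closedPlane := by
  rintro x (rfl | ⟨hx, -⟩)
  exacts [hξ.mem_closedPlane, hx.mem_closedPlane]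

lemma exists_line {F ξ : ℝ × ℝ} (hF : IsOrdinary F) (hξ : IsAsymptotic ξ) :
    ∃ η, IsAsymptotic η ∧ ξ ≠ η ∧ F ∈ segment ℝ ξ η := by
  have hF' : dot F F < 1 := hF
  have hξ' : dot ξ ξ = 1 := hξ
  have hm := hξ.mink_hom_pos hF.mem_closedPlane (by rintro rfl; exact hξ.not_isOrdinary hF)
  rw [mink_hom] at hm
  have hn : 0 < 1 + dot F F - 2 * dot ξ F := by
    have := two_dot_le ξ F
    by_contra hcon
    nlinarith [mul_pos hm hm, sq_nonneg (ξ.1 * F.2 - ξ.2 * F.1),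
      (by simp only [dot]; ring : dot ξ F ^ 2 + (ξ.1 * F.2 - ξ.2 * F.1) ^ 2 = dot ξ ξ * dot F F)]
  -- The second intersection of the Euclidean line `ξF` with the circle is `F + t (F - ξ)`, where `t
  -- = (1 - |F|²) / |F - ξ|²`.
  set t := (1 - dot F F) / (1 + dot F F - 2 * dot ξ F) with ht
  have ht0 : 0 < t := div_pos (by linarith) hn
  have ht1 : t * (1 + dot F F - 2 * dot ξ F) = 1 - dot F F := by
    rw [ht]; field_simp
  have hη : IsAsymptotic ((1 + t) • F - t • ξ) := by
    have e : dot ((1 + t) • F - t • ξ) ((1 + t) • F - t • ξ) =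
        (1 + t) ^ 2 * dot F F - 2 * t * (1 + t) * dot ξ F + t ^ 2 * dot ξ ξ := by
      simp only [dot, Prod.fst_sub, Prod.snd_sub, Prod.smul_fst, Prod.smul_snd, smul_eq_mul]; ring
    rw [IsAsymptotic, e, hξ']
    linear_combination (1 + t) * ht1
  have hmem : F ∈ segment ℝ ξ ((1 + t) • F - t • ξ) := by
    refine ⟨t / (1 + t), 1 / (1 + t), by positivity, by positivity, by field_simp; ring, ?_⟩
    simp only [Prod.ext_iff, Prod.fst_add, Prod.snd_add, Prod.fst_sub, Prod.snd_sub,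
      Prod.smul_fst, Prod.smul_snd, smul_eq_mul]
    constructor <;> field_simp <;> ring
  refine ⟨_, hη, ?_, hmem⟩
  intro h
  rw [← h, segment_same] at hmem
  rw [hmem] at hF
  exact hξ.not_isOrdinary hF

lemma exists_axis_parabola {F ξ : ℝ × ℝ} (c : ℝ) (hF : IsOrdinary F) (hξ : IsAsymptotic ξ) :
    ∃ η, IsSymmetryAxis (parabola F ξ c) ξ η := by
  obtain ⟨η, hη, hne, hmem⟩ := exists_line hF hξ
  refine ⟨η, isSymmetryAxis_of_forall hξ hη hne (parabola_subset hξ) ?_⟩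
  rintro x (rfl | ⟨hx, h⟩)
  · rw [hreflection_of_mem_segment hξ hη hne (left_mem_segment ℝ _ _)]
    exact Set.mem_insert _ _
  · right
    refine ⟨isOrdinary_hreflection hξ hη hne hx, ?_⟩
    rwa [ordDist_hreflection hξ hη hne hx hmem,
      horoDist_hreflection hξ hη hne hx (left_mem_segment ℝ _ _)]

lemma exists_axis_horodisk {ξ : ℝ × ℝ} (c : ℝ) (hξ : IsAsymptotic ξ) :
    ∃ η, IsSymmetryAxis (horodisk ξ c) ξ η := by
  obtain ⟨η, hη, hne, -⟩ := exists_line (F := 0) (by simp [IsOrdinary, dot]) hξ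
  refine ⟨η, isSymmetryAxis_of_forall hξ hη hne (horodisk_subset hξ) ?_⟩
  rintro x (rfl | ⟨hx, h⟩)
  · rw [hreflection_of_mem_segment hξ hη hne (left_mem_segment ℝ _ _)]
    exact Set.mem_insert _ _
  · right
    refine ⟨isOrdinary_hreflection hξ hη hne hx, ?_⟩
    rwa [horoDist_hreflection hξ hη hne hx (left_mem_segment ℝ _ _)]

lemma exists_axis_singleton {ξ : ℝ × ℝ} (hξ : IsAsymptotic ξ) :
    ∃ η, IsSymmetryAxis {ξ} ξ η := by
  obtain ⟨η, hη, hne, -⟩ := exists_line (F := 0) (by simp [IsOrdinary, dot]) hξ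
  refine ⟨η, isSymmetryAxis_of_forall hξ hη hne (by rintro _ rfl; exact hξ.mem_closedPlane) ?_⟩
  rintro _ rfl
  exact hreflection_of_mem_segment hξ hη hne (left_mem_segment ℝ _ _)

/-! ## Major axes of sets with one or two asymptotic points -/

lemma exists_segment_eq_inter {K : Set (ℝ × ℝ)} (hconv : Convex ℝ K) (hcomp : IsCompact K)
    {a b : ℝ × ℝ} (hne : (K ∩ segment ℝ a b).Nonempty) :
    ∃ p q, K ∩ segment ℝ a b = segment ℝ p q := by
  set T : Set ℝ := (AffineMap.lineMap a b : ℝ →ᵃ[ℝ] ℝ × ℝ) ⁻¹' K ∩ Set.Icc 0 1 with hT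
  have himg : (AffineMap.lineMap a b : ℝ →ᵃ[ℝ] ℝ × ℝ) '' T = K ∩ segment ℝ a b := by
    rw [hT, Set.image_preimage_inter, segment_eq_image_lineMap]
  have hTc : IsCompact T :=
    isCompact_Icc.inter_left (hcomp.isClosed.preimage AffineMap.lineMap_continuous)
  have hTconv : Convex ℝ T := (hconv.affine_preimage _).inter (convex_Icc 0 1)
  have hTne : T.Nonempty := by rw [← himg] at hne; exact hne.of_image
  have hIcc := eq_Icc_of_connected_compact ⟨hTne, hTconv.isPreconnected⟩ hTc
  refine ⟨AffineMap.lineMap a b (sInf T), AffineMap.lineMap a b (sSup T), ?_⟩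
  have hle : sInf T ≤ sSup T := by
    obtain ⟨t, ht⟩ := hTne
    rw [hIcc] at ht
    exact ht.1.trans ht.2
  rw [← himg, hIcc, ← segment_eq_Icc hle, image_segment]
  simp [hle]

lemma exists_isMajorAxis_semibounded {K : Set (ℝ × ℝ)} {ξ η : ℝ × ℝ} (hconv : Convex ℝ K)
    (hcomp : IsCompact K) (hξ : {x ∈ K | IsAsymptotic x} = {ξ}) (h : IsSymmetryAxis K ξ η) :
    ∃ p q, IsMajorAxis K p q := by
  have hmem : ξ ∈ ({ξ} : Set (ℝ × ℝ)) := rfl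
  rw [← hξ] at hmem
  obtain ⟨p, q, hpq⟩ := exists_segment_eq_inter hconv hcomp (a := ξ) (b := η)
    ⟨ξ, hmem.1, left_mem_segment ℝ _ _⟩
  exact ⟨p, q, .semibounded p q ξ η ξ hξ h hpq⟩

/-- An axis of symmetry of a convex set with one asymptotic point passes through that point, and
through other points of the set if there are any. -/
lemma exists_mem_axis {K : Set (ℝ × ℝ)} {ξ a b x : ℝ × ℝ} (hconv : Convex ℝ K)
    (hξ : {x ∈ K | IsAsymptotic x} = {ξ}) (h : IsSymmetryAxis K a b)
    (hx : x ∈ K) (hxo : IsOrdinary x) :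
    ξ ∈ segment ℝ a b ∧ ∃ y ∈ K ∩ segment ℝ a b, y ≠ ξ := by
  obtain ⟨ha, hb, hab, hR⟩ := h
  have hs := ha.mink_hom_pos hb.mem_closedPlane hab
  have hξK : ξ ∈ K ∧ IsAsymptotic ξ := by
    have : ξ ∈ ({ξ} : Set (ℝ × ℝ)) := rfl
    rwa [← hξ] at this
  have hRξ : hreflection a b ξ = ξ := by
    have : hreflection a b ξ ∈ {x ∈ K | IsAsymptotic x} :=
      ⟨hR.subset ⟨ξ, hξK.1, rfl⟩, isAsymptotic_hreflection ha hb hab hξK.2⟩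
    rwa [hξ] at this
  -- The only asymptotic point of `K` is fixed by the reflection. Pairing its image with itself
  -- shows that an asymptotic fixed point is orthogonal to `hom a` or `hom b`, so it is that
  -- endpoint.
  have hor : ξ = a ∨ ξ = b := by
    have e := hom_hreflection ha hb hab hξK.2.mem_closedPlane
    rw [hRξ] at e
    have e2 := congrArg (fun Z => mink Z (hom ξ)) e
    simp only [mink_smul_left, mink_hom_self hξK.2, mul_zero] at e2
    simp only [reflVec, mink_sub_left, mink_smul_left, mink_add_left, mink_hom_self hξK.2,
      mink_comm (hom a) (hom ξ), mink_comm (hom b) (hom ξ)] at e2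
    have e3 : mink (hom ξ) (hom a) * mink (hom ξ) (hom b) = 0 := by
      field_simp at e2
      linarith
    rcases mul_eq_zero.1 e3 with h0 | h0
    · left
      by_contra hne
      exact (hξK.2.mink_hom_pos ha.mem_closedPlane hne).ne' h0
    · right
      by_contra hne
      exact (hξK.2.mink_hom_pos hb.mem_closedPlane hne).ne' h0
  have hξab : ξ ∈ segment ℝ a b := by
    rcases hor with h | h <;> rw [h]
    exacts [left_mem_segment ℝ _ _, right_mem_segment ℝ _ _]
  refine ⟨hξab, ?_⟩
  have hRx : hreflection a b x ∈ K := hR.subset ⟨x, hx, rfl⟩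
  have hRo := isOrdinary_hreflection ha hb hab hxo
  have e := hom_hreflection ha hb hab hxo.mem_closedPlane
  have hw := reflVec_hom_pos ha hb hab hxo.mem_closedPlane
  set w := (reflVec a b (hom x)).2.2
  have hxa := mink_hom_pos_of_left hxo ha.mem_closedPlane
  have hxb := mink_hom_pos_of_left hxo hb.mem_closedPlane
  -- The sum of a vector and its mirror image lies in the plane of the axis. The resulting point is
  -- on the segment from `x` to its image, hence in `K`, and it is ordinary, hence different from
  -- `ξ`.
  have hsum : hom x + w • hom (hreflection a b x) =
      (2 / mink (hom a) (hom b) * mink (hom x) (hom b)) • hom a +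
      (2 / mink (hom a) (hom b) * mink (hom x) (hom a)) • hom b := by
    rw [← e, reflVec]; module
  have hm1 := toDisk_add_mem_segment (X := hom x) (Y := hom (hreflection a b x)) (a := 1)
    (b := w) one_pos one_pos zero_le_one hw.le (by linarith)
  have hm2 := toDisk_add_mem_segment (X := hom a) (Y := hom b)
    (a := 2 / mink (hom a) (hom b) * mink (hom x) (hom b))
    (b := 2 / mink (hom a) (hom b) * mink (hom x) (hom a)) one_pos one_pos (by positivity)
    (by positivity) (by positivity)
  rw [one_smul, hsum, toDisk_hom, toDisk_hom] at hm1
  rw [toDisk_hom, toDisk_hom] at hm2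
  refine ⟨_, ⟨hconv.segment_subset hx hRx hm1, hm2⟩, ?_⟩
  intro heq
  rw [heq] at hm1
  exact hξK.2.not_isOrdinary (isOrdinary_of_mem_segment hxo hRo hm1)

lemma hdist_of_isMajorAxis_semibounded {K : Set (ℝ × ℝ)} {ξ x : ℝ × ℝ} (hconv : Convex ℝ K)
    (hK : K ⊆ closedPlane) (hξ : ξ ∈ K) (hξa : IsAsymptotic ξ) (hx : x ∈ K) (hxo : IsOrdinary x)
    {p q : ℝ × ℝ} (h : IsMajorAxis K p q) : hdist p q = ∞ := by
  cases h with
  | bounded c r hK => exact absurd (hK ξ hξ) hξa.not_isOrdinary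
  | semibounded a b ξ' hK' hab hpq =>
    obtain ⟨h1, y, hy, hne⟩ := exists_mem_axis hconv hK' hab hx hxo
    have h2 : ξ = ξ' := by
      have : ξ ∈ {x ∈ K | IsAsymptotic x} := ⟨hξ, hξa⟩
      rwa [hK'] at this
    subst h2
    have h3 : ξ ∈ segment ℝ p q := hpq.subset ⟨hξ, h1⟩
    have hpK : p ∈ K := (hpq.superset (left_mem_segment ℝ p q)).1
    have hqK : q ∈ K := (hpq.superset (right_mem_segment ℝ p q)).1
    have hpq' : p ≠ q := by
      rintro rfl
      rw [hpq, segment_same] at hy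
      rw [segment_same] at h3
      exact hne (hy.trans h3.symm)
    rcases hξa.eq_or_eq_of_mem_segment (hK hpK) (hK hqK) h3 with h | h
    · exact hdist_eq_top (Or.inl (h ▸ hξa)) hpq'
    · exact hdist_eq_top (Or.inr (h ▸ hξa)) hpq'
  | band hp hq hne hpq => exact hdist_eq_top (Or.inl hp) hne

lemma hdist_of_isMajorAxis_singleton {ξ p q : ℝ × ℝ} (hξ : IsAsymptotic ξ)
    (h : IsMajorAxis {ξ} p q) : hdist p q = 0 := by
  cases h with
  | bounded c r hK => exact absurd (hK ξ rfl) hξ.not_isOrdinary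
  | semibounded a b ξ' hK' hab hpq =>
    have hpK : p = ξ := (hpq.superset (left_mem_segment ℝ p q)).1
    have hqK : q = ξ := (hpq.superset (right_mem_segment ℝ p q)).1
    rw [hpK, hqK, hdist_self]
  | band hp hq hne hpq =>
    have hpK : p = ξ := hpq (left_mem_segment ℝ p q)
    have hqK : q = ξ := hpq (right_mem_segment ℝ p q)
    exact absurd (hpK.trans hqK.symm) hne

lemma hdist_of_isMajorAxis_band {K : Set (ℝ × ℝ)} {ξ η p q : ℝ × ℝ} (hξ : ξ ∈ K)
    (hξa : IsAsymptotic ξ) (hη : η ∈ K) (hηa : IsAsymptotic η) (hne : ξ ≠ η)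
    (h : IsMajorAxis K p q) : hdist p q = ∞ := by
  cases h with
  | bounded c r hK => exact absurd (hK ξ hξ) hξa.not_isOrdinary
  | semibounded a b ξ' hK' hab hpq =>
    have h1 : ξ ∈ {x ∈ K | IsAsymptotic x} := ⟨hξ, hξa⟩
    have h2 : η ∈ {x ∈ K | IsAsymptotic x} := ⟨hη, hηa⟩
    rw [hK'] at h1 h2
    exact absurd (h1.trans h2.symm) hne
  | band hp hq hne hpq => exact hdist_eq_top (Or.inl hp) hne

/-! ## Foci of sets with asymptotic points -/

lemma focus_mem_parabola {F ξ : ℝ × ℝ} {c : ℝ} (hF : IsOrdinary F)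
    (hc : horoDist ξ F - c ≤ 0) : F ∈ parabola F ξ c := by
  right
  exact ⟨hF, by rw [ordDist_self hF]; linarith⟩

lemma not_ellipse_of_asymptotic {K : Set (ℝ × ℝ)} {ξ F₁ F₂ : ℝ × ℝ} {m : ℝ≥0} (hξ : ξ ∈ K)
    (hξa : IsAsymptotic ξ) (h₁ : IsOrdinary F₁) (h₂ : IsOrdinary F₂) :
    K ≠ ellipse F₁ F₂ m := by
  intro h
  rw [h] at hξ
  exact hξa.not_isOrdinary ((mem_ellipse h₁ h₂).1 hξ).1

lemma hdist_of_isFociPair_parabola {F ξ p q : ℝ × ℝ} {c : ℝ} (hF : IsOrdinary F)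
    (hξ : IsAsymptotic ξ) (hc : horoDist ξ F - c ≤ 0) (h : IsFociPair (parabola F ξ c) p q) :
    hdist p q = ∞ := by
  cases h with
  | ellipse _ m hp hq hm hK =>
    exact absurd hK (not_ellipse_of_asymptotic (Set.mem_insert _ _) hξ hp hq)
  | parabola _ c hF hξ hc hK =>
    exact hdist_eq_top (Or.inr hξ) (by rintro rfl; exact hξ.not_isOrdinary hF)
  | band _ r hξ hη hne hK => exact hdist_eq_top (Or.inl hξ) hne
  | horodisk c hξ' hK => exact absurd hK (parabola_ne_horodisk hF hξ)
  | asymptoticPoint hξ' hK =>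
    have : F = p := hK.subset (focus_mem_parabola hF hc)
    exact absurd (this ▸ hF) hξ'.not_isOrdinary

lemma hdist_of_isFociPair_band {ξ η p q : ℝ × ℝ} {r : ℝ≥0} (hξ : IsAsymptotic ξ)
    (hη : IsAsymptotic η) (hne : ξ ≠ η) (h : IsFociPair (band ξ η r) p q) :
    hdist p q = ∞ := by
  have m1 := segment_subset_band r hξ hη (left_mem_segment ℝ _ _)
  have m2 := segment_subset_band r hξ hη (right_mem_segment ℝ _ _)
  cases h with
  | ellipse _ m hp hq hm hK => exact absurd hK (not_ellipse_of_asymptotic m1 hξ hp hq)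
  | parabola _ c hF hξ hc hK =>
    exact hdist_eq_top (Or.inr hξ) (by rintro rfl; exact hξ.not_isOrdinary hF)
  | band _ r hξ hη hne hK => exact hdist_eq_top (Or.inl hξ) hne
  | horodisk c hξ' hK =>
    have e1 := mem_horodisk_asymptotic hξ (hK.subset m1)
    have e2 := mem_horodisk_asymptotic hη (hK.subset m2)
    exact absurd (e1.trans e2.symm) hne
  | asymptoticPoint hξ' hK =>
    have e1 : ξ = p := hK.subset m1
    have e2 : η = p := hK.subset m2
    exact absurd (e1.trans e2.symm) hne

lemma hdist_of_isFociPair_horodisk {ξ p q : ℝ × ℝ} {c : ℝ} (hξ : IsAsymptotic ξ)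
    (h : IsFociPair (horodisk ξ c) p q) : hdist p q = 0 := by
  cases h with
  | ellipse _ m hp hq hm hK =>
    exact absurd hK (not_ellipse_of_asymptotic (Set.mem_insert _ _) hξ hp hq)
  | parabola _ c hF hξ hc hK => exact absurd hK.symm (parabola_ne_horodisk hF hξ)
  | band _ r hξ' hη hne hK =>
    have m1 := segment_subset_band r hξ' hη (left_mem_segment ℝ _ _)
    have m2 := segment_subset_band r hξ' hη (right_mem_segment ℝ _ _)
    have e1 := mem_horodisk_asymptotic hξ' (hK.superset m1)
    have e2 := mem_horodisk_asymptotic hη (hK.superset m2)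
    exact absurd (e1.trans e2.symm) hne
  | horodisk c hξ' hK => exact hdist_self _
  | asymptoticPoint hξ' hK => exact hdist_self _

lemma hdist_of_isFociPair_singleton {ξ p q : ℝ × ℝ} (hξ : IsAsymptotic ξ)
    (h : IsFociPair {ξ} p q) : hdist p q = 0 := by
  cases h with
  | ellipse _ m hp hq hm hK =>
    exact absurd hK (not_ellipse_of_asymptotic rfl hξ hp hq)
  | parabola _ c hF hξ' hc hK =>
    have : p = ξ := hK.superset (focus_mem_parabola hF hc)
    exact absurd (this ▸ hF) hξ.not_isOrdinary
  | band _ r hξ' hη hne hK =>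
    have e1 : p = ξ := hK.superset (segment_subset_band r hξ' hη (left_mem_segment ℝ _ _))
    have e2 : q = ξ := hK.superset (segment_subset_band r hξ' hη (right_mem_segment ℝ _ _))
    exact absurd (e1.trans e2.symm) hne
  | horodisk c hξ' hK => exact hdist_self _
  | asymptoticPoint hξ' hK => exact hdist_self _

/-! ## The real Davis--Wielandt shell in the parabolic chart -/

/-- Homogeneous coordinates of the point with coordinates `u`, `q` in the chart in which the
absolute is the parabola `q = u²`. -/
def vec (u q : ℝ) : ℝ × ℝ × ℝ := (2 * u, q - 1, q + 1)

lemma mink_vec (u q u' q' : ℝ) : mink (vec u q) (vec u' q') = 2 * (q + q' - 2 * u * u') := by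
  simp only [mink, vec]; ring

section Shell

variable {H : Type*} [NormedAddCommGroup H] [InnerProductSpace ℂ H]

/-- The set of the pairs `(Re ⟨Ax, x⟩, ‖Ax‖²)` for unit vectors `x`. -/
def shell (A : H →ₗ[ℂ] H) : Set (ℝ × ℝ) :=
  {z | ∃ v : H, ‖v‖ = 1 ∧ z = ((inner ℂ (A v) v).re, ‖A v‖ ^ 2)}

lemma conformalRange_eq_image (A : H →ₗ[ℂ] H) :
    conformalRange A = (fun z : ℝ × ℝ => toDisk (vec z.1 z.2)) '' shell A := by
  ext p
  constructor
  · rintro ⟨x, hx, rfl⟩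
    have hn : ‖x‖ ≠ 0 := norm_ne_zero_iff.2 hx
    refine ⟨_, ⟨((‖x‖⁻¹ : ℝ) : ℂ) • x, ?_, rfl⟩, ?_⟩
    · rw [norm_smul, Complex.norm_real, norm_inv, norm_norm, inv_mul_cancel₀ hn]
    · have e : (inner ℂ (A (((‖x‖⁻¹ : ℝ) : ℂ) • x)) (((‖x‖⁻¹ : ℝ) : ℂ) • x)).re =
          (inner ℂ (A x) x).re / ‖x‖ ^ 2 := by
        rw [map_smul, inner_smul_left, inner_smul_right, Complex.conj_ofReal,
          Complex.re_ofReal_mul, Complex.re_ofReal_mul]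
        field_simp
      have e2 : ‖A (((‖x‖⁻¹ : ℝ) : ℂ) • x)‖ ^ 2 = ‖A x‖ ^ 2 / ‖x‖ ^ 2 := by
        rw [map_smul, norm_smul, Complex.norm_real, norm_inv, norm_norm]
        field_simp
      have hpos : 0 < ‖x‖ ^ 2 := by positivity
      have hpos2 : 0 < ‖A x‖ ^ 2 + ‖x‖ ^ 2 := by positivity
      simp only [toDisk, vec, e, e2]
      refine Prod.ext ?_ ?_ <;> simp only [] <;> field_simp
  · rintro ⟨_, ⟨v, hv, rfl⟩, rfl⟩
    refine ⟨v, ?_, ?_⟩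
    · rintro rfl
      simp at hv
    · simp [toDisk, vec, hv]

/-- The quantity `q - u²` is the squared distance of `A v` from `u • v`. So the shell lies above the
parabola and touches it only at real eigenvalues. -/
lemma shell_sub_sq (A : H →ₗ[ℂ] H) {v : H} (hv : ‖v‖ = 1) :
    ‖A v‖ ^ 2 - (inner ℂ (A v) v).re ^ 2 =
      ‖A v - (((inner ℂ (A v) v).re : ℝ) : ℂ) • v‖ ^ 2 := by
  have h := norm_sub_sq (𝕜 := ℂ) (A v) ((((inner ℂ (A v) v).re : ℝ) : ℂ) • v)
  rw [h, inner_smul_right, norm_smul, hv, Complex.norm_real, mul_one, Real.norm_eq_abs, sq_abs]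
  have : RCLike.re ((((inner ℂ (A v) v).re : ℝ) : ℂ) * inner ℂ (A v) v) =
      (inner ℂ (A v) v).re * (inner ℂ (A v) v).re := Complex.re_ofReal_mul _ _
  rw [this]; ring

lemma sq_le_of_mem_shell {A : H →ₗ[ℂ] H} {z : ℝ × ℝ} (hz : z ∈ shell A) : z.1 ^ 2 ≤ z.2 := by
  obtain ⟨v, hv, rfl⟩ := hz
  have := shell_sub_sq A hv
  nlinarith [sq_nonneg ‖A v - (((inner ℂ (A v) v).re : ℝ) : ℂ) • v‖]

lemma exists_eigenvector_of_mem_shell {A : H →ₗ[ℂ] H} {z : ℝ × ℝ} (hz : z ∈ shell A)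
    (h : z.2 = z.1 ^ 2) : ∃ v : H, v ≠ 0 ∧ A v = (z.1 : ℂ) • v := by
  obtain ⟨v, hv, rfl⟩ := hz
  have h1 := shell_sub_sq A hv
  simp only [] at h
  rw [h, sub_self] at h1
  refine ⟨v, ?_, ?_⟩
  · rintro rfl
    simp at hv
  · exact sub_eq_zero.1 (norm_eq_zero.1 (pow_eq_zero_iff two_ne_zero |>.1 h1.symm))

lemma isCompact_shell [FiniteDimensional ℂ H] (A : H →ₗ[ℂ] H) : IsCompact (shell A) := by
  have : FiniteDimensional ℝ H := FiniteDimensional.complexToReal H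
  have : ProperSpace H := FiniteDimensional.proper ℝ H
  have hA : Continuous A := A.continuous_of_finiteDimensional
  have e : shell A = (fun v : H => ((inner ℂ (A v) v).re, ‖A v‖ ^ 2)) '' Metric.sphere 0 1 := by
    ext z
    constructor
    · rintro ⟨v, hv, rfl⟩
      exact ⟨v, by simpa using hv, rfl⟩
    · rintro ⟨v, hv, rfl⟩
      exact ⟨v, by simpa using hv, rfl⟩
  rw [e]
  refine (isCompact_sphere _ _).image ?_
  exact (Complex.continuous_re.comp (hA.inner continuous_id)).prodMk (hA.norm.pow 2)

lemma isCompact_conformalRange [FiniteDimensional ℂ H] (A : H →ₗ[ℂ] H) :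
    IsCompact (conformalRange A) := by
  rw [conformalRange_eq_image]
  refine (isCompact_shell A).image_of_continuousOn ?_
  have hne : ∀ z ∈ shell A, z.2 + 1 ≠ 0 := fun z hz => by
    have := sq_le_of_mem_shell hz
    nlinarith [sq_nonneg z.1]
  simp only [toDisk, vec]
  exact ContinuousOn.prodMk
    (ContinuousOn.div (by fun_prop) (by fun_prop) hne)
    (ContinuousOn.div (by fun_prop) (by fun_prop) hne)

/-- The chart is projective with a positive denominator on `S`, so it preserves segments; the
weights only have to be rescaled by the denominators. -/
lemma convex_image_of_shell {S : Set (ℝ × ℝ)} (hS : Convex ℝ S) (hpos : ∀ z ∈ S, 0 < z.2 + 1) :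
    Convex ℝ ((fun z : ℝ × ℝ => toDisk (vec z.1 z.2)) '' S) := by
  rintro _ ⟨z, hz, rfl⟩ _ ⟨w, hw, rfl⟩ a b ha hb hab
  have h1 := hpos z hz
  have h2 := hpos w hw
  have hsum : 0 < a * (w.2 + 1) + b * (z.2 + 1) := by
    rcases ha.eq_or_lt with h | h
    · have : 0 < b := by linarith
      positivity
    · positivity
  refine ⟨_, hS hz hw (a := a * (w.2 + 1) / (a * (w.2 + 1) + b * (z.2 + 1)))
    (b := b * (z.2 + 1) / (a * (w.2 + 1) + b * (z.2 + 1))) (by positivity) (by positivity)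
    (by field_simp), ?_⟩
  have e : a * (w.2 + 1) / (a * (w.2 + 1) + b * (z.2 + 1)) * z.2 +
      b * (z.2 + 1) / (a * (w.2 + 1) + b * (z.2 + 1)) * w.2 + 1 =
      (z.2 + 1) * (w.2 + 1) / (a * (w.2 + 1) + b * (z.2 + 1)) := by
    field_simp
    linear_combination (z.2 + 1) * (w.2 + 1) * hab
  simp only [toDisk, vec, Prod.ext_iff, Prod.fst_add, Prod.snd_add, Prod.smul_fst, Prod.smul_snd,
    smul_eq_mul]
  rw [e]
  constructor
  · field_simp
  · field_simp
    linear_combination (-(a * (w.2 + 1) + b * (z.2 + 1))) * (0 : ℝ) * hab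

end Shell

/-! ## Triangular form -/

section Triangular

variable {H : Type*} [NormedAddCommGroup H] [InnerProductSpace ℂ H]

/-- The matrix of `A` in the orthonormal basis `e` is upper triangular. -/
structure IsTriangular (A : H →ₗ[ℂ] H) (e : OrthonormalBasis (Fin 2) ℂ H) (l₁ l₂ β : ℂ) :
    Prop where
  left : A (e 0) = l₁ • e 0
  right : A (e 1) = β • e 0 + l₂ • e 1

lemma exists_isTriangular [FiniteDimensional ℂ H] (hH : Module.finrank ℂ H = 2) (A : H →ₗ[ℂ] H) :
    ∃ e l₁ l₂ β, IsTriangular A e l₁ l₂ β := by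
  have : Nontrivial H := Module.nontrivial_of_finrank_pos (R := ℂ) (by omega)
  obtain ⟨l, hl⟩ := Module.End.exists_eigenvalue A
  obtain ⟨v, hv⟩ := hl.exists_hasEigenvector
  have hn : ‖v‖ ≠ 0 := norm_ne_zero_iff.2 hv.2
  set w : Fin 2 → H := ![((‖v‖⁻¹ : ℝ) : ℂ) • v, 0]
  have hw : Orthonormal ℂ (({0} : Set (Fin 2)).domRestrict w) := by
    constructor
    · rintro ⟨i, rfl⟩
      change ‖((‖v‖⁻¹ : ℝ) : ℂ) • v‖ = 1
      rw [norm_smul, Complex.norm_real, norm_inv, norm_norm, inv_mul_cancel₀ hn]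
    · rintro ⟨i, rfl⟩ ⟨j, rfl⟩ hij
      exact absurd rfl hij
  obtain ⟨e, he⟩ := hw.exists_orthonormalBasis_extension_of_card_eq (by simpa using hH)
  have he0 : e 0 = ((‖v‖⁻¹ : ℝ) : ℂ) • v := he 0 rfl
  refine ⟨e, l, inner ℂ (e 1) (A (e 1)), inner ℂ (e 0) (A (e 1)), ?_, ?_⟩
  · rw [he0, map_smul, hv.apply_eq_smul, smul_comm]
  · have := e.sum_repr' (A (e 1))
    rw [Fin.sum_univ_two] at this
    exact this.symm

lemma inner_basis (e : OrthonormalBasis (Fin 2) ℂ H) (x y x' y' : ℂ) :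
    inner ℂ (x • e 0 + y • e 1) (x' • e 0 + y' • e 1) =
      (starRingEnd ℂ) x * x' + (starRingEnd ℂ) y * y' := by
  simp only [inner_add_left, inner_add_right, inner_smul_left, inner_smul_right,
    e.inner_eq_ite]
  simp
  ring

lemma norm_sq_basis (e : OrthonormalBasis (Fin 2) ℂ H) (x y : ℂ) :
    ‖x • e 0 + y • e 1‖ ^ 2 = Complex.normSq x + Complex.normSq y := by
  have h := inner_self_eq_norm_sq (𝕜 := ℂ) (x • e 0 + y • e 1)
  rw [← h, inner_basis, ← Complex.normSq_eq_conj_mul_self, ← Complex.normSq_eq_conj_mul_self]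
  simp

variable {A : H →ₗ[ℂ] H} {e : OrthonormalBasis (Fin 2) ℂ H} {l₁ l₂ β : ℂ}

lemma IsTriangular.apply (h : IsTriangular A e l₁ l₂ β) (x y : ℂ) :
    A (x • e 0 + y • e 1) = (l₁ * x + β * y) • e 0 + (l₂ * y) • e 1 := by
  rw [map_add, map_smul, map_smul, h.left, h.right]; module

lemma IsTriangular.trace (h : IsTriangular A e l₁ l₂ β) :
    LinearMap.trace ℂ H A = l₁ + l₂ := by
  rw [LinearMap.trace_eq_sum_inner A e, Fin.sum_univ_two, h.left, h.right]
  simp [inner_add_right, inner_smul_right, e.inner_eq_ite]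

lemma IsTriangular.det (h : IsTriangular A e l₁ l₂ β) : LinearMap.det A = l₁ * l₂ := by
  rw [← LinearMap.det_toMatrix e.toBasis, Matrix.det_fin_two]
  simp [LinearMap.toMatrix_apply, h.left, h.right]

lemma IsTriangular.traceless (h : IsTriangular A e l₁ l₂ β) :
    IsTriangular (traceless A) e ((l₁ - l₂) / 2) (-((l₁ - l₂) / 2)) β := by
  constructor
  · simp only [ConformalRange.traceless, h.trace, LinearMap.sub_apply, LinearMap.smul_apply,
      LinearMap.id_apply, h.left]
    module
  · simp only [ConformalRange.traceless, h.trace, LinearMap.sub_apply, LinearMap.smul_apply,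
      LinearMap.id_apply, h.right]
    module

lemma IsTriangular.specDisc (h : IsTriangular A e l₁ l₂ β) :
    specDisc A = -((l₁ - l₂) / 2) ^ 2 := by
  rw [ConformalRange.specDisc, h.traceless.det]; ring

lemma IsTriangular.norm_specDisc (h : IsTriangular A e l₁ l₂ β) :
    ‖ConformalRange.specDisc A‖ = ((l₁.re - l₂.re) ^ 2 + (l₁.im - l₂.im) ^ 2) / 4 := by
  rw [h.specDisc, norm_neg, norm_pow, Complex.sq_norm, Complex.normSq_apply]
  simp
  ring

lemma IsTriangular.conjDisc (h : IsTriangular A e l₁ l₂ β) :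
    conjDisc A = (l₁.im + l₂.im) ^ 2 / 4 + (l₁.re - l₂.re) ^ 2 / 4 := by
  rw [ConformalRange.conjDisc, h.norm_specDisc, h.specDisc, h.trace]
  simp [sq]
  ring

lemma IsTriangular.metricDisc [FiniteDimensional ℂ H] (h : IsTriangular A e l₁ l₂ β) :
    metricDisc A =
      ((l₁.re - l₂.re) ^ 2 + (l₁.im - l₂.im) ^ 2) / 4 + Complex.normSq β / 2 := by
  rw [ConformalRange.metricDisc, LinearMap.trace_eq_sum_inner _ e, Fin.sum_univ_two]
  simp only [LinearMap.comp_apply, LinearMap.adjoint_inner_right]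
  have e1 := h.traceless.apply 1 0
  have e2 := h.traceless.apply 0 1
  simp only [one_smul, zero_smul, add_zero, zero_add] at e1 e2
  rw [e1, e2, inner_basis, inner_basis, ← Complex.normSq_eq_conj_mul_self,
    ← Complex.normSq_eq_conj_mul_self, ← Complex.normSq_eq_conj_mul_self,
    ← Complex.normSq_eq_conj_mul_self]
  simp only [Complex.add_re, Complex.ofReal_re, Complex.normSq_apply]
  simp
  ring

lemma IsTriangular.eigenvalue (h : IsTriangular A e l₁ l₂ β) {v : H} (hv : v ≠ 0) {l : ℂ}
    (hl : A v = l • v) : l = l₁ ∨ l = l₂ := by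
  have hsum := e.sum_repr' v
  rw [Fin.sum_univ_two] at hsum
  set x := inner ℂ (e 0) v
  set y := inner ℂ (e 1) v
  rw [← hsum, h.apply] at hl
  have h1 := congrArg (fun w => inner ℂ (e 1) w) hl
  have h0 := congrArg (fun w => inner ℂ (e 0) w) hl
  simp only [inner_add_right, inner_smul_right, e.inner_eq_ite] at h0 h1
  simp at h0 h1
  by_cases hy : y = 0
  · left
    have hx : x ≠ 0 := by
      intro hx
      rw [hx, hy] at hsum
      exact hv (by simpa using hsum.symm)
    rw [hy] at h0
    simp at h0
    exact (h0.resolve_right hx).symm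
  · right
    exact (h1.resolve_right hy).symm

end Triangular

/-! ## The equation of the shell -/

/-- The quadratic polynomial whose nonnegativity describes the shell of a nonnormal triangular
operator with eigenvalues `x₁ + i y₁`, `x₂ + i y₂` and squared off-diagonal modulus `B`. -/
noncomputable def conic (x₁ y₁ x₂ y₂ B : ℝ) (z : ℝ × ℝ) : ℝ :=
  y₂ ^ 2 * (z.2 + x₁ ^ 2 + y₁ ^ 2 - 2 * z.1 * x₁) ^ 2
    + y₁ ^ 2 * (z.2 + x₂ ^ 2 + y₂ ^ 2 - 2 * z.1 * x₂) ^ 2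
    - (y₁ ^ 2 + y₂ ^ 2 + (x₁ - x₂) ^ 2 + B) * (z.2 + x₁ ^ 2 + y₁ ^ 2 - 2 * z.1 * x₁)
      * (z.2 + x₂ ^ 2 + y₂ ^ 2 - 2 * z.1 * x₂)
    + ((y₁ ^ 2 + y₂ ^ 2 + (x₁ - x₂) ^ 2 + B) ^ 2 - 4 * y₁ ^ 2 * y₂ ^ 2) * (z.2 - z.1 ^ 2)

lemma conic_swap (x₁ y₁ x₂ y₂ B : ℝ) (z : ℝ × ℝ) :
    conic x₁ y₁ x₂ y₂ B z = conic x₂ y₂ x₁ y₁ B z := by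
  simp only [conic]; ring

lemma sq_add_le_of_add_eq_one {a b : ℝ} (ha : 0 ≤ a) (hb : 0 ≤ b) (hab : a + b = 1) (x y : ℝ) :
    (a * x + b * y) ^ 2 ≤ a * x ^ 2 + b * y ^ 2 := by
  have : a * x ^ 2 + b * y ^ 2 - (a * x + b * y) ^ 2 = a * b * (x - y) ^ 2 := by
    rw [show b = 1 - a by linarith]; ring
  nlinarith [mul_nonneg (mul_nonneg ha hb) (sq_nonneg (x - y))]

/-- The polynomial is a constant minus a nonnegative combination of squares of affine functions.
These are the coordinates of `2 (s b - t a)`, up to the factor `√B` in two of them, in the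
description of the shell by `exists_unit_vector`. -/
lemma convex_conic (x₁ y₁ x₂ y₂ : ℝ) {B : ℝ} (hB : 0 ≤ B) :
    Convex ℝ {z | 0 ≤ conic x₁ y₁ x₂ y₂ B z} := by
  obtain ⟨C, L₁, L₂, L₃, key, k₁, k₂, k₃⟩ : ∃ (C : ℝ) (L₁ L₂ L₃ : ℝ × ℝ → ℝ),
      (∀ z, conic x₁ y₁ x₂ y₂ B z = C - (B * L₁ z ^ 2 + B * L₂ z ^ 2 + L₃ z ^ 2)) ∧
      (∀ z w a b, a + b = 1 → L₁ (a • z + b • w) = a * L₁ z + b * L₁ w) ∧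
      (∀ z w a b, a + b = 1 → L₂ (a • z + b • w) = a * L₂ z + b * L₂ w) ∧
      (∀ z w a b, a + b = 1 → L₃ (a • z + b • w) = a * L₃ z + b * L₃ w) := by
    obtain ⟨σ, hσ⟩ : ∃ σ, σ = (x₁ + x₂) / 2 := ⟨_, rfl⟩
    obtain ⟨τ, hτ⟩ : ∃ τ, τ = (x₁ ^ 2 + y₁ ^ 2 + x₂ ^ 2 + y₂ ^ 2 + B) / 2 := ⟨_, rfl⟩
    obtain ⟨k, hk⟩ : ∃ k, k = (x₁ ^ 2 + y₁ ^ 2 - x₂ ^ 2 - y₂ ^ 2 - B) / 2 := ⟨_, rfl⟩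
    refine ⟨B * ((x₁ - x₂) ^ 2 * y₁ ^ 2 + ((x₁ - x₂) * x₁ - k) ^ 2 + B * y₁ ^ 2),
      fun z => 2 * (z.1 - σ) * x₁ - (z.2 - τ), fun z => 2 * (z.1 - σ) * y₁,
      fun z => 2 * (z.1 - σ) * k - (z.2 - τ) * (x₁ - x₂), ?_, ?_, ?_, ?_⟩
    · intro z
      simp only [conic, hk, hσ, hτ]
      ring
    all_goals
      intro z w a b hab
      obtain rfl : b = 1 - a := by linarith
      simp only [Prod.fst_add, Prod.snd_add, Prod.smul_fst, Prod.smul_snd, smul_eq_mul]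
      ring
  intro z hz w hw a b ha hb hab
  have hz' : 0 ≤ conic x₁ y₁ x₂ y₂ B z := hz
  have hw' : 0 ≤ conic x₁ y₁ x₂ y₂ B w := hw
  change 0 ≤ conic x₁ y₁ x₂ y₂ B (a • z + b • w)
  rw [key] at hz' hw' ⊢
  rw [k₁ z w a b hab, k₂ z w a b hab, k₃ z w a b hab]
  have f1 := mul_le_mul_of_nonneg_left (sq_add_le_of_add_eq_one ha hb hab (L₁ z) (L₁ w)) hB
  have f2 := mul_le_mul_of_nonneg_left (sq_add_le_of_add_eq_one ha hb hab (L₂ z) (L₂ w)) hB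
  have f3 := sq_add_le_of_add_eq_one ha hb hab (L₃ z) (L₃ w)
  have g1 := mul_nonneg ha hz'
  have g2 := mul_nonneg hb hw'
  have h4 : C = a * C + b * C := by rw [← add_mul, hab, one_mul]
  linarith

/-- A unit vector with prescribed scalar products with two given independent vectors. -/
lemma exists_unit_vector (a₁ a₂ a₃ b₁ b₂ b₃ s t : ℝ)
    (hc : 0 < (a₂ * b₃ - a₃ * b₂) ^ 2 + (a₃ * b₁ - a₁ * b₃) ^ 2 + (a₁ * b₂ - a₂ * b₁) ^ 2)
    (h : (s * b₁ - t * a₁) ^ 2 + (s * b₂ - t * a₂) ^ 2 + (s * b₃ - t * a₃) ^ 2 ≤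
      (a₂ * b₃ - a₃ * b₂) ^ 2 + (a₃ * b₁ - a₁ * b₃) ^ 2 + (a₁ * b₂ - a₂ * b₁) ^ 2) :
    ∃ n₁ n₂ n₃ : ℝ, n₁ ^ 2 + n₂ ^ 2 + n₃ ^ 2 = 1 ∧ a₁ * n₁ + a₂ * n₂ + a₃ * n₃ = s ∧
      b₁ * n₁ + b₂ * n₂ + b₃ * n₃ = t := by
  obtain ⟨c₁, hc₁⟩ : ∃ c, c = a₂ * b₃ - a₃ * b₂ := ⟨_, rfl⟩
  obtain ⟨c₂, hc₂⟩ : ∃ c, c = a₃ * b₁ - a₁ * b₃ := ⟨_, rfl⟩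
  obtain ⟨c₃, hc₃⟩ : ∃ c, c = a₁ * b₂ - a₂ * b₁ := ⟨_, rfl⟩
  obtain ⟨d₁, hd₁⟩ : ∃ d, d = s * b₁ - t * a₁ := ⟨_, rfl⟩
  obtain ⟨d₂, hd₂⟩ : ∃ d, d = s * b₂ - t * a₂ := ⟨_, rfl⟩
  obtain ⟨d₃, hd₃⟩ : ∃ d, d = s * b₃ - t * a₃ := ⟨_, rfl⟩
  rw [← hc₁, ← hc₂, ← hc₃] at hc h
  rw [← hd₁, ← hd₂, ← hd₃] at h
  obtain ⟨C, hC⟩ : ∃ C, C = c₁ ^ 2 + c₂ ^ 2 + c₃ ^ 2 := ⟨_, rfl⟩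
  obtain ⟨D, hD⟩ : ∃ D, D = d₁ ^ 2 + d₂ ^ 2 + d₃ ^ 2 := ⟨_, rfl⟩
  rw [← hC] at hc h
  rw [← hD] at h
  have hcd : c₁ * d₁ + c₂ * d₂ + c₃ * d₃ = 0 := by
    rw [hc₁, hc₂, hc₃, hd₁, hd₂, hd₃]; ring
  set r := √(C - D) with hr
  have hr2 : r ^ 2 = C - D := Real.sq_sqrt (by linarith)
  have ca : c₁ * a₁ + c₂ * a₂ + c₃ * a₃ = 0 := by rw [hc₁, hc₂, hc₃]; ring
  have cb : c₁ * b₁ + c₂ * b₂ + c₃ * b₃ = 0 := by rw [hc₁, hc₂, hc₃]; ring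
  -- With `c = a × b` and `d = s b - t a`, the plane conditions define a line parallel to `c`, whose
  -- point nearest to the origin is `(d × c) / |c|²`. The multiple `r` of `c` brings the vector to
  -- unit length.
  refine ⟨(d₂ * c₃ - d₃ * c₂ + r * c₁) / C, (d₃ * c₁ - d₁ * c₃ + r * c₂) / C,
    (d₁ * c₂ - d₂ * c₁ + r * c₃) / C, ?_, ?_, ?_⟩
  · field_simp
    have e : (d₂ * c₃ - d₃ * c₂ + r * c₁) ^ 2 + (d₃ * c₁ - d₁ * c₃ + r * c₂) ^ 2 +
        (d₁ * c₂ - d₂ * c₁ + r * c₃) ^ 2 = D * C - (c₁ * d₁ + c₂ * d₂ + c₃ * d₃) ^ 2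
          + r ^ 2 * C := by rw [hC, hD]; ring
    rw [hcd, hr2] at e
    linear_combination e
  · field_simp
    have e : a₁ * (d₂ * c₃ - d₃ * c₂ + r * c₁) + a₂ * (d₃ * c₁ - d₁ * c₃ + r * c₂)
        + a₃ * (d₁ * c₂ - d₂ * c₁ + r * c₃) =
        s * (c₁ * (a₂ * b₃ - a₃ * b₂) + c₂ * (a₃ * b₁ - a₁ * b₃) + c₃ * (a₁ * b₂ - a₂ * b₁))
          + r * (c₁ * a₁ + c₂ * a₂ + c₃ * a₃) := by rw [hd₁, hd₂, hd₃]; ring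
    rw [ca, ← hc₁, ← hc₂, ← hc₃] at e
    linear_combination e - s * hC
  · field_simp
    have e : b₁ * (d₂ * c₃ - d₃ * c₂ + r * c₁) + b₂ * (d₃ * c₁ - d₁ * c₃ + r * c₂)
        + b₃ * (d₁ * c₂ - d₂ * c₁ + r * c₃) =
        t * (c₁ * (a₂ * b₃ - a₃ * b₂) + c₂ * (a₃ * b₁ - a₁ * b₃) + c₃ * (a₁ * b₂ - a₂ * b₁))
          + r * (c₁ * b₁ + c₂ * b₂ + c₃ * b₃) := by rw [hd₁, hd₂, hd₃]; ring
    rw [cb, ← hc₁, ← hc₂, ← hc₃] at e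
    linear_combination e - t * hC

section Triangular

variable {H : Type*} [NormedAddCommGroup H] [InnerProductSpace ℂ H]
variable {A : H →ₗ[ℂ] H} {e : OrthonormalBasis (Fin 2) ℂ H} {l₁ l₂ β : ℂ}

/-- For `v = x e₀ + y e₁` the parameters are `P = |x|²`, `Q = |y|²` and `w₁ + i w₂ = β y x̄`. They
determine the shell point, and their only relations are the listed ones. -/
lemma IsTriangular.mem_shell (h : IsTriangular A e l₁ l₂ β) {z : ℝ × ℝ} :
    z ∈ shell A ↔ ∃ P Q w₁ w₂ : ℝ, 0 ≤ P ∧ 0 ≤ Q ∧ P + Q = 1 ∧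
      w₁ ^ 2 + w₂ ^ 2 = Complex.normSq β * P * Q ∧
      z = (P * l₁.re + Q * l₂.re + w₁,
        P * (l₁.re ^ 2 + l₁.im ^ 2) + Q * (l₂.re ^ 2 + l₂.im ^ 2 + Complex.normSq β)
          + 2 * (w₁ * l₁.re + w₂ * l₁.im)) := by
  have key : ∀ x y : ℂ, ((inner ℂ (A (x • e 0 + y • e 1)) (x • e 0 + y • e 1)).re,
      ‖A (x • e 0 + y • e 1)‖ ^ 2) =
      (Complex.normSq x * l₁.re + Complex.normSq y * l₂.re + (β * y * (starRingEnd ℂ) x).re,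
        Complex.normSq x * (l₁.re ^ 2 + l₁.im ^ 2)
          + Complex.normSq y * (l₂.re ^ 2 + l₂.im ^ 2 + Complex.normSq β)
          + 2 * ((β * y * (starRingEnd ℂ) x).re * l₁.re
            + (β * y * (starRingEnd ℂ) x).im * l₁.im)) := by
    intro x y
    rw [h.apply, inner_basis, norm_sq_basis]
    simp only [Complex.normSq_apply, Complex.add_re, Complex.mul_re, Complex.conj_re,
      Complex.conj_im, Complex.mul_im, Complex.add_im, map_add, map_mul]
    refine Prod.ext ?_ ?_ <;> simp only [] <;> ring
  constructor
  · rintro ⟨v, hv, rfl⟩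
    have hsum := e.sum_repr' v
    rw [Fin.sum_univ_two] at hsum
    generalize inner ℂ (e 0) v = x at hsum
    generalize inner ℂ (e 1) v = y at hsum
    subst hsum
    have hn := norm_sq_basis e x y
    rw [hv, one_pow] at hn
    refine ⟨Complex.normSq x, Complex.normSq y, (β * y * (starRingEnd ℂ) x).re,
      (β * y * (starRingEnd ℂ) x).im, Complex.normSq_nonneg _, Complex.normSq_nonneg _, hn.symm,
      ?_, key x y⟩
    have : Complex.normSq (β * y * (starRingEnd ℂ) x) =
        Complex.normSq β * Complex.normSq x * Complex.normSq y := by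
      rw [map_mul, map_mul, Complex.normSq_conj]; ring
    rw [← this, Complex.normSq_apply]; ring
  · rintro ⟨P, Q, w₁, w₂, hP, hQ, hPQ, hw, rfl⟩
    obtain ⟨x, y, hx, hy, hxy⟩ : ∃ x y : ℂ, Complex.normSq x = P ∧ Complex.normSq y = Q ∧
        β * y * (starRingEnd ℂ) x = ⟨w₁, w₂⟩ := by
      by_cases h0 : Complex.normSq β * P = 0
      · rw [h0, zero_mul] at hw
        have e1 : w₁ = 0 := by nlinarith [sq_nonneg w₁, sq_nonneg w₂]
        have e2 : w₂ = 0 := by nlinarith [sq_nonneg w₁, sq_nonneg w₂]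
        refine ⟨(√P : ℝ), (√Q : ℝ), ?_, ?_, ?_⟩
        · rw [Complex.normSq_ofReal, Real.mul_self_sqrt hP]
        · rw [Complex.normSq_ofReal, Real.mul_self_sqrt hQ]
        · rw [e1, e2]
          rcases mul_eq_zero.1 h0 with h1 | h1
          · rw [Complex.normSq_eq_zero.1 h1]; simp; rfl
          · rw [h1]; simp; rfl
      · have hP0 : P ≠ 0 := right_ne_zero_of_mul h0
        have hβ0 : β ≠ 0 := fun hβ => left_ne_zero_of_mul h0 (by rw [hβ, map_zero])
        have hβn := left_ne_zero_of_mul h0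
        have hPpos : 0 < P := lt_of_le_of_ne hP hP0.symm
        have hs : (√P : ℝ) ≠ 0 := (Real.sqrt_pos.2 hPpos).ne'
        refine ⟨(√P : ℝ), ⟨w₁, w₂⟩ / (β * (√P : ℝ)), ?_, ?_, ?_⟩
        · rw [Complex.normSq_ofReal, Real.mul_self_sqrt hP]
        · rw [Complex.normSq_div, Complex.normSq_mk, map_mul, Complex.normSq_ofReal,
            Real.mul_self_sqrt hP, ← sq, ← sq, hw]
          field_simp
        · rw [Complex.conj_ofReal]
          have : ((√P : ℝ) : ℂ) ≠ 0 := Complex.ofReal_ne_zero.2 hs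
          field_simp
    refine ⟨x • e 0 + y • e 1, ?_, ?_⟩
    · have := norm_sq_basis e x y
      rw [hx, hy, hPQ] at this
      exact (pow_eq_one_iff_of_nonneg (norm_nonneg _) two_ne_zero).1 this
    · rw [key, hx, hy, hxy]

/-- The normal case is separate because for `B = 0` the polynomial `conic` is minus a square and no
longer singles out the segment on its zero set. -/
lemma IsTriangular.shell_eq_segment (h : IsTriangular A e l₁ l₂ β) (hβ : Complex.normSq β = 0) :
    shell A = segment ℝ (l₁.re, l₁.re ^ 2 + l₁.im ^ 2) (l₂.re, l₂.re ^ 2 + l₂.im ^ 2) := by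
  ext z
  rw [h.mem_shell, hβ]
  constructor
  · rintro ⟨P, Q, w₁, w₂, hP, hQ, hPQ, hw, rfl⟩
    have e1 : w₁ = 0 := by nlinarith [sq_nonneg w₁, sq_nonneg w₂]
    have e2 : w₂ = 0 := by nlinarith [sq_nonneg w₁, sq_nonneg w₂]
    refine ⟨P, Q, hP, hQ, hPQ, ?_⟩
    simp [e1, e2]
  · rintro ⟨P, Q, hP, hQ, hPQ, rfl⟩
    exact ⟨P, Q, 0, 0, hP, hQ, hPQ, by simp, by simp⟩

lemma IsTriangular.shell_eq_conic (h : IsTriangular A e l₁ l₂ β) (hβ : 0 < Complex.normSq β) :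
    shell A = {z | 0 ≤ conic l₁.re l₁.im l₂.re l₂.im (Complex.normSq β) z} := by
  ext z
  rw [h.mem_shell, Set.mem_ofPred_eq]
  generalize Complex.normSq β = B at hβ
  generalize l₁.re = x₁
  generalize l₁.im = y₁
  generalize l₂.re = x₂
  generalize l₂.im = y₂
  constructor
  · rintro ⟨P, Q, w₁, w₂, hP, hQ, hPQ, hw, rfl⟩
    obtain rfl : Q = 1 - P := by linarith
    set k := (x₁ ^ 2 + y₁ ^ 2 - x₂ ^ 2 - y₂ ^ 2 - B) / 2 with hk
    -- On the unit sphere `|a × b|² - |s b - t a|² = ((a × b) · n)²` with `s = a · n`, `t = b · n`;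
    -- the right-hand side is four times this square.
    have : conic x₁ y₁ x₂ y₂ B (P * x₁ + (1 - P) * x₂ + w₁,
        P * (x₁ ^ 2 + y₁ ^ 2) + (1 - P) * (x₂ ^ 2 + y₂ ^ 2 + B) + 2 * (w₁ * x₁ + w₂ * y₁)) =
        (2 * (-((x₁ - x₂) * y₁ * w₁) + ((x₁ - x₂) * x₁ - k) * w₂
          + B * y₁ / 2 * (2 * P - 1))) ^ 2 := by
      simp only [conic, hk]
      linear_combination (-4 * ((x₁ - x₂) ^ 2 * y₁ ^ 2
        + ((x₁ - x₂) * x₁ - (x₁ ^ 2 + y₁ ^ 2 - x₂ ^ 2 - y₂ ^ 2 - B) / 2) ^ 2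
        + B * y₁ ^ 2)) * hw
    rw [this]
    positivity
  · intro hz
    obtain ⟨u, q⟩ := z
    set b := √B with hb
    have hb0 : 0 < b := Real.sqrt_pos.2 hβ
    have hb2 : b ^ 2 = B := Real.sq_sqrt hβ.le
    -- The affine map from the sphere to the shell has rank two: its cross product has third
    -- component `B y₁ / 2`, and if `y₁ = 0` the second one is positive.
    have hcc : 0 < (0 * ((x₁ ^ 2 + y₁ ^ 2 - x₂ ^ 2 - y₂ ^ 2 - B) / 2)
          - (x₁ - x₂) / 2 * (b * y₁)) ^ 2
        + ((x₁ - x₂) / 2 * (b * x₁) - b / 2 * ((x₁ ^ 2 + y₁ ^ 2 - x₂ ^ 2 - y₂ ^ 2 - B) / 2)) ^ 2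
        + (b / 2 * (b * y₁) - 0 * (b * x₁)) ^ 2 := by
      by_cases hy : y₁ = 0
      · subst hy
        have : (x₁ - x₂) / 2 * (b * x₁)
            - b / 2 * ((x₁ ^ 2 + 0 ^ 2 - x₂ ^ 2 - y₂ ^ 2 - B) / 2) =
            b / 4 * ((x₁ - x₂) ^ 2 + y₂ ^ 2 + B) := by ring
        rw [this]
        have : 0 < b / 4 * ((x₁ - x₂) ^ 2 + y₂ ^ 2 + B) := by positivity
        positivity
      · have : 0 < (b / 2 * (b * y₁) - 0 * (b * x₁)) ^ 2 := by
          rw [zero_mul, sub_zero]; positivity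
        positivity
    obtain ⟨n₁, n₂, n₃, hn, hs, ht⟩ := exists_unit_vector (b / 2) 0 ((x₁ - x₂) / 2) (b * x₁)
      (b * y₁) ((x₁ ^ 2 + y₁ ^ 2 - x₂ ^ 2 - y₂ ^ 2 - B) / 2) (u - (x₁ + x₂) / 2)
      (q - (x₁ ^ 2 + y₁ ^ 2 + x₂ ^ 2 + y₂ ^ 2 + B) / 2) hcc (by
        rw [← hb2] at hz ⊢
        simp only [conic] at hz
        nlinarith only [hz])
    refine ⟨(1 + n₃) / 2, (1 - n₃) / 2, b * n₁ / 2, b * n₂ / 2, ?_, ?_, by ring, ?_, ?_⟩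
    · nlinarith [sq_nonneg n₁, sq_nonneg n₂]
    · nlinarith [sq_nonneg n₁, sq_nonneg n₂]
    · rw [← hb2]; linear_combination (b ^ 2 / 4) * hn
    · refine Prod.ext ?_ ?_
      · simp only []; linear_combination -hs
      · simp only []; linear_combination -ht

end Triangular

/-! ## The parabolic chart -/

/-- The point of the disk with given coordinates in the parabolic chart. -/
noncomputable def chart (z : ℝ × ℝ) : ℝ × ℝ := toDisk (vec z.1 z.2)

lemma vec_snd_snd (u q : ℝ) : (vec u q).2.2 = q + 1 := rfl

lemma add_one_pos_of_sq_le {z : ℝ × ℝ} (hz : z.1 ^ 2 ≤ z.2) : 0 < z.2 + 1 := by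
  nlinarith [sq_nonneg z.1]

lemma chart_injective {z w : ℝ × ℝ} (hz : 0 < z.2 + 1) (hw : 0 < w.2 + 1)
    (h : chart z = chart w) : z = w := by
  have h1 := congrArg Prod.fst h
  have h2 := congrArg Prod.snd h
  simp only [chart, toDisk, vec] at h1 h2
  have h3 : z.2 = w.2 := by
    rw [div_eq_div_iff hz.ne' hw.ne'] at h2
    linarith
  rw [h3] at h1
  have h4 : z.1 = w.1 := by
    rw [div_left_inj' hw.ne'] at h1
    linarith
  exact Prod.ext h4 h3

lemma one_sub_dot_chart {z : ℝ × ℝ} (hz : 0 < z.2 + 1) :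
    1 - dot (chart z) (chart z) = 4 * (z.2 - z.1 ^ 2) / (z.2 + 1) ^ 2 := by
  rw [chart, one_sub_dot_toDisk (by rw [vec_snd_snd]; exact hz.ne')
    (by rw [vec_snd_snd]; exact hz.ne'), mink_vec, vec_snd_snd]
  ring

lemma isOrdinary_chart {z : ℝ × ℝ} (hz : z.1 ^ 2 < z.2) : IsOrdinary (chart z) := by
  refine isOrdinary_toDisk ?_ ?_
  · rw [vec_snd_snd]; exact (add_one_pos_of_sq_le hz.le).ne'
  · rw [mink_vec]; linarith

lemma isAsymptotic_chart {z : ℝ × ℝ} (hz : z.2 = z.1 ^ 2) : IsAsymptotic (chart z) := by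
  have h := one_sub_dot_chart (add_one_pos_of_sq_le hz.ge)
  rw [hz, sub_self, mul_zero, zero_div] at h
  exact (sub_eq_zero.1 h).symm

lemma exists_chart {p : ℝ × ℝ} (hp : IsOrdinary p) : ∃ z : ℝ × ℝ, z.1 ^ 2 < z.2 ∧ chart z = p := by
  have hp' : p.1 * p.1 + p.2 * p.2 < 1 := hp
  have h1 : 0 < 1 - p.2 := by nlinarith [sq_nonneg p.1]
  refine ⟨(p.1 / (1 - p.2), (1 + p.2) / (1 - p.2)), ?_, ?_⟩
  · have : (1 + p.2) / (1 - p.2) - (p.1 / (1 - p.2)) ^ 2 =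
        (1 - (p.1 * p.1 + p.2 * p.2)) / (1 - p.2) ^ 2 := by field_simp; ring
    have h2 : 0 < (1 - (p.1 * p.1 + p.2 * p.2)) / (1 - p.2) ^ 2 :=
      div_pos (by linarith) (by positivity)
    simp only []
    linarith
  · have e : (1 + p.2) / (1 - p.2) + 1 = 2 / (1 - p.2) := by field_simp; ring
    have e' : (1 + p.2) / (1 - p.2) - 1 = 2 * p.2 / (1 - p.2) := by field_simp; ring
    simp only [chart, toDisk, vec, e, e']
    refine Prod.ext ?_ ?_ <;> simp only [] <;> field_simp

lemma lift_chart {z : ℝ × ℝ} (hz : z.1 ^ 2 < z.2) :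
    lift (chart z) = (2 * √(z.2 - z.1 ^ 2))⁻¹ • vec z.1 z.2 := by
  have h : mink (vec z.1 z.2) (vec z.1 z.2) = 2 ^ 2 * (z.2 - z.1 ^ 2) := by rw [mink_vec]; ring
  rw [chart, lift_toDisk_of_pos (by rw [vec_snd_snd]; exact add_one_pos_of_sq_le hz.le)
    (by rw [h]; linarith), h, Real.sqrt_mul (by norm_num), Real.sqrt_sq (by norm_num)]

/-- This identifies `chart (x, x² + y²)` as the focus belonging to the eigenvalue `x + i y`: the
factors of `conic` become hyperbolic cosines of the distances from it. -/
lemma mink_lift_chart {x y : ℝ} (hy : y ≠ 0) {z : ℝ × ℝ} (hz : z.1 ^ 2 < z.2) :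
    mink (lift (chart (x, x ^ 2 + y ^ 2))) (lift (chart z)) =
      (z.2 + x ^ 2 + y ^ 2 - 2 * z.1 * x) / (2 * |y| * √(z.2 - z.1 ^ 2)) := by
  have hy2 : 0 < y ^ 2 := by positivity
  rw [lift_chart hz, lift_chart (by simp only []; linarith), mink_smul_left, mink_smul_right,
    mink_vec]
  simp only []
  rw [show x ^ 2 + y ^ 2 - x ^ 2 = y ^ 2 by ring, Real.sqrt_sq_eq_abs]
  have h1 : 0 < √(z.2 - z.1 ^ 2) := Real.sqrt_pos.2 (by linarith)
  have h2 : 0 < |y| := abs_pos.2 hy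
  field_simp
  ring

lemma mink_hom_chart (x : ℝ) {z : ℝ × ℝ} (hz : z.1 ^ 2 < z.2) :
    mink (hom (chart (x, x ^ 2))) (lift (chart z)) =
      (z.2 + x ^ 2 - 2 * z.1 * x) / ((x ^ 2 + 1) * √(z.2 - z.1 ^ 2)) := by
  have h1 : 0 < √(z.2 - z.1 ^ 2) := Real.sqrt_pos.2 (by linarith)
  have h2 : 0 < x ^ 2 + 1 := by positivity
  rw [lift_chart hz, chart, hom_toDisk (by rw [vec_snd_snd]; exact h2.ne'), mink_smul_left,
    mink_smul_right, mink_vec, vec_snd_snd]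
  field_simp
  ring

lemma mink_hom_chart_hom (x x' : ℝ) :
    mink (hom (chart (x, x ^ 2))) (hom (chart (x', x' ^ 2))) =
      2 * (x - x') ^ 2 / ((x ^ 2 + 1) * (x' ^ 2 + 1)) := by
  have h1 : 0 < x ^ 2 + 1 := by positivity
  have h2 : 0 < x' ^ 2 + 1 := by positivity
  rw [chart, chart, hom_toDisk (by rw [vec_snd_snd]; exact h1.ne'),
    hom_toDisk (by rw [vec_snd_snd]; exact h2.ne'), mink_smul_left, mink_smul_right, mink_vec,
    vec_snd_snd, vec_snd_snd]
  field_simp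
  ring

lemma chart_image_segment {z w : ℝ × ℝ} (hz : 0 < z.2 + 1) (hw : 0 < w.2 + 1) :
    chart '' segment ℝ z w = segment ℝ (chart z) (chart w) := by
  apply Set.Subset.antisymm
  · rintro _ ⟨_, ⟨a, b, ha, hb, hab, rfl⟩, rfl⟩
    have e : vec (a • z + b • w).1 (a • z + b • w).2 = a • vec z.1 z.2 + b • vec w.1 w.2 := by
      simp only [vec, Prod.ext_iff, Prod.fst_add, Prod.snd_add, Prod.smul_fst, Prod.smul_snd,
        smul_eq_mul]
      refine ⟨by ring, ?_, ?_⟩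
      · linear_combination hab
      · linear_combination -hab
    rw [show chart (a • z + b • w) = toDisk (vec (a • z + b • w).1 (a • z + b • w).2) from rfl, e]
    exact toDisk_add_mem_segment hz hw ha hb (by linarith)
  · have hconv : Convex ℝ (chart '' segment ℝ z w) := by
      refine convex_image_of_shell (convex_segment z w) ?_
      rintro _ ⟨a, b, ha, hb, hab, rfl⟩
      simp only [Prod.snd_add, Prod.smul_snd, smul_eq_mul]
      have : a * z.2 + b * w.2 + 1 = a * (z.2 + 1) + b * (w.2 + 1) := by
        linear_combination -hab
      rw [this]
      rcases ha.eq_or_lt with h | h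
      · have : 0 < b := by linarith
        positivity
      · positivity
    exact hconv.segment_subset ⟨z, left_mem_segment ℝ z w, rfl⟩
      ⟨w, right_mem_segment ℝ z w, rfl⟩

/-! ## Conformal ranges in the parabolic chart -/

/-- `S` is the shell of an operator with eigenvalues `x₁ + i y₁`, `x₂ + i y₂` and squared modulus
`B` of the off-diagonal entry in a triangular form. -/
structure IsShell (S : Set (ℝ × ℝ)) (x₁ y₁ x₂ y₂ B : ℝ) : Prop where
  nonneg : 0 ≤ B
  eq_conic : 0 < B → S = {z | 0 ≤ conic x₁ y₁ x₂ y₂ B z}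
  eq_segment : B = 0 → S = segment ℝ (x₁, x₁ ^ 2 + y₁ ^ 2) (x₂, x₂ ^ 2 + y₂ ^ 2)
  sq_le : ∀ z ∈ S, z.1 ^ 2 ≤ z.2
  eigenvalue : ∀ z ∈ S, z.2 = z.1 ^ 2 → (z.1 = x₁ ∧ y₁ = 0) ∨ (z.1 = x₂ ∧ y₂ = 0)

lemma IsTriangular.isShell {H : Type*} [NormedAddCommGroup H] [InnerProductSpace ℂ H]
    {A : H →ₗ[ℂ] H} {e : OrthonormalBasis (Fin 2) ℂ H} {l₁ l₂ β : ℂ}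
    (h : IsTriangular A e l₁ l₂ β) :
    IsShell (shell A) l₁.re l₁.im l₂.re l₂.im (Complex.normSq β) where
  nonneg := Complex.normSq_nonneg β
  eq_conic := h.shell_eq_conic
  eq_segment := h.shell_eq_segment
  sq_le _ := sq_le_of_mem_shell
  eigenvalue z hz hz' := by
    obtain ⟨v, hv, hA⟩ := exists_eigenvector_of_mem_shell hz hz'
    rcases h.eigenvalue hv hA with rfl | rfl <;> simp

namespace IsShell

variable {S : Set (ℝ × ℝ)} {x₁ y₁ x₂ y₂ B : ℝ}

lemma swap (h : IsShell S x₁ y₁ x₂ y₂ B) : IsShell S x₂ y₂ x₁ y₁ B where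
  nonneg := h.nonneg
  eq_conic hB := by rw [h.eq_conic hB]; simp only [conic_swap x₁ y₁]
  eq_segment hB := by rw [h.eq_segment hB, segment_symm]
  sq_le := h.sq_le
  eigenvalue z hz hz' := (h.eigenvalue z hz hz').symm

lemma convex (h : IsShell S x₁ y₁ x₂ y₂ B) : Convex ℝ (chart '' S) := by
  refine convex_image_of_shell ?_ fun z hz => add_one_pos_of_sq_le (h.sq_le z hz)
  rcases h.nonneg.eq_or_lt with hB | hB
  · rw [h.eq_segment hB.symm]; exact convex_segment _ _
  · rw [h.eq_conic hB]; exact convex_conic _ _ _ _ hB.le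

lemma subset_closedPlane (h : IsShell S x₁ y₁ x₂ y₂ B) : chart '' S ⊆ closedPlane := by
  rintro _ ⟨z, hz, rfl⟩
  rcases (h.sq_le z hz).eq_or_lt with h1 | h1
  · exact (isAsymptotic_chart h1.symm).mem_closedPlane
  · exact (isOrdinary_chart h1).mem_closedPlane

lemma chart_mem (h : IsShell S x₁ y₁ x₂ y₂ B) {z : ℝ × ℝ} (hz : z.1 ^ 2 ≤ z.2) :
    chart z ∈ chart '' S ↔ z ∈ S := by
  refine ⟨?_, fun hz => ⟨z, hz, rfl⟩⟩
  rintro ⟨w, hw, hwz⟩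
  rwa [← chart_injective (add_one_pos_of_sq_le (h.sq_le w hw)) (add_one_pos_of_sq_le hz) hwz]

lemma asymptotic (h : IsShell S x₁ y₁ x₂ y₂ B) {p : ℝ × ℝ} (hp : IsAsymptotic p)
    (hpS : p ∈ chart '' S) :
    (p = chart (x₁, x₁ ^ 2) ∧ y₁ = 0) ∨ (p = chart (x₂, x₂ ^ 2) ∧ y₂ = 0) := by
  obtain ⟨z, hz, rfl⟩ := hpS
  have h1 : z.2 = z.1 ^ 2 := by
    by_contra hne
    exact hp.not_isOrdinary (isOrdinary_chart (lt_of_le_of_ne (h.sq_le z hz) (Ne.symm hne)))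
  rcases h.eigenvalue z hz h1 with ⟨h2, h3⟩ | ⟨h2, h3⟩
  · left; exact ⟨by rw [← h2, ← h1], h3⟩
  · right; exact ⟨by rw [← h2, ← h1], h3⟩

lemma mem_left (h : IsShell S x₁ 0 x₂ y₂ B) : (x₁, x₁ ^ 2) ∈ S := by
  rcases h.nonneg.eq_or_lt with hB | hB
  · rw [h.eq_segment hB.symm]
    convert left_mem_segment ℝ _ _ using 2
    ring
  · rw [h.eq_conic hB]
    change 0 ≤ conic _ _ _ _ _ _
    simp only [conic]
    apply le_of_eq
    ring

lemma mem_right (h : IsShell S x₁ y₁ x₂ 0 B) : (x₂, x₂ ^ 2) ∈ S := h.swap.mem_left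

lemma image_eq (h : IsShell S x₁ y₁ x₂ y₂ B) {T : Set (ℝ × ℝ)} (hT : T ⊆ closedPlane)
    (hord : ∀ z : ℝ × ℝ, z.1 ^ 2 < z.2 → (z ∈ S ↔ chart z ∈ T))
    (hasym : ∀ p, IsAsymptotic p → (p ∈ chart '' S ↔ p ∈ T)) : chart '' S = T := by
  ext p
  have key : p ∈ closedPlane → (p ∈ chart '' S ↔ p ∈ T) := fun hp => by
    rcases isOrdinary_or_isAsymptotic hp with hp | hp
    · obtain ⟨z, hz, rfl⟩ := exists_chart hp
      rw [h.chart_mem hz.le, hord z hz]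
    · exact hasym p hp
  exact ⟨fun hp => (key (h.subset_closedPlane hp)).1 hp, fun hp => (key (hT hp)).2 hp⟩

end IsShell

/-! ## Operators without real eigenvalues -/

/-- The polynomial factors as `(cosh m - cosh (d₁ + d₂)) (cosh m - cosh (d₁ - d₂))`. Since `|d₁ -
d₂| ≤ d(F₁, F₂) < m`, the second factor is positive and the sign is that of the first. -/
lemma mem_ellipse_iff_of_lt {F₁ F₂ x : ℝ × ℝ} {m : ℝ≥0} (h₁ : IsOrdinary F₁)
    (h₂ : IsOrdinary F₂) (hx : IsOrdinary x) (hm : ordDist F₁ F₂ < m) :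
    x ∈ ellipse F₁ F₂ m ↔
      0 ≤ mink (lift F₁) (lift x) ^ 2 + mink (lift F₂) (lift x) ^ 2
        - 2 * Real.cosh m * mink (lift F₁) (lift x) * mink (lift F₂) (lift x)
        + Real.cosh m ^ 2 - 1 := by
  have hm0 : (0 : ℝ) ≤ m := m.2
  have d1 := ordDist_nonneg h₁ hx
  have d2 := ordDist_nonneg h₂ hx
  have h3 : Real.cosh (ordDist F₁ x - ordDist F₂ x) < Real.cosh m := by
    rw [Real.cosh_lt_cosh, abs_of_nonneg hm0]
    exact (abs_sub_ordDist_le h₁ h₂ hx).trans_lt hm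
  rw [← cosh_ordDist h₁ hx, ← cosh_ordDist h₂ hx, mem_ellipse h₁ h₂, and_iff_right hx,
    ← cosh_le_cosh_iff (add_nonneg d1 d2) hm0]
  have key : Real.cosh (ordDist F₁ x) ^ 2 + Real.cosh (ordDist F₂ x) ^ 2
        - 2 * Real.cosh m * Real.cosh (ordDist F₁ x) * Real.cosh (ordDist F₂ x)
        + Real.cosh m ^ 2 - 1 =
      (Real.cosh m - Real.cosh (ordDist F₁ x + ordDist F₂ x)) *
        (Real.cosh m - Real.cosh (ordDist F₁ x - ordDist F₂ x)) := by
    rw [Real.cosh_add, Real.cosh_sub]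
    have e1 := Real.sinh_sq (ordDist F₁ x)
    have e2 := Real.sinh_sq (ordDist F₂ x)
    linear_combination Real.sinh (ordDist F₂ x) ^ 2 * e1
      + (Real.cosh (ordDist F₁ x) ^ 2 - 1) * e2
  rw [key, mul_nonneg_iff_of_pos_right (sub_pos.2 h3), sub_nonneg]

lemma segment_eq_ellipse {p q : ℝ × ℝ} (hp : IsOrdinary p) (hq : IsOrdinary q) {m : ℝ≥0}
    (hm : ordDist p q = m) : segment ℝ p q = ellipse p q m := by
  ext x
  rw [mem_ellipse hp hq]
  constructor
  · intro hx
    refine ⟨isOrdinary_of_mem_segment hp hq hx, ?_⟩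
    rw [ordDist_comm q x, ordDist_add_of_mem_segment hp hq hx, hm]
  · rintro ⟨hx, h⟩
    rw [ordDist_comm q x, ← hm] at h
    exact mem_segment_of_ordDist_add_le hp hq hx h

lemma IsShell.eq_ellipse {S : Set (ℝ × ℝ)} {x₁ y₁ x₂ y₂ B : ℝ} (h : IsShell S x₁ y₁ x₂ y₂ B)
    (h₁ : y₁ ≠ 0) (h₂ : y₂ ≠ 0) :
    ∃ (F₁ F₂ : ℝ × ℝ) (m : ℝ≥0), IsOrdinary F₁ ∧ IsOrdinary F₂ ∧ ordDist F₁ F₂ ≤ m ∧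
      chart '' S = ellipse F₁ F₂ m ∧
      (m : ℝ) = Real.arcosh ((y₁ ^ 2 + y₂ ^ 2 + (x₁ - x₂) ^ 2 + B) / 2 / |y₁ * y₂|) ∧
      ordDist F₁ F₂ = Real.arcosh ((y₁ ^ 2 + y₂ ^ 2 + (x₁ - x₂) ^ 2) / 2 / |y₁ * y₂|) := by
  have q1 : 0 < y₁ ^ 2 := by positivity
  have q2 : 0 < y₂ ^ 2 := by positivity
  have a1 : 0 < |y₁| := abs_pos.2 h₁
  have a2 : 0 < |y₂| := abs_pos.2 h₂
  have hB := h.nonneg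
  have l1 : (x₁, x₁ ^ 2 + y₁ ^ 2).1 ^ 2 < (x₁, x₁ ^ 2 + y₁ ^ 2).2 := by simp only []; linarith
  have l2 : (x₂, x₂ ^ 2 + y₂ ^ 2).1 ^ 2 < (x₂, x₂ ^ 2 + y₂ ^ 2).2 := by simp only []; linarith
  have o1 := isOrdinary_chart l1
  have o2 := isOrdinary_chart l2
  have hd : mink (lift (chart (x₁, x₁ ^ 2 + y₁ ^ 2))) (lift (chart (x₂, x₂ ^ 2 + y₂ ^ 2))) =
      (y₁ ^ 2 + y₂ ^ 2 + (x₁ - x₂) ^ 2) / 2 / |y₁ * y₂| := by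
    rw [mink_lift_chart h₁ l2, show x₂ ^ 2 + y₂ ^ 2 - x₂ ^ 2 = y₂ ^ 2 by ring,
      Real.sqrt_sq_eq_abs, abs_mul, div_div]
    congr 1 <;> ring
  have hN0 := one_le_mink_lift o1 o2
  rw [hd] at hN0
  have hNN : (y₁ ^ 2 + y₂ ^ 2 + (x₁ - x₂) ^ 2) / 2 / |y₁ * y₂| ≤
      (y₁ ^ 2 + y₂ ^ 2 + (x₁ - x₂) ^ 2 + B) / 2 / |y₁ * y₂| :=
    div_le_div_of_nonneg_right (by linarith) (abs_nonneg _)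
  have hm0 := Real.arcosh_nonneg (hN0.trans hNN)
  have hdist : ordDist (chart (x₁, x₁ ^ 2 + y₁ ^ 2)) (chart (x₂, x₂ ^ 2 + y₂ ^ 2)) =
      Real.arcosh ((y₁ ^ 2 + y₂ ^ 2 + (x₁ - x₂) ^ 2) / 2 / |y₁ * y₂|) := by
    rw [ordDist_eq, hd]
  obtain ⟨m, hm⟩ : ∃ m : ℝ≥0, (m : ℝ) =
      Real.arcosh ((y₁ ^ 2 + y₂ ^ 2 + (x₁ - x₂) ^ 2 + B) / 2 / |y₁ * y₂|) :=
    ⟨Real.toNNReal _, Real.coe_toNNReal _ hm0⟩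
  refine ⟨_, _, m, o1, o2, ?_, ?_, hm, hdist⟩
  · rw [hdist, hm, Real.arcosh_le_arcosh (by linarith) (by linarith)]
    exact hNN
  rcases hB.eq_or_lt with hB0 | hB0
  · subst hB0
    rw [h.eq_segment rfl, chart_image_segment (add_one_pos_of_sq_le l1.le)
      (add_one_pos_of_sq_le l2.le)]
    apply segment_eq_ellipse o1 o2
    rw [hdist, hm, add_zero]
  · refine h.image_eq (fun x hx => hx.1) (fun z hz => ?_) (fun p hp => ?_)
    · have hlt : ordDist (chart (x₁, x₁ ^ 2 + y₁ ^ 2)) (chart (x₂, x₂ ^ 2 + y₂ ^ 2)) <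
          m := by
        rw [hdist, hm, Real.arcosh_lt_arcosh (by linarith) (by linarith)]
        exact div_lt_div_of_pos_right (by linarith) (by positivity)
      rw [mem_ellipse_iff_of_lt o1 o2 (isOrdinary_chart hz) hlt, hm,
        Real.cosh_arcosh (hN0.trans hNN), mink_lift_chart h₁ hz, mink_lift_chart h₂ hz,
        h.eq_conic hB0]
      change 0 ≤ conic _ _ _ _ _ _ ↔ _
      have hδ : 0 < z.2 - z.1 ^ 2 := by linarith
      have hs : √(z.2 - z.1 ^ 2) ^ 2 = z.2 - z.1 ^ 2 := Real.sq_sqrt hδ.le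
      have hs0 := Real.sqrt_pos.2 hδ
      -- Clearing the denominators of the two hyperbolic cosines and of `cosh m` multiplies by `4
      -- y₁² y₂² (q - u²)`, positive at ordinary points.
      have e : conic x₁ y₁ x₂ y₂ B z = 4 * y₁ ^ 2 * y₂ ^ 2 * (z.2 - z.1 ^ 2) *
          (((z.2 + x₁ ^ 2 + y₁ ^ 2 - 2 * z.1 * x₁) / (2 * |y₁| * √(z.2 - z.1 ^ 2))) ^ 2 +
            ((z.2 + x₂ ^ 2 + y₂ ^ 2 - 2 * z.1 * x₂) / (2 * |y₂| * √(z.2 - z.1 ^ 2))) ^ 2 -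
            2 * ((y₁ ^ 2 + y₂ ^ 2 + (x₁ - x₂) ^ 2 + B) / 2 / |y₁ * y₂|) *
              ((z.2 + x₁ ^ 2 + y₁ ^ 2 - 2 * z.1 * x₁) / (2 * |y₁| * √(z.2 - z.1 ^ 2))) *
              ((z.2 + x₂ ^ 2 + y₂ ^ 2 - 2 * z.1 * x₂) / (2 * |y₂| * √(z.2 - z.1 ^ 2))) +
            ((y₁ ^ 2 + y₂ ^ 2 + (x₁ - x₂) ^ 2 + B) / 2 / |y₁ * y₂|) ^ 2 - 1) := by
        generalize √(z.2 - z.1 ^ 2) = s at hs hs0 ⊢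
        rw [abs_mul, conic, show z.2 = s ^ 2 + z.1 ^ 2 by linarith, ← sq_abs y₁, ← sq_abs y₂]
        generalize |y₁| = η₁ at a1 ⊢
        generalize |y₂| = η₂ at a2 ⊢
        field_simp
        ring
      rw [e, mul_nonneg_iff_of_pos_left (by positivity)]
    · constructor
      · intro hpS
        rcases h.asymptotic hp hpS with ⟨-, h0⟩ | ⟨-, h0⟩
        exacts [absurd h0 h₁, absurd h0 h₂]
      · intro hpT
        exact absurd ((mem_ellipse o1 o2).1 hpT).1 hp.not_isOrdinary

/-! ## Operators with a single real eigenvalue -/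

/-- The real eigenvalue becomes the asymptotic focus. For `y₂ = 0`, comparing `conic` with
`mem_parabola_iff_of_lt` gives the horocycle constant `κ`; `B = 0` yields the half-line, where `κ`
would equal the value at the focus. -/
lemma IsShell.eq_parabola {S : Set (ℝ × ℝ)} {x₁ y₁ x₂ B : ℝ} (h : IsShell S x₁ y₁ x₂ 0 B)
    (h₁ : y₁ ≠ 0) :
    ∃ (F ξ : ℝ × ℝ) (c : ℝ), IsOrdinary F ∧ IsAsymptotic ξ ∧ horoDist ξ F - c ≤ 0 ∧
      chart '' S = parabola F ξ c := by
  have q1 : 0 < y₁ ^ 2 := by positivity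
  have a1 : 0 < |y₁| := abs_pos.2 h₁
  have hB := h.nonneg
  have l1 : (x₁, x₁ ^ 2 + y₁ ^ 2).1 ^ 2 < (x₁, x₁ ^ 2 + y₁ ^ 2).2 := by simp only []; linarith
  have o1 := isOrdinary_chart l1
  have o2 : IsAsymptotic (chart (x₂, x₂ ^ 2)) := isAsymptotic_chart rfl
  have hf : mink (hom (chart (x₂, x₂ ^ 2))) (lift (chart (x₁, x₁ ^ 2 + y₁ ^ 2))) =
      (y₁ ^ 2 + (x₁ - x₂) ^ 2) / ((x₂ ^ 2 + 1) * |y₁|) := by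
    rw [mink_hom_chart x₂ l1, show x₁ ^ 2 + y₁ ^ 2 - x₁ ^ 2 = y₁ ^ 2 by ring,
      Real.sqrt_sq_eq_abs]
    congr 1; ring
  rcases hB.eq_or_lt with hB0 | hB0
  · refine ⟨_, _, _, o1, o2, le_of_eq (sub_self _), ?_⟩
    rw [h.eq_segment hB0.symm, ← segment_eq_parabola o1 o2, chart_image_segment
      (add_one_pos_of_sq_le l1.le) (by positivity)]
    simp
  · have hlt : mink (hom (chart (x₂, x₂ ^ 2))) (lift (chart (x₁, x₁ ^ 2 + y₁ ^ 2))) <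
        (y₁ ^ 2 + (x₁ - x₂) ^ 2 + B) / ((x₂ ^ 2 + 1) * |y₁|) := by
      rw [hf]
      exact div_lt_div_of_pos_right (by linarith) (by positivity)
    refine ⟨_, _, Real.log ((y₁ ^ 2 + (x₁ - x₂) ^ 2 + B) / ((x₂ ^ 2 + 1) * |y₁|)), o1, o2, ?_, ?_⟩
    · rw [horoDist_eq, sub_nonpos]
      exact Real.log_le_log (mink_hom_lift_pos o2 o1) hlt.le
    refine h.image_eq (parabola_subset o2) (fun z hz => ?_) (fun p hp => ?_)
    · have hzo := isOrdinary_chart hz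
      have hmem : ∀ c, chart z ∈ parabola (chart (x₁, x₁ ^ 2 + y₁ ^ 2)) (chart (x₂, x₂ ^ 2)) c ↔
          ordDist (chart (x₁, x₁ ^ 2 + y₁ ^ 2)) (chart z)
            + (horoDist (chart (x₂, x₂ ^ 2)) (chart z) - c) ≤ 0 := fun c => by
        constructor
        · rintro (h0 | ⟨-, h0⟩)
          · rw [h0] at hzo; exact absurd hzo o2.not_isOrdinary
          · exact h0
        · intro h0; exact Or.inr ⟨hzo, h0⟩
      rw [hmem, mem_parabola_iff_of_lt o1 o2 hzo hlt, mink_lift_chart h₁ hz,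
        mink_hom_chart x₂ hz, h.eq_conic hB0]
      change 0 ≤ conic _ _ _ _ _ _ ↔ _
      have hδ : 0 < z.2 - z.1 ^ 2 := by linarith
      have hs : √(z.2 - z.1 ^ 2) ^ 2 = z.2 - z.1 ^ 2 := Real.sq_sqrt hδ.le
      have hs0 := Real.sqrt_pos.2 hδ
      have hx : 0 < x₂ ^ 2 + 1 := by positivity
      have e : conic x₁ y₁ x₂ 0 B z = y₁ ^ 2 * (x₂ ^ 2 + 1) ^ 2 * (z.2 - z.1 ^ 2) *
          (((y₁ ^ 2 + (x₁ - x₂) ^ 2 + B) / ((x₂ ^ 2 + 1) * |y₁|)) ^ 2 +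
            ((z.2 + x₂ ^ 2 - 2 * z.1 * x₂) / ((x₂ ^ 2 + 1) * √(z.2 - z.1 ^ 2))) ^ 2 -
            2 * ((y₁ ^ 2 + (x₁ - x₂) ^ 2 + B) / ((x₂ ^ 2 + 1) * |y₁|)) *
              ((z.2 + x₁ ^ 2 + y₁ ^ 2 - 2 * z.1 * x₁) / (2 * |y₁| * √(z.2 - z.1 ^ 2))) *
              ((z.2 + x₂ ^ 2 - 2 * z.1 * x₂) / ((x₂ ^ 2 + 1) * √(z.2 - z.1 ^ 2)))) := by
        generalize √(z.2 - z.1 ^ 2) = s at hs hs0 ⊢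
        rw [conic, show z.2 = s ^ 2 + z.1 ^ 2 by linarith, ← sq_abs y₁]
        generalize |y₁| = η₁ at a1 ⊢
        field_simp
        ring
      rw [e, mul_nonneg_iff_of_pos_left (by positivity), sub_nonneg]
    · constructor
      · intro hpS
        rcases h.asymptotic hp hpS with ⟨-, h0⟩ | ⟨h0, -⟩
        · exact absurd h0 h₁
        · rw [h0]; exact Set.mem_insert _ _
      · intro hpT
        rw [mem_parabola_asymptotic hp hpT]
        exact ⟨_, h.mem_right, rfl⟩

/-! ## Operators with real eigenvalues only -/

/-- With both eigenvalues real and distinct, `conic` compares the product of the two Busemann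
factors with a constant; `mem_band_ordinary` then gives `cosh² r = ((x₁ - x₂)² + B) / (x₁ - x₂)²`.
-/
lemma IsShell.eq_band {S : Set (ℝ × ℝ)} {x₁ x₂ B : ℝ} (h : IsShell S x₁ 0 x₂ 0 B)
    (hne : x₁ ≠ x₂) :
    ∃ (ξ η : ℝ × ℝ) (r : ℝ≥0), IsAsymptotic ξ ∧ IsAsymptotic η ∧ ξ ≠ η ∧
      chart '' S = band ξ η r := by
  have o1 : IsAsymptotic (chart (x₁, x₁ ^ 2)) := isAsymptotic_chart rfl
  have o2 : IsAsymptotic (chart (x₂, x₂ ^ 2)) := isAsymptotic_chart rfl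
  have p1 : 0 < x₁ ^ 2 + 1 := by positivity
  have p2 : 0 < x₂ ^ 2 + 1 := by positivity
  have hne' : chart (x₁, x₁ ^ 2) ≠ chart (x₂, x₂ ^ 2) := fun h0 =>
    hne (congrArg Prod.fst (chart_injective p1 p2 h0))
  have hΔ : 0 < (x₁ - x₂) ^ 2 := by
    have := sub_ne_zero.2 hne
    positivity
  have hB := h.nonneg
  rcases hB.eq_or_lt with hB0 | hB0
  · refine ⟨_, _, 0, o1, o2, hne', ?_⟩
    rw [← segment_eq_band o1 o2 hne', ← chart_image_segment p1 p2, h.eq_segment hB0.symm]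
    simp
  · have hC : 1 ≤ √(((x₁ - x₂) ^ 2 + B) / (x₁ - x₂) ^ 2) := by
      rw [Real.one_le_sqrt, one_le_div hΔ]
      linarith
    obtain ⟨r, hr⟩ : ∃ r : ℝ≥0, (r : ℝ) = Real.arcosh √(((x₁ - x₂) ^ 2 + B) / (x₁ - x₂) ^ 2) :=
      ⟨Real.toNNReal _, Real.coe_toNNReal _ (Real.arcosh_nonneg hC)⟩
    refine ⟨_, _, r, o1, o2, hne', ?_⟩
    refine h.image_eq (fun x hx => hx.1) (fun z hz => ?_) (fun p hp => ?_)
    · rw [mem_band_ordinary o1 o2 hne' (isOrdinary_chart hz), hr, Real.cosh_arcosh hC,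
        Real.sq_sqrt (by positivity), mink_hom_chart x₁ hz, mink_hom_chart x₂ hz,
        mink_hom_chart_hom, h.eq_conic hB0]
      change 0 ≤ conic _ _ _ _ _ _ ↔ _
      have hδ : 0 < z.2 - z.1 ^ 2 := by linarith
      have hs : √(z.2 - z.1 ^ 2) ^ 2 = z.2 - z.1 ^ 2 := Real.sq_sqrt hδ.le
      have hs0 := Real.sqrt_pos.2 hδ
      have e : conic x₁ 0 x₂ 0 B z =
          ((x₁ - x₂) ^ 2 + B) * (z.2 - z.1 ^ 2) * ((x₁ ^ 2 + 1) * (x₂ ^ 2 + 1)) / 2 *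
          (2 * (x₁ - x₂) ^ 2 / ((x₁ ^ 2 + 1) * (x₂ ^ 2 + 1))
              * (((x₁ - x₂) ^ 2 + B) / (x₁ - x₂) ^ 2) -
            2 * ((z.2 + x₁ ^ 2 - 2 * z.1 * x₁) / ((x₁ ^ 2 + 1) * √(z.2 - z.1 ^ 2))) *
              ((z.2 + x₂ ^ 2 - 2 * z.1 * x₂) / ((x₂ ^ 2 + 1) * √(z.2 - z.1 ^ 2)))) := by
        generalize √(z.2 - z.1 ^ 2) = s at hs hs0 ⊢
        rw [conic, show z.2 = s ^ 2 + z.1 ^ 2 by linarith]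
        field_simp
        ring
      rw [e, mul_nonneg_iff_of_pos_left (by positivity), sub_nonneg]
    · rw [mem_band_asymptotic o1 o2 hp]
      constructor
      · intro hpS
        rcases h.asymptotic hp hpS with ⟨h0, -⟩ | ⟨h0, -⟩
        exacts [Or.inl h0, Or.inr h0]
      · rintro (rfl | rfl)
        exacts [⟨_, h.mem_left, rfl⟩, ⟨_, h.mem_right, rfl⟩]

/-- For a double real eigenvalue the two Busemann factors coincide, so `conic` bounds the square of
one. The ordinary point supplied is a zero of `conic`; it guarantees an axis of infinite length. -/
lemma IsShell.eq_horodisk {S : Set (ℝ × ℝ)} {x B : ℝ} (h : IsShell S x 0 x 0 B) (hB : 0 < B) :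
    ∃ (ξ : ℝ × ℝ) (c : ℝ), IsAsymptotic ξ ∧ chart '' S = horodisk ξ c ∧
      ∃ p ∈ chart '' S, IsOrdinary p := by
  have o1 : IsAsymptotic (chart (x, x ^ 2)) := isAsymptotic_chart rfl
  have p1 : 0 < x ^ 2 + 1 := by positivity
  have hb := Real.sqrt_pos.2 hB
  refine ⟨_, Real.log (√B / (x ^ 2 + 1)), o1, ?_, chart (x, x ^ 2 + B), ⟨_, ?_, rfl⟩,
    isOrdinary_chart (by simp only []; linarith)⟩
  · refine h.image_eq (horodisk_subset o1) (fun z hz => ?_) (fun p hp => ?_)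
    · have hzo := isOrdinary_chart hz
      have hmem : ∀ c, chart z ∈ horodisk (chart (x, x ^ 2)) c ↔
          horoDist (chart (x, x ^ 2)) (chart z) - c ≤ 0 := fun c => by
        constructor
        · rintro (h0 | ⟨-, h0⟩)
          · rw [h0] at hzo; exact absurd hzo o1.not_isOrdinary
          · exact h0
        · intro h0; exact Or.inr ⟨hzo, h0⟩
      have hpos := mink_hom_lift_pos o1 hzo
      rw [hmem, mem_horodisk_iff o1 hzo (by positivity),
        ← sq_le_sq₀ hpos.le (by positivity), div_pow, Real.sq_sqrt hB.le, mink_hom_chart x hz,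
        h.eq_conic hB]
      change 0 ≤ conic _ _ _ _ _ _ ↔ _
      have hδ : 0 < z.2 - z.1 ^ 2 := by linarith
      have hs : √(z.2 - z.1 ^ 2) ^ 2 = z.2 - z.1 ^ 2 := Real.sq_sqrt hδ.le
      have hs0 := Real.sqrt_pos.2 hδ
      have e : conic x 0 x 0 B z = B * (z.2 - z.1 ^ 2) * (x ^ 2 + 1) ^ 2 *
          (B / (x ^ 2 + 1) ^ 2 -
            ((z.2 + x ^ 2 - 2 * z.1 * x) / ((x ^ 2 + 1) * √(z.2 - z.1 ^ 2))) ^ 2) := by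
        generalize √(z.2 - z.1 ^ 2) = s at hs hs0 ⊢
        rw [conic, show z.2 = s ^ 2 + z.1 ^ 2 by linarith]
        field_simp
        ring
      rw [e, mul_nonneg_iff_of_pos_left (by positivity), sub_nonneg]
    · constructor
      · intro hpS
        rcases h.asymptotic hp hpS with ⟨h0, -⟩ | ⟨h0, -⟩ <;>
          (rw [h0]; exact Set.mem_insert _ _)
      · intro hpT
        rw [mem_horodisk_asymptotic hp hpT]
        exact ⟨_, h.mem_left, rfl⟩
  · rw [h.eq_conic hB]
    change 0 ≤ conic _ _ _ _ _ _
    apply le_of_eq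
    simp only [conic]
    ring

lemma IsShell.eq_singleton {S : Set (ℝ × ℝ)} {x : ℝ} (h : IsShell S x 0 x 0 0) :
    chart '' S = {chart (x, x ^ 2)} := by
  rw [h.eq_segment rfl, segment_same]
  simp

/-! ## Major axes and foci of conformal ranges -/

lemma extArcosh_extQuot_of_ne_zero {a b : ℝ} (hb : b ≠ 0) (hab : 0 ≤ a / b) :
    extArcosh (extQuot a b) = ENNReal.ofReal (Real.arcosh (a / b)) := by
  rw [extQuot, if_neg hb, extArcosh, if_neg ENNReal.ofReal_ne_top, ENNReal.toReal_ofReal hab]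

lemma extArcosh_extQuot_zero {a : ℝ} (ha : a ≠ 0) : extArcosh (extQuot a 0) = ∞ := by
  rw [extQuot, if_pos rfl, if_neg ha, extArcosh, if_pos rfl]

lemma extArcosh_extQuot_zero_zero : extArcosh (extQuot 0 0) = 0 := by
  rw [extQuot, if_pos rfl, if_pos rfl, extArcosh, if_neg ENNReal.one_ne_top, ENNReal.toReal_one,
    Real.arcosh_zero, ENNReal.ofReal_zero]

/-- `K` has a major axis and a pair of foci, all its major axes have length `a`, and all its pairs
of foci have distance `f`. -/
def HasMajorFocal (K : Set (ℝ × ℝ)) (a f : ℝ≥0∞) : Prop :=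
  ((∃ p q, IsMajorAxis K p q) ∧ ∀ p q, IsMajorAxis K p q → hdist p q = a) ∧
    ((∃ p q, IsFociPair K p q) ∧ ∀ p q, IsFociPair K p q → hdist p q = f)

/-! ### Axes and foci of the five types of sets -/

lemma hasMajorFocal_ellipse {F₁ F₂ : ℝ × ℝ} {m : ℝ≥0} (h₁ : IsOrdinary F₁) (h₂ : IsOrdinary F₂)
    (hm : ordDist F₁ F₂ ≤ m) :
    HasMajorFocal (ellipse F₁ F₂ m) m (ENNReal.ofReal (ordDist F₁ F₂)) := by
  refine ⟨⟨exists_isMajorAxis_ellipse h₁ h₂ hm,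
    fun _ _ h => hdist_of_isMajorAxis_ellipse h₁ h₂ hm h⟩, ⟨F₁, F₂, ?_⟩,
    fun _ _ h => hdist_of_isFociPair_ellipse h₁ h₂ hm h⟩
  refine .ellipse _ _ m h₁ h₂ ?_ rfl
  rwa [hdist_ordinary h₁ h₂, ofReal_le_coe_iff]

lemma hasMajorFocal_parabola {F ξ : ℝ × ℝ} {c : ℝ} (hF : IsOrdinary F) (hξ : IsAsymptotic ξ)
    (hc : horoDist ξ F - c ≤ 0) (hconv : Convex ℝ (parabola F ξ c))
    (hcomp : IsCompact (parabola F ξ c)) : HasMajorFocal (parabola F ξ c) ∞ ∞ := by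
  have hmem : ξ ∈ parabola F ξ c := Set.mem_insert _ _
  have hK : {x ∈ parabola F ξ c | IsAsymptotic x} = {ξ} :=
    Set.eq_singleton_iff_unique_mem.2
      ⟨⟨hmem, hξ⟩, fun x hx => mem_parabola_asymptotic hx.2 hx.1⟩
  obtain ⟨η, hη⟩ := exists_axis_parabola c hF hξ
  exact ⟨⟨exists_isMajorAxis_semibounded hconv hcomp hK hη,
    fun _ _ h => hdist_of_isMajorAxis_semibounded hconv (parabola_subset hξ) hmem hξ
      (focus_mem_parabola hF hc) hF h⟩,
    ⟨F, ξ, .parabola _ _ c hF hξ hc rfl⟩, fun _ _ h => hdist_of_isFociPair_parabola hF hξ hc h⟩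

lemma hasMajorFocal_band {ξ η : ℝ × ℝ} (r : ℝ≥0) (hξ : IsAsymptotic ξ) (hη : IsAsymptotic η)
    (hne : ξ ≠ η) : HasMajorFocal (band ξ η r) ∞ ∞ :=
  ⟨⟨⟨ξ, η, .band _ _ hξ hη hne (segment_subset_band r hξ hη)⟩,
    fun _ _ h => hdist_of_isMajorAxis_band ((mem_band_asymptotic hξ hη hξ).2 (Or.inl rfl)) hξ
      ((mem_band_asymptotic hξ hη hη).2 (Or.inr rfl)) hη hne h⟩,
    ⟨ξ, η, .band _ _ r hξ hη hne rfl⟩, fun _ _ h => hdist_of_isFociPair_band hξ hη hne h⟩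

lemma hasMajorFocal_horodisk {ξ x : ℝ × ℝ} {c : ℝ} (hξ : IsAsymptotic ξ)
    (hconv : Convex ℝ (horodisk ξ c)) (hcomp : IsCompact (horodisk ξ c))
    (hx : x ∈ horodisk ξ c) (hxo : IsOrdinary x) : HasMajorFocal (horodisk ξ c) ∞ 0 := by
  have hmem : ξ ∈ horodisk ξ c := Set.mem_insert _ _
  have hK : {x ∈ horodisk ξ c | IsAsymptotic x} = {ξ} :=
    Set.eq_singleton_iff_unique_mem.2
      ⟨⟨hmem, hξ⟩, fun x hx => mem_horodisk_asymptotic hx.2 hx.1⟩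
  obtain ⟨η, hη⟩ := exists_axis_horodisk c hξ
  exact ⟨⟨exists_isMajorAxis_semibounded hconv hcomp hK hη,
    fun _ _ h => hdist_of_isMajorAxis_semibounded hconv (horodisk_subset hξ) hmem hξ hx hxo h⟩,
    ⟨ξ, ξ, .horodisk _ c hξ rfl⟩, fun _ _ h => hdist_of_isFociPair_horodisk hξ h⟩

lemma hasMajorFocal_singleton {ξ : ℝ × ℝ} (hξ : IsAsymptotic ξ) : HasMajorFocal {ξ} 0 0 := by
  have hK : {x ∈ ({ξ} : Set (ℝ × ℝ)) | IsAsymptotic x} = {ξ} :=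
    Set.eq_singleton_iff_unique_mem.2 ⟨⟨rfl, hξ⟩, fun x hx => hx.1⟩
  obtain ⟨η, hη⟩ := exists_axis_singleton hξ
  exact ⟨⟨exists_isMajorAxis_semibounded (convex_singleton ξ) isCompact_singleton hK hη,
    fun _ _ h => hdist_of_isMajorAxis_singleton hξ h⟩,
    ⟨ξ, ξ, .asymptoticPoint _ hξ rfl⟩, fun _ _ h => hdist_of_isFociPair_singleton hξ h⟩

/-- A real eigenvalue makes the denominator zero, so only the vanishing of the numerators matters.
The focal one vanishes for a double real eigenvalue (horodisk or point), the axial one only if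
moreover `B = 0` (point); there `0 / 0 = 1` gives length `0`. -/
lemma IsShell.hasMajorFocal_of_right_real {S : Set (ℝ × ℝ)} {x₁ y₁ x₂ B : ℝ}
    (h : IsShell S x₁ y₁ x₂ 0 B) (hcomp : IsCompact (chart '' S)) :
    HasMajorFocal (chart '' S) (extArcosh (extQuot ((y₁ ^ 2 + (x₁ - x₂) ^ 2 + B) / 2) 0))
      (extArcosh (extQuot ((y₁ ^ 2 + (x₁ - x₂) ^ 2) / 2) 0)) := by
  have hconv := h.convex
  have hB := h.nonneg
  by_cases h₁ : y₁ = 0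
  · subst h₁
    by_cases hx : x₁ = x₂
    · subst hx
      rcases hB.eq_or_lt with hB0 | hB0
      · subst hB0
        rw [h.eq_singleton]
        simpa [extArcosh_extQuot_zero_zero] using
          hasMajorFocal_singleton (isAsymptotic_chart (z := (x₁, x₁ ^ 2)) rfl)
      · obtain ⟨ξ, c, hξ, hS, p, hp, hpo⟩ := h.eq_horodisk hB0
        rw [hS] at hp hcomp hconv ⊢
        rw [extArcosh_extQuot_zero (by simpa using hB0.ne')]
        simpa [extArcosh_extQuot_zero_zero] using hasMajorFocal_horodisk hξ hconv hcomp hp hpo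
    · have hΔ : 0 < (x₁ - x₂) ^ 2 := by
        have := sub_ne_zero.2 hx
        positivity
      obtain ⟨ξ, η, r, hξ, hη, hne, hS⟩ := h.eq_band hx
      rw [hS, extArcosh_extQuot_zero (by positivity), extArcosh_extQuot_zero (by positivity)]
      exact hasMajorFocal_band r hξ hη hne
  · obtain ⟨F, ξ, c, hF, hξ, hc, hS⟩ := h.eq_parabola h₁
    rw [extArcosh_extQuot_zero (by positivity), extArcosh_extQuot_zero (by positivity)]
    rw [hS] at hcomp hconv ⊢
    exact hasMajorFocal_parabola hF hξ hc hconv hcomp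

lemma IsShell.hasMajorFocal {S : Set (ℝ × ℝ)} {x₁ y₁ x₂ y₂ B : ℝ} (h : IsShell S x₁ y₁ x₂ y₂ B)
    (hcomp : IsCompact (chart '' S)) :
    HasMajorFocal (chart '' S)
      (extArcosh (extQuot ((y₁ ^ 2 + y₂ ^ 2 + (x₁ - x₂) ^ 2 + B) / 2) |y₁ * y₂|))
      (extArcosh (extQuot ((y₁ ^ 2 + y₂ ^ 2 + (x₁ - x₂) ^ 2) / 2) |y₁ * y₂|)) := by
  have hB := h.nonneg
  by_cases h₂ : y₂ = 0
  · subst h₂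
    simpa using h.hasMajorFocal_of_right_real hcomp
  by_cases h₁ : y₁ = 0
  · subst h₁
    simpa [← sub_sq_comm x₁ x₂] using h.swap.hasMajorFocal_of_right_real hcomp
  obtain ⟨F₁, F₂, m, o₁, o₂, hm, hS, hm', hd⟩ := h.eq_ellipse h₁ h₂
  have hy : |y₁ * y₂| ≠ 0 := abs_ne_zero.2 (mul_ne_zero h₁ h₂)
  rw [hS, extArcosh_extQuot_of_ne_zero hy (by positivity),
    extArcosh_extQuot_of_ne_zero hy (by positivity), ← hm', ← hd, ENNReal.ofReal_coe_nnreal]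
  exact hasMajorFocal_ellipse o₁ o₂ hm

end ConformalRange

theorem mainTheorem3 {H : Type*} [NormedAddCommGroup H] [InnerProductSpace ℂ H]
    [FiniteDimensional ℂ H] (hH : Module.finrank ℂ H = 2) (A : H →ₗ[ℂ] H) :
    ((∃ p q : ℝ × ℝ, ConformalRange.IsMajorAxis (ConformalRange.conformalRange A) p q) ∧
      ∀ p q : ℝ × ℝ, ConformalRange.IsMajorAxis (ConformalRange.conformalRange A) p q →
        ConformalRange.hdist p q / 2 =
          ConformalRange.extArcosh
            (ConformalRange.extQuot
              (ConformalRange.metricDisc A + ConformalRange.conjDisc A)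
              |ConformalRange.conjDisc A - ‖ConformalRange.specDisc A‖|) / 2) ∧
    ((∃ F₁ F₂ : ℝ × ℝ, ConformalRange.IsFociPair (ConformalRange.conformalRange A) F₁ F₂) ∧
      ∀ F₁ F₂ : ℝ × ℝ, ConformalRange.IsFociPair (ConformalRange.conformalRange A) F₁ F₂ →
        ConformalRange.hdist F₁ F₂ / 2 =
          ConformalRange.extArcosh
            (ConformalRange.extQuot
              (ConformalRange.conjDisc A + ‖ConformalRange.specDisc A‖)
              |ConformalRange.conjDisc A - ‖ConformalRange.specDisc A‖|) / 2) := by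
  obtain ⟨e, l₁, l₂, β, h⟩ := ConformalRange.exists_isTriangular hH A
  have hK : ConformalRange.conformalRange A =
      ConformalRange.chart '' ConformalRange.shell A := ConformalRange.conformalRange_eq_image A
  have hcomp := ConformalRange.isCompact_conformalRange A
  rw [hK] at hcomp ⊢
  obtain ⟨⟨h1, h2⟩, h3, h4⟩ := h.isShell.hasMajorFocal hcomp
  rw [h.metricDisc, h.conjDisc, h.norm_specDisc]
  -- The three identities express the invariants of the statement through the triangular form; the
  -- last one is `E_A - |D_A| = y₁ y₂`.
  have e1 : ((l₁.re - l₂.re) ^ 2 + (l₁.im - l₂.im) ^ 2) / 4 + Complex.normSq β / 2 +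
      ((l₁.im + l₂.im) ^ 2 / 4 + (l₁.re - l₂.re) ^ 2 / 4) =
      (l₁.im ^ 2 + l₂.im ^ 2 + (l₁.re - l₂.re) ^ 2 + Complex.normSq β) / 2 := by ring
  have e2 : (l₁.im + l₂.im) ^ 2 / 4 + (l₁.re - l₂.re) ^ 2 / 4 +
      ((l₁.re - l₂.re) ^ 2 + (l₁.im - l₂.im) ^ 2) / 4 =
      (l₁.im ^ 2 + l₂.im ^ 2 + (l₁.re - l₂.re) ^ 2) / 2 := by ring
  have e3 : (l₁.im + l₂.im) ^ 2 / 4 + (l₁.re - l₂.re) ^ 2 / 4 -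
      ((l₁.re - l₂.re) ^ 2 + (l₁.im - l₂.im) ^ 2) / 4 = l₁.im * l₂.im := by ring
  rw [e1, e2, e3]
  exact ⟨⟨h1, fun p q hpq => by rw [h2 p q hpq]⟩, h3, fun p q hpq => by rw [h4 p q hpq]⟩
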